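/- Let $n\ge 2$, let $B\subset\mathbb R^n$ be the open unit ball, and let $M\subset\mathbb S^{n-1}=\partial B$ be an oriented closed (i.e. compact, without boundary) smooth embedded $(n-2)$-dimensional submanifold, with associated integration current $[M]$. Let $C(M)=\{tx: t\ge 0,\ x\in M\}$ be the cone over $M$, and $E=C(M)\cap\overline B$. Let $w$ be a coflat calibration in $B$ with singular set $S_w$: $w$ is a measurable $(n-1)$-form on $B$, $S_w\subset B$ is relatively closed with $\mathcal H^{n-1}(S_w)=0$, $w$ is $C^1$, closed ($dw=0$) and nowhere zero on $B\setminus S_w$, and $\|w\|_\infty\le 1$ (comass norm). If $w=\sum_{i=1}^n(-1)^{i-1}v_i\,e_1^*\wedge\cdots\wedge\widehat{e_i^*}\wedge\cdots\wedge e_n^*$, let $w_\perp=\sum_i v_ie_i$; it is a vector field orthogonal to the hyperplanes associated with $w$. Suppose that $E$ is calibrated by $w$ with respect to $[M]$ in $B$, written $E\in C([M],w,B)$. This means that $[M]$ is an integral current without boundary, that $E$ is a closed subset of $\overline B$ with $E\cap\partial B=\operatorname{spt}[M]\subset\partial B$, and that there is an integral $(n-1)$-current $T$ with $\operatorname{spt}T=E$,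 mass $\mathbf M(T)=\mathcal H^{n-1}(E)$, $\partial T=[M]$ and $\mathcal H^{n-1}(E)=\langle T,w\rangle$. Then $E$ is of multiplicity one with respect to the $C^1$ vector field $w_\perp|_{B\setminus S_w}$: every maximal integral curve of $w_\perp$ in $B\setminus S_w$ meets $E$ in at most one point, and every point of $E\setminus S_w$ in $B$ lies on such a curve. Consequently $E\in C_1([M],w,B)$, the class of all sets in $C([M],w,B)$ that are of multiplicity one with respect to $w_\perp|_{B\setminus S_w}$. -/

import Mathlib

set_option maxSynthPendingDepth 3

open MeasureTheory Set Filter Topology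
open scoped Distributions ContDiff ENNReal

noncomputable section

namespace CoflatCone

/-- Euclidean space `ℝⁿ`. -/
abbrev Eu (n : ℕ) : Type := EuclideanSpace ℝ (Fin n)

/-- `k`-covectors of `ℝⁿ`. Their norm as alternating maps, the supremum of `|ω (v₁, …, v_k)|` over
vectors of norm at most one, is the comass norm. -/
abbrev Covec (n k : ℕ) : Type := (Eu n) [⋀^Fin k]→L[ℝ] ℝ

/-- `k`-vectors of `ℝⁿ`, as the dual space of the `k`-covectors. -/
abbrev MVec (n k : ℕ) : Type := Covec n k →L[ℝ] ℝ

/-- The simple `k`-vector `e₁ ∧ ⋯ ∧ e_k`. -/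
def wedge {n k : ℕ} (e : Fin k → Eu n) : MVec n k :=
  (ContinuousMultilinearMap.apply ℝ (fun _ : Fin k => Eu n) ℝ e).comp
    (ContinuousAlternatingMap.toContinuousMultilinearMapCLM ℝ)

/-- `ξ` is one of the two unit simple `k`-vectors orienting the `k`-dimensional subspace `P`. The
explicit sign matters only for `k = 0`, where an orientation is a sign. -/
def Orients {n k : ℕ} (ξ : MVec n k) (P : Submodule ℝ (Eu n)) : Prop :=
  ∃ e : Fin k → Eu n, Orthonormal ℝ e ∧ Submodule.span ℝ (range e) = P ∧
    (ξ = wedge e ∨ ξ = -wedge e)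

/-! ### Currents -/

/-- Smooth `k`-forms with compact support in `ℝⁿ`. -/
abbrev TestForm (n k : ℕ) : Type := 𝓓((⊤ : TopologicalSpace.Opens (Eu n)), Covec n k)

/-- `k`-dimensional currents in `ℝⁿ` (in the sense of de Rham). -/
abbrev Current (n k : ℕ) : Type := TestForm n k →L[ℝ] ℝ

/-- Exterior derivative of test forms. -/
def dTest (n k : ℕ) : TestForm n k →L[ℝ] TestForm n (k + 1) :=
  (TestFunction.postcompCLM
      (ContinuousAlternatingMap.alternatizeUncurryFinCLM ℝ (Eu n) ℝ)).comp
    (TestFunction.fderivCLM ℝ ⊤ ⊤)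

theorem dTest_apply {n k : ℕ} (φ : TestForm n k) (x : Eu n) :
    dTest n k φ x = extDeriv (φ : Eu n → Covec n k) x := by
  simp [dTest, extDeriv]

/-- Boundary of a current, `∂T (φ) = T (dφ)`. -/
def Current.bdry {n k : ℕ} (T : Current n (k + 1)) : Current n k := T.comp (dTest n k)

/-- A current without boundary; every `0`-dimensional current is one. -/
def Current.IsCycle {n : ℕ} : {k : ℕ} → Current n k → Prop
  | 0, _ => True
  | _ + 1, T => T.bdry = 0

/-- Support of a current. -/
def Current.spt {n k : ℕ} (T : Current n k) : Set (Eu n) :=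
  Distribution.dsupport (T : TestForm n k → ℝ)

/-- Mass of a current: the supremum of `T φ` over the test forms of comass at most one. -/
def Current.mass {n k : ℕ} (T : Current n k) : ℝ≥0∞ :=
  ⨆ (φ : TestForm n k) (_ : ∀ x, ‖φ x‖ ≤ 1), ENNReal.ofReal (T φ)

/-- The current `φ ↦ ∫ ⟨η(x), φ(x)⟩ dμ(x)` of a locally `μ`-integrable field `η` of `k`-vectors. -/
def currentOf {n k : ℕ} (μ : Measure (Eu n)) (η : Eu n → MVec n k) : Current n k :=
  TestFunction.integralAgainstBilinCLM (ContinuousLinearMap.id ℝ (MVec n k)).flip μ η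

theorem currentOf_apply {n k : ℕ} {μ : Measure (Eu n)} {η : Eu n → MVec n k}
    (h : LocallyIntegrable η μ) (φ : TestForm n k) :
    currentOf μ η φ = ∫ x, η x (φ x) ∂μ := by
  have h' : LocallyIntegrableOn η ((⊤ : TopologicalSpace.Opens (Eu n)) : Set (Eu n)) μ :=
    fun x _ => (h x).filter_mono nhdsWithin_le_nhds
  unfold currentOf
  rw [TestFunction.integralAgainstBilinCLM_eq_integral h']
  rfl

/-! ### Rectifiable sets, integral currents

`μHE[k]` is the `k`-dimensional Hausdorff measure, normalized so that it is Lebesgue measure on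
`k`-dimensional subspaces. -/

/-- Countably `k`-rectifiable set: `ℋᵏ`-almost all of it is covered by countably many Lipschitz
images of `ℝᵏ`. -/
def CountablyRectifiable {n : ℕ} (k : ℕ) (S : Set (Eu n)) : Prop :=
  ∃ f : ℕ → Eu k → Eu n, (∀ i, ∃ K, LipschitzWith K (f i)) ∧
    μHE[k] (S \ ⋃ i, range (f i)) = 0

/-- `P` is an approximate tangent `k`-plane of `S` at `x`: the upper `k`-density of `S` at `x` is
positive, and for each aperture `s` the part of `S` outside of the cone of aperture `s` around
`x + P` has density zero at `x`. -/
def IsApproxTangent {n : ℕ} (k : ℕ) (S : Set (Eu n)) (x : Eu n) (P : Submodule ℝ (Eu n)) : Prop :=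
  0 < limsup (fun r : ℝ => μHE[k] (S ∩ Metric.closedBall x r) / ENNReal.ofReal (r ^ k)) (𝓝[>] 0) ∧
  ∀ s : ℝ, 0 < s →
    Tendsto (fun r : ℝ =>
      μHE[k] {y ∈ S ∩ Metric.closedBall x r | s * ‖y - x‖ < Metric.infDist (y - x) P} /
        ENNReal.ofReal (r ^ k)) (𝓝[>] 0) (𝓝 0)

/-- `S` is a rectifiable set, `θ` an integrable positive integer multiplicity on `S`, and `ξ` a
measurable orientation of the approximate tangent planes of `S`. -/
structure IsRectifiableTriple {n k : ℕ} (S : Set (Eu n)) (θ : Eu n → ℕ) (ξ : Eu n → MVec n k) :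
    Prop where
  measurableSet : MeasurableSet S
  rectifiable : CountablyRectifiable k S
  one_le : ∀ x ∈ S, 1 ≤ θ x
  integrable : IntegrableOn (fun x => (θ x : ℝ)) S μHE[k]
  measurable_orient : AEStronglyMeasurable ξ (μHE[k].restrict S)
  orient : ∀ᵐ x ∂(μHE[k].restrict S), ∃ P, IsApproxTangent k S x P ∧ Orients (ξ x) P

/-- `T = ℋᵏ⌊_S ∧ θ ξ` for a rectifiable set with integer multiplicity and orientation. -/
def Current.IsGivenBy {n k : ℕ} (T : Current n k) (S : Set (Eu n)) (θ : Eu n → ℕ)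
    (ξ : Eu n → MVec n k) : Prop :=
  IsRectifiableTriple S θ ξ ∧ T = currentOf (μHE[k].restrict S) (fun x => (θ x : ℝ) • ξ x)

/-- Integer multiplicity rectifiable current with compact support. -/
def Current.IsRectifiable {n k : ℕ} (T : Current n k) : Prop :=
  IsCompact T.spt ∧ ∃ S θ ξ, T.IsGivenBy S θ ξ

/-- Integral current: rectifiable, with rectifiable boundary. -/
def Current.IsIntegral {n : ℕ} : {k : ℕ} → Current n k → Prop
  | 0, T => T.IsRectifiable
  | _ + 1, T => T.IsRectifiable ∧ T.bdry.IsRectifiable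

/-- The `k`-current `T` is associated to `E`: `spt T = E` and `M(T) = ℋᵏ(E)`. -/
def Current.IsAssociated {n k : ℕ} (T : Current n k) (E : Set (Eu n)) : Prop :=
  T.spt = E ∧ T.mass = μHE[k] E

/-- `⟨T, w⟩` for `T = ℋᵏ⌊_S ∧ θ ξ` and a `k`-form `w` which is defined in `U`. -/
def pairing {n k : ℕ} (U S : Set (Eu n)) (θ : Eu n → ℕ) (ξ : Eu n → MVec n k)
    (w : Eu n → Covec n k) : ℝ :=
  ∫ x in S ∩ U, (θ x : ℝ) * ξ x (w x) ∂μHE[k]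

/-! ### Oriented submanifolds -/

/-- Smooth embedded `k`-dimensional submanifold (without boundary) of `ℝⁿ`: near each of its points,
`M` is a coordinate slice in a smooth chart of `ℝⁿ`. -/
def IsSubmanifold {n : ℕ} (k : ℕ) (M : Set (Eu n)) : Prop :=
  ∀ x ∈ M, ∃ Φ : OpenPartialHomeomorph (Eu n) (Eu n), x ∈ Φ.source ∧
    ContDiffOn ℝ ∞ Φ Φ.source ∧ ContDiffOn ℝ ∞ Φ.symm Φ.target ∧
    ∀ y ∈ Φ.source, y ∈ M ↔ ∀ i : Fin n, k ≤ (i : ℕ) → Φ y i = 0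

/-- Tangent space of a submanifold. -/
def tangentSpace {n : ℕ} (M : Set (Eu n)) (x : Eu n) : Submodule ℝ (Eu n) :=
  Submodule.span ℝ (tangentConeAt ℝ M x)

/-- `ξ` is an orientation of the submanifold `M`: a continuous choice of unit simple `k`-vectors
orienting the tangent spaces. -/
def IsOrientation {n k : ℕ} (M : Set (Eu n)) (ξ : Eu n → MVec n k) : Prop :=
  ContinuousOn ξ M ∧ ∀ x ∈ M, Orients (ξ x) (tangentSpace M x)

/-- The current `[M]` of integration over the compact submanifold `M` oriented by `ξ`. -/
def fundCurrent {n k : ℕ} (M : Set (Eu n)) (ξ : Eu n → MVec n k) : Current n k :=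
  currentOf (μHE[k].restrict M) ξ

/-- The cone `{t x : 0 ≤ t, x ∈ X}` over `X`. -/
def coneOver {n : ℕ} (X : Set (Eu n)) : Set (Eu n) := {y | ∃ t : ℝ, 0 ≤ t ∧ ∃ x ∈ X, y = t • x}

/-! ### Coflat calibrations -/

/-- `w` is a coflat calibration (of degree `N`) in the open set `W ⊆ ℝᴺ⁺¹`, with singular set `S`.
Values of `w` outside of `W` are irrelevant. -/
structure IsCoflatCalibration {N : ℕ} (W : Set (Eu (N + 1))) (w : Eu (N + 1) → Covec (N + 1) N)
    (S : Set (Eu (N + 1))) : Prop where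
  measurable : AEStronglyMeasurable w (volume.restrict W)
  subset : S ⊆ W
  relClosed : ∃ C, IsClosed C ∧ S = W ∩ C
  null : μHE[N] S = 0
  contDiffOn : ContDiffOn ℝ 1 w (W \ S)
  closed : ∀ x ∈ W \ S, extDeriv w x = 0
  norm_le_one : eLpNorm w ∞ (volume.restrict W) ≤ 1
  ne_zero : ∀ x ∈ W \ S, w x ≠ 0

/-- The vector field `w_⊥` of a form `w` of codimension one: with the canonical basis `e₀, …, e_N`
and `w = ∑ᵢ (-1)ⁱ vᵢ e₀* ∧ ⋯ ∧ eᵢ*^ ∧ ⋯ ∧ e_N*` (`eᵢ*` omitted), `w_⊥ = ∑ᵢ vᵢ eᵢ`. It is orthogonal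
to the hyperplane associated with `w`, and it is divergence free exactly if `dw = 0`. -/
def perp {N : ℕ} (w : Eu (N + 1) → Covec (N + 1) N) (x : Eu (N + 1)) : Eu (N + 1) :=
  WithLp.toLp 2 fun i =>
    (-1) ^ (i : ℕ) * w x fun j => EuclideanSpace.single (i.succAbove j) (1 : ℝ)

/-! ### Integral curves and multiplicity -/

/-- `γ`, defined on the open interval `I`, is a maximal integral curve of `v` in `W`. -/
structure IsMaximalIntegralCurve {n : ℕ} (v : Eu n → Eu n) (W : Set (Eu n)) (γ : ℝ → Eu n)
    (I : Set ℝ) : Prop where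
  isOpen : IsOpen I
  nonempty : I.Nonempty
  ordConnected : I.OrdConnected
  mapsTo : MapsTo γ I W
  integralCurve : IsIntegralCurveOn γ (fun _ => v) I
  maximal : ∀ (J : Set ℝ) (η : ℝ → Eu n), IsOpen J → J.OrdConnected → I ⊆ J → MapsTo η J W →
    IsIntegralCurveOn η (fun _ => v) J → EqOn η γ I → J ⊆ I

/-- The class of the integral curves (trajectories) of `v` in `W`, as subsets of `W`. -/
def trajectories {n : ℕ} (v : Eu n → Eu n) (W : Set (Eu n)) : Set (Set (Eu n)) :=
  {Γ | ∃ γ I, IsMaximalIntegralCurve v W γ I ∧ Γ = γ '' I}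

/-- `E` is of multiplicity no more than one with respect to the vector field `v` in `W`. -/
def MultLeOne {n : ℕ} (v : Eu n → Eu n) (W E : Set (Eu n)) : Prop :=
  ∀ Γ ∈ trajectories v W, (Γ ∩ E).Subsingleton

/-- `E` is of multiplicity no less than one with respect to the vector field `v` in `W`. -/
def MultGeOne {n : ℕ} (v : Eu n → Eu n) (W E : Set (Eu n)) : Prop :=
  ∀ x ∈ E ∩ W, ∃ Γ ∈ trajectories v W, x ∈ Γ

/-- `E` is of multiplicity one with respect to the vector field `v` in `W`. -/
def MultOne {n : ℕ} (v : Eu n → Eu n) (W E : Set (Eu n)) : Prop :=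
  MultLeOne v W E ∧ MultGeOne v W E

/-! ### Calibrated sets -/

/-- `E ∈ C(β, w, U)`: the set `E` is calibrated by `w` with respect to `β` in `U`. -/
structure IsCalibratedBy {m : ℕ} (β : Current (m + 2) m) (w : Eu (m + 2) → Covec (m + 2) (m + 1))
    (U E : Set (Eu (m + 2))) : Prop where
  integral : β.IsIntegral
  cycle : β.IsCycle
  spt_subset : β.spt ⊆ frontier U
  isClosed : IsClosed E
  subset_closure : E ⊆ closure U
  inter_frontier : E ∩ frontier U = β.spt
  calibrated : ∃ T : Current (m + 2) (m + 1), T.IsIntegral ∧ T.IsAssociated E ∧ T.bdry = β ∧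
    ∃ S θ ξ, T.IsGivenBy S θ ξ ∧ (μHE[m + 1] E).toReal = pairing U S θ ξ w

/-- `E ∈ C₁(β, w, U)`: the set `E` is calibrated by `w` with respect to `β` in `U`, and of
multiplicity one with respect to `w_⊥` outside of the singular set `S` of `w`. -/
def IsCalibratedMultOne {m : ℕ} (β : Current (m + 2) m) (w : Eu (m + 2) → Covec (m + 2) (m + 1))
    (S U E : Set (Eu (m + 2))) : Prop :=
  IsCalibratedBy β w U E ∧ MultOne (perp w) (U \ S) E

end CoflatCone

end

/-!
Let `v = w_⊥` be the normal field of the calibration, extended by zero off the regular set, let `T`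
be the calibrated current with underlying measure `κ = θ ℋⁿ⁻¹⌊Z`, and let `C` be the cone over `M`.

*The cone as a jump set.* The pairing of `T` with `w` is at most the mass of `T`, and equality
forces the unit normal of `T` to be equal to `v` at `κ`-almost all points
(`IsPolar.ae_eq_calField`). Since `T` has no boundary in the open ball, the vector measure `v κ` is curl free there
(`IsPolar.isCurlFreeOn`), and therefore it is the distributional gradient of a bounded function `u`
which is locally constant off `C` (`exists_jump_function`,
`IsCalibratingField.exists_isJumpFunction`). As `C` is a cone, `u` is constant along rays. Off `C`
it takes finitely many values, and since in suitable coordinates `C` is locally a hyperplane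
(`isTwoSidedCone_coneOver`), `u` jumps across it by a fixed amount at each point but the vertex. The
mass of `T` is only `ℋⁿ⁻¹(C ∩ B)`, so that `θ = 1` and all jumps have height one
(`IsJumpFunction.unitJumps`).

*Two values.* The heart of the proof is that `u` takes only two values, `c` and `c + 1`
(`IsJumpFunction.exists_two_values`). The field `v` is weakly divergence free in the whole ball,
since its singular set is removable (`integral_fderiv_eq_zero_of_removable`). The sublevel sets of
`u` are all calibrated by `v`, and so are their translates by the translates of `v`. Compare `u`
with its translate: for a small vector `z`, the part of `u(x - z) - u(x)` above one is compactly
supported near the vertex, because `u` oscillates by at most one at distances comparable to the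
distance from the vertex. Testing both `div v = 0` and its translate with (the square of) this
function shows that, where it varies, the fields `v` and `v(· - z)` calibrate the same jump set
(`IsJumpFunction.integral_excessSlope_le`). Hence `v` takes the same value at a point where `u < c`
and at a point of `C` where `u` jumps from `c` to `c + 1` (`IsJumpFunction.exists_eq_of_lt`). If `u`
had three values, then `v` would be a constant vector on the cone near the vertex, and `u` a
monotone function of one linear coordinate which is constant along rays; such a function has only
two values (`IsJumpFunction.not_three_values`).

*Integral curves.* Near a regular point of `C`, the function `u` increases along `v`, so an integral
curve of `v` passes at each encounter with `C` from `u = c` to `u = c + 1`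
(`IsJumpFunction.eventually_crossing`). Between two consecutive encounters `u` would have to be
constant along the curve and equal to both values, so there is at most one encounter
(`IsJumpFunction.subsingleton_hits`). Each regular point lies on a maximal integral curve by the
Picard–Lindelöf theorem and Zorn's lemma (`exists_isMaximalIntegralCurve`).
-/

noncomputable section

namespace CoflatCone

open Metric
open scoped RealInnerProductSpace Convolution

set_option linter.unusedSectionVars false

/-! ### Mollification of vector measures -/

section Mollification

variable {V : Type*} [NormedAddCommGroup V] [InnerProductSpace ℝ V] [FiniteDimensional ℝ V]
  [MeasurableSpace V] [BorelSpace V]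

/-- The mollification `x ↦ ∫ ρ (x - y) v(y) dκ(y)` of the vector measure `v κ`, where `ρ` is the
normalized bump function `φ`. -/
def mollify (φ : ContDiffBump (0 : V)) (κ : Measure V) (v : V → V) (x : V) : V :=
  ∫ y, φ.normed volume (x - y) • v y ∂κ

/-- The mollification `x ↦ ∫ ρ (x - y) dκ(y)` of the measure `κ`. -/
def mollifyMass (φ : ContDiffBump (0 : V)) (κ : Measure V) (x : V) : ℝ :=
  ∫ y, φ.normed volume (x - y) ∂κ

theorem exists_bound_normed (φ : ContDiffBump (0 : V)) :
    ∃ K : ℝ, 0 ≤ K ∧ ∀ x, ‖φ.normed volume x‖ ≤ K := by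
  obtain ⟨K, hK⟩ := φ.hasCompactSupport_normed (μ := volume) |>.exists_bound_of_continuous
    φ.continuous_normed
  exact ⟨K, (norm_nonneg _).trans (hK 0), hK⟩

theorem normed_eq_zero_of_le (φ : ContDiffBump (0 : V)) {x : V} (hx : φ.rOut ≤ ‖x‖) :
    φ.normed volume x = 0 := by
  have : x ∉ Function.support (φ.normed volume) := by
    rw [φ.support_normed_eq]; simpa using hx
  simpa using this

theorem norm_lt_of_normed_ne_zero (φ : ContDiffBump (0 : V)) {x : V}
    (hx : φ.normed volume x ≠ 0) : ‖x‖ < φ.rOut := by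
  by_contra h
  exact hx (normed_eq_zero_of_le φ (not_lt.1 h))

theorem normed_pos_of_lt (φ : ContDiffBump (0 : V)) {x : V} (hx : ‖x‖ < φ.rOut) :
    0 < φ.normed volume x := by
  have : x ∈ Function.support (φ.normed volume) := by
    rw [φ.support_normed_eq]; simpa using hx
  exact lt_of_le_of_ne (φ.nonneg_normed x) (Ne.symm this)

theorem integrable_normed_mul {κ : Measure V} (φ : ContDiffBump (0 : V)) {g : V → ℝ}
    (hg : Integrable g κ) (x : V) : Integrable (fun y => φ.normed volume (x - y) * g y) κ := by
  obtain ⟨K, -, hK⟩ := exists_bound_normed φ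
  exact hg.bdd_mul (c := K)
    ((φ.continuous_normed.comp (continuous_const.sub continuous_id)).aestronglyMeasurable)
    (Eventually.of_forall fun y => hK _)

theorem integrable_normed_smul {κ : Measure V} (φ : ContDiffBump (0 : V)) {v : V → V}
    (hv : Integrable v κ) (x : V) : Integrable (fun y => φ.normed volume (x - y) • v y) κ := by
  obtain ⟨K, -, hK⟩ := exists_bound_normed φ
  exact hv.bdd_smul (C := K)
    ((φ.continuous_normed.comp (continuous_const.sub continuous_id)).aestronglyMeasurable)
    (Eventually.of_forall fun y => hK _)

theorem mollify_eq_convolution (φ : ContDiffBump (0 : V)) (κ : Measure V) (v : V → V) :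
    mollify φ κ v = (v ⋆[(ContinuousLinearMap.lsmul ℝ ℝ).flip, κ] φ.normed volume) := by
  ext1 x; rfl

theorem contDiff_mollify (φ : ContDiffBump (0 : V)) {κ : Measure V} {v : V → V}
    (hv : Integrable v κ) : ContDiff ℝ ∞ (mollify φ κ v) := by
  rw [mollify_eq_convolution]
  exact φ.hasCompactSupport_normed.contDiff_convolution_right _ hv.locallyIntegrable
    φ.contDiff_normed

theorem inner_mollify (φ : ContDiffBump (0 : V)) {κ : Measure V} {v : V → V}
    (hv : Integrable v κ) (x a : V) :
    ⟪mollify φ κ v x, a⟫ = ∫ y, φ.normed volume (x - y) * ⟪v y, a⟫ ∂κ := by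
  unfold mollify
  rw [real_inner_comm, ← integral_inner (integrable_normed_smul φ hv x)]
  refine integral_congr_ae (Eventually.of_forall fun y => ?_)
  simp only [inner_smul_right, real_inner_comm]

theorem mollify_eq_zero (φ : ContDiffBump (0 : V)) {κ : Measure V} {v : V → V} {x : V}
    (h : κ (ball x φ.rOut) = 0) : mollify φ κ v x = 0 := by
  refine integral_eq_zero_of_ae ?_
  have : ∀ᵐ y ∂κ, y ∉ ball x φ.rOut := measure_eq_zero_iff_ae_notMem.1 h
  filter_upwards [this] with y hy
  rw [normed_eq_zero_of_le φ, zero_smul]; · rfl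
  simpa [dist_eq_norm, norm_sub_rev] using hy

theorem norm_mollify_le (φ : ContDiffBump (0 : V)) {κ : Measure V} [IsFiniteMeasure κ] {v : V → V}
    (hv : ∀ y, ‖v y‖ ≤ 1) (x : V) : ‖mollify φ κ v x‖ ≤ mollifyMass φ κ x := by
  refine norm_integral_le_of_norm_le ?_ (Eventually.of_forall fun y => ?_)
  · simpa using integrable_normed_mul φ (integrable_const (1 : ℝ) (μ := κ)) x
  · rw [norm_smul, Real.norm_of_nonneg (φ.nonneg_normed _)]
    exact mul_le_of_le_one_right (φ.nonneg_normed _) (hv y)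

/-- The derivative of a mollification falls on the kernel. -/
theorem fderiv_mollify (φ : ContDiffBump (0 : V)) {κ : Measure V} [IsFiniteMeasure κ] {v : V → V}
    (hv : Integrable v κ) (x a b : V) :
    ⟪fderiv ℝ (mollify φ κ v) x a, b⟫ =
      ∫ y, fderiv ℝ (φ.normed volume) (x - y) a * ⟪v y, b⟫ ∂κ := by
  have h1 : ContDiff ℝ 1 (φ.normed (volume : Measure V)) := φ.contDiff_normed (n := 1)
  have hc : HasCompactSupport (φ.normed (volume : Measure V)) := φ.hasCompactSupport_normed
  obtain ⟨K, hK⟩ := (hc.fderiv ℝ).exists_bound_of_continuous (h1.continuous_fderiv one_ne_zero)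
  have hcont : Continuous fun y => fderiv ℝ (φ.normed (volume : Measure V)) (x - y) :=
    (h1.continuous_fderiv one_ne_zero).comp (continuous_const.sub continuous_id)
  have hI : Integrable (fun y => (fderiv ℝ (φ.normed (volume : Measure V)) (x - y)).smulRight
      (v y)) κ := by
    refine (hv.norm.const_mul K).mono' ?_ (Eventually.of_forall fun y => ?_)
    · exact ContinuousLinearMap.aestronglyMeasurable_comp₂ (ContinuousLinearMap.smulRightL ℝ V V)
        hcont.aestronglyMeasurable hv.aestronglyMeasurable
    · rw [ContinuousLinearMap.norm_smulRight_apply]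
      gcongr
      exact hK _
  have h2 : HasFDerivAt (mollify φ κ v) (∫ y, (fderiv ℝ (φ.normed (volume : Measure V))
      (x - y)).smulRight (v y) ∂κ) x := by
    refine hasFDerivAt_integral_of_dominated_of_fderiv_le (s := univ)
      (F := fun x y => φ.normed volume (x - y) • v y)
      (F' := fun x y => (fderiv ℝ (φ.normed (volume : Measure V)) (x - y)).smulRight (v y))
      (bound := fun y => K * ‖v y‖) univ_mem
      (Eventually.of_forall fun x => (integrable_normed_smul φ hv x).aestronglyMeasurable)
      (integrable_normed_smul φ hv x) hI.aestronglyMeasurable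
      (Eventually.of_forall fun y z _ => ?_) (hv.norm.const_mul K)
      (Eventually.of_forall fun y z _ => ?_)
    · rw [ContinuousLinearMap.norm_smulRight_apply]
      gcongr
      exact hK _
    · have h3 : HasFDerivAt (φ.normed volume) (fderiv ℝ (φ.normed volume) (z - y)) (z - y) :=
        (h1.differentiable (by simp)).differentiableAt.hasFDerivAt
      exact ((hasFDerivAt_comp_sub y).2 h3).smul_const (v y)
  rw [h2.fderiv, ContinuousLinearMap.integral_apply hI, real_inner_comm,
    ← integral_inner (hI.apply_continuousLinearMap a)]
  refine integral_congr_ae (Eventually.of_forall fun y => ?_)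
  simp [inner_smul_right, real_inner_comm]

/-- The vector measure `v κ` is curl free in `U`, in the sense of distributions. -/
def IsCurlFreeOn (v : V → V) (κ : Measure V) (U : Set V) : Prop :=
  ∀ h : V → ℝ, ContDiff ℝ ∞ h → HasCompactSupport h → tsupport h ⊆ U → ∀ a b : V,
    ∫ y, fderiv ℝ h y a * ⟪v y, b⟫ ∂κ = ∫ y, fderiv ℝ h y b * ⟪v y, a⟫ ∂κ

theorem IsCurlFreeOn.fderiv_mollify_symm {κ : Measure V} [IsFiniteMeasure κ] {v : V → V}
    (hv : Integrable v κ) {U : Set V} (hc : IsCurlFreeOn v κ U) (φ : ContDiffBump (0 : V)) {x : V}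
    (hx : closedBall x φ.rOut ⊆ U) (a b : V) :
    ⟪fderiv ℝ (mollify φ κ v) x a, b⟫ = ⟪fderiv ℝ (mollify φ κ v) x b, a⟫ := by
  rw [fderiv_mollify φ hv, fderiv_mollify φ hv]
  have h1 : ContDiff ℝ ∞ (φ.normed (volume : Measure V)) := φ.contDiff_normed
  have key := hc (fun y => φ.normed volume (x - y)) (h1.comp (contDiff_const.sub contDiff_id))
    (φ.hasCompactSupport_normed.comp_homeomorph (Homeomorph.subLeft x))
    (by
      refine Subset.trans ?_ hx
      refine closure_minimal ?_ isClosed_closedBall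
      intro y hy
      have := norm_lt_of_normed_ne_zero φ hy
      rw [mem_closedBall, dist_comm, dist_eq_norm]; exact this.le) a b
  have hd : ∀ y c, fderiv ℝ (fun y => φ.normed volume (x - y)) y c =
      - fderiv ℝ (φ.normed volume) (x - y) c := by
    intro y c
    have h3 : HasFDerivAt (φ.normed volume) (fderiv ℝ (φ.normed volume) (x - y)) (x - y) :=
      (h1.differentiable (by simp)).differentiableAt.hasFDerivAt
    have := h3.comp y ((hasFDerivAt_id y).const_sub x)
    rw [show (fun y => φ.normed volume (x - y)) = (φ.normed volume) ∘ (HSub.hSub x) from rfl,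
      this.fderiv]
    simp
  simp only [hd, neg_mul, integral_neg, neg_inj] at key
  exact key

/-- A function whose gradient is the mollified vector measure. -/
def IsPotential (φ : ContDiffBump (0 : V)) (κ : Measure V) (v : V → V) (f : V → ℝ) : Prop :=
  ∀ x, ‖x‖ + φ.rOut < 1 → HasFDerivAt f (innerSL ℝ (mollify φ κ v x)) x

/-- By the Poincaré lemma, the mollifications of a curl free vector measure are gradients. The
potential is normalized to vanish at `p`. -/
theorem IsCurlFreeOn.exists_isPotential {κ : Measure V} [IsFiniteMeasure κ] {v : V → V}
    (hv : Integrable v κ) (hc : IsCurlFreeOn v κ (ball 0 1)) (φ : ContDiffBump (0 : V)) (p : V) :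
    ∃ f, IsPotential φ κ v f ∧ f p = 0 := by
  have hsm := (contDiff_mollify φ hv).differentiable (by simp)
  have hω : Differentiable ℝ (fun x => innerSL ℝ (mollify φ κ v x)) :=
    (innerSL ℝ).differentiable.comp hsm
  obtain ⟨f, hf⟩ := (convex_ball (0 : V) (1 - φ.rOut)).exists_forall_hasFDerivAt_of_fderiv_symmetric
    isOpen_ball hω.differentiableOn (by
      intro x hx a b
      have hfd : ∀ a b, fderiv ℝ (fun x => innerSL ℝ (mollify φ κ v x)) x a b =
          ⟪fderiv ℝ (mollify φ κ v) x a, b⟫ := by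
        intro a b
        have := ((innerSL ℝ).hasFDerivAt (x := mollify φ κ v x)).comp x (hsm x).hasFDerivAt
        rw [show (fun x => innerSL ℝ (mollify φ κ v x)) = (innerSL ℝ) ∘ (mollify φ κ v) from rfl]
        erw [this.fderiv]
        rfl
      rw [hfd, hfd]
      refine hc.fderiv_mollify_symm hv φ ?_ a b
      intro y hy
      have h1 := norm_sub_norm_le y x
      rw [mem_closedBall, dist_eq_norm] at hy
      simp only [mem_ball_zero_iff] at hx ⊢
      linarith)
  refine ⟨fun x => f x - f p, fun x hx => ?_, sub_self _⟩
  exact (hf x (by simp only [mem_ball_zero_iff]; linarith)).sub_const _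

end Mollification

/-! ### Comparison of the potentials at different scales -/

section Potential

variable {V : Type*} [NormedAddCommGroup V] [InnerProductSpace ℝ V] [FiniteDimensional ℝ V]
  [MeasurableSpace V] [BorelSpace V]

theorem exists_bound_mollify (φ : ContDiffBump (0 : V)) {κ : Measure V} {v : V → V}
    (hv : Integrable v κ) : ∃ M : ℝ, 0 ≤ M ∧ ∀ x, ‖mollify φ κ v x‖ ≤ M := by
  obtain ⟨K, hK0, hK⟩ := exists_bound_normed φ
  refine ⟨K * ∫ y, ‖v y‖ ∂κ, by positivity, fun x => ?_⟩
  rw [← integral_const_mul]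
  refine norm_integral_le_of_norm_le (hv.norm.const_mul K) (Eventually.of_forall fun y => ?_)
  rw [norm_smul]
  gcongr
  exact hK _

theorem integral_normed_mul_normed (φ ψ : ContDiffBump (0 : V)) (q : V) :
    ∫ s, ψ.normed volume s * φ.normed volume (q - s) =
      ∫ s, φ.normed volume s * ψ.normed volume (q - s) := by
  rw [← integral_sub_left_eq_self (fun s => φ.normed volume s * ψ.normed volume (q - s)) volume q]
  simp [mul_comm]

theorem integral_normed_smul_mollify (φ ψ : ContDiffBump (0 : V)) {κ : Measure V}
    [IsFiniteMeasure κ] {v : V → V} (hv : Integrable v κ) (p : V) :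
    ∫ s, ψ.normed volume s • mollify φ κ v (p - s) =
      ∫ y, (∫ s, ψ.normed volume s * φ.normed volume (p - y - s)) • v y ∂κ := by
  unfold mollify
  simp_rw [← integral_smul, ← integral_smul_const, smul_smul]
  rw [integral_integral_swap]
  · simp_rw [show ∀ s y : V, p - s - y = p - y - s from fun s y => by abel]
  · obtain ⟨K, hK0, hK⟩ := exists_bound_normed φ
    have h1 : Integrable (fun z : V × V => ψ.normed volume z.1 • v z.2) (volume.prod κ) :=
      (ψ.integrable_normed (μ := volume)).smul_prod hv
    have h2 := h1.bdd_smul (φ := fun z : V × V => φ.normed volume (p - z.1 - z.2)) K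
      ((φ.continuous_normed.comp (by fun_prop : Continuous fun z : V × V =>
        p - z.1 - z.2)).aestronglyMeasurable) (Eventually.of_forall fun z => hK _)
    refine h2.congr (Eventually.of_forall fun z => ?_)
    simp [smul_smul, mul_comm, Function.uncurry_def]

theorem integral_normed_smul_mollify_comm (φ ψ : ContDiffBump (0 : V)) {κ : Measure V}
    [IsFiniteMeasure κ] {v : V → V} (hv : Integrable v κ) (p : V) :
    ∫ s, ψ.normed volume s • mollify φ κ v (p - s) =
      ∫ s, φ.normed volume s • mollify ψ κ v (p - s) := by
  rw [integral_normed_smul_mollify φ ψ hv, integral_normed_smul_mollify ψ φ hv]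
  simp_rw [integral_normed_mul_normed φ ψ]

variable {κ : Measure V} {v : V → V} {f g : V → ℝ} {φ ψ : ContDiffBump (0 : V)}

theorem continuous_normed_mul_of_continuousAt (ψ : ContDiffBump (0 : V)) {x : V} {f : V → ℝ}
    (hf : ∀ y ∈ closedBall x ψ.rOut, ContinuousAt f y) :
    Continuous fun s => ψ.normed volume s * f (x - s) := by
  refine continuous_of_tsupport fun s hs => ?_
  have hs' : s ∈ closedBall 0 ψ.rOut := by
    rw [← ψ.tsupport_normed_eq (μ := volume)]
    exact closure_mono (Function.support_mul_subset_left _ _) hs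
  refine ψ.continuous_normed.continuousAt.mul ?_
  have h1 : ContinuousAt f (x - s) := hf _ (by simpa [dist_eq_norm] using hs')
  exact ContinuousAt.comp (f := fun s => x - s) h1 (by fun_prop)

theorem integrable_normed_mul_of_continuousAt (ψ : ContDiffBump (0 : V)) {x : V} {f : V → ℝ}
    (hf : ∀ y ∈ closedBall x ψ.rOut, ContinuousAt f y) :
    Integrable fun s => ψ.normed volume s * f (x - s) :=
  (continuous_normed_mul_of_continuousAt ψ hf).integrable_of_hasCompactSupport
    (ψ.hasCompactSupport_normed.mul_right)

theorem IsPotential.continuousAt (hf : IsPotential φ κ v f) {x : V} (hx : ‖x‖ + φ.rOut < 1) :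
    ContinuousAt f x := (hf x hx).continuousAt

omit [FiniteDimensional ℝ V] [MeasurableSpace V] [BorelSpace V] in
theorem enorm_inner_le (x y : V) : ‖⟪x, y⟫‖ₑ ≤ ‖x‖ₑ * ‖y‖ₑ := by
  rw [← ofReal_norm, ← ofReal_norm, ← ofReal_norm, ← ENNReal.ofReal_mul (norm_nonneg _)]
  exact ENNReal.ofReal_le_ofReal (norm_inner_le_norm _ _)

omit [InnerProductSpace ℝ V] [FiniteDimensional ℝ V] [MeasurableSpace V] [BorelSpace V] in
theorem norm_le_of_mem_closedBall {x y : V} {r : ℝ} (h : y ∈ closedBall x r) : ‖y‖ ≤ ‖x‖ + r := by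
  have h1 := norm_sub_norm_le y x
  rw [mem_closedBall, dist_eq_norm] at h
  linarith

theorem IsPotential.integrable (hf : IsPotential φ κ v f) {x : V}
    (hx : ‖x‖ + φ.rOut + ψ.rOut < 1) :
    Integrable fun s => ψ.normed volume s * f (x - s) :=
  integrable_normed_mul_of_continuousAt ψ fun y hy => hf.continuousAt (by
    have := norm_le_of_mem_closedBall hy; linarith)

/-- The averages of a potential are differentiable under the integral sign. -/
theorem IsPotential.hasFDerivAt_average (hv : Integrable v κ) (hf : IsPotential φ κ v f)
    (ψ : ContDiffBump (0 : V)) {x : V} (hx : ‖x‖ + φ.rOut + ψ.rOut < 1) :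
    HasFDerivAt (fun x => ∫ s, ψ.normed volume s * f (x - s))
      (innerSL ℝ (∫ s, ψ.normed volume s • mollify φ κ v (x - s))) x := by
  obtain ⟨M, hM0, hM⟩ := exists_bound_mollify φ hv
  have hcm := (contDiff_mollify φ hv).continuous
  have hI : Integrable fun s => ψ.normed volume s • mollify φ κ v (x - s) := by
    refine Continuous.integrable_of_hasCompactSupport ?_ ψ.hasCompactSupport_normed.smul_right
    exact ψ.continuous_normed.smul (hcm.comp (by fun_prop))
  rw [← ContinuousLinearMap.integral_comp_comm _ hI]
  set r := (1 - (‖x‖ + φ.rOut + ψ.rOut)) with hr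
  have hrb : ∀ z ∈ ball x r, ‖z‖ + φ.rOut + ψ.rOut < 1 := by
    intro z hz
    have h1 := norm_sub_norm_le z x
    rw [mem_ball, dist_eq_norm] at hz
    linarith
  refine hasFDerivAt_integral_of_dominated_of_fderiv_le (s := ball x r)
    (F' := fun x s => innerSL ℝ (ψ.normed volume s • mollify φ κ v (x - s)))
    (bound := fun s => ψ.normed volume s * M)
    (ball_mem_nhds x (by linarith)) ?_ (hf.integrable hx)
    ((innerSL ℝ).integrable_comp hI).aestronglyMeasurable
    (Eventually.of_forall fun s z _ => ?_) (ψ.integrable_normed.mul_const M)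
    (Eventually.of_forall fun s z hz => ?_)
  · filter_upwards [ball_mem_nhds x (show 0 < r by linarith)] with z hz
    exact (hf.integrable (hrb z hz)).aestronglyMeasurable
  · rw [innerSL_apply_norm, norm_smul, Real.norm_of_nonneg (ψ.nonneg_normed s)]
    gcongr
    · exact ψ.nonneg_normed s
    · exact hM _
  · by_cases h0 : ψ.normed volume s = 0
    · simpa [h0] using hasFDerivAt_const (0 : ℝ) z
    · have hs := norm_lt_of_normed_ne_zero ψ h0
      have h2 : ‖z - s‖ + φ.rOut < 1 := by
        have := norm_sub_le z s
        have := hrb z hz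
        linarith
      have h3 := (hasFDerivAt_comp_sub s).2 (hf (z - s) h2)
      rw [map_smul]
      exact h3.const_mul _

/-- Mollifications of the same vector measure have commuting averages, so that the cross-averages
of their potentials differ by a constant. -/
theorem IsPotential.average_sub_average [IsFiniteMeasure κ] (hv : Integrable v κ)
    (hf : IsPotential φ κ v f) (hg : IsPotential ψ κ v g) {x y : V}
    (hx : ‖x‖ + φ.rOut + ψ.rOut < 1) (hy : ‖y‖ + φ.rOut + ψ.rOut < 1) :
    (∫ s, ψ.normed volume s * f (x - s)) - ∫ s, φ.normed volume s * g (x - s) =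
      (∫ s, ψ.normed volume s * f (y - s)) - ∫ s, φ.normed volume s * g (y - s) := by
  have hd : ∀ z ∈ ball (0 : V) (1 - (φ.rOut + ψ.rOut)),
      HasFDerivWithinAt (fun z => (∫ s, ψ.normed volume s * f (z - s)) -
        ∫ s, φ.normed volume s * g (z - s)) (0 : V →L[ℝ] ℝ)
        (ball (0 : V) (1 - (φ.rOut + ψ.rOut))) z := by
    intro z hz
    rw [mem_ball_zero_iff] at hz
    have h1 := hf.hasFDerivAt_average hv ψ (x := z) (by linarith)
    have h2 := hg.hasFDerivAt_average hv φ (x := z) (by linarith)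
    have h3 := h1.sub h2
    rw [integral_normed_smul_mollify_comm φ ψ hv, sub_self] at h3
    exact h3.hasFDerivWithinAt
  have := (convex_ball (0 : V) (1 - (φ.rOut + ψ.rOut))).norm_image_sub_le_of_norm_hasFDerivWithin_le
    (C := 0) hd (fun z _ => by simp) (x := y) (y := x)
    (by rw [mem_ball_zero_iff]; linarith) (by rw [mem_ball_zero_iff]; linarith)
  rw [zero_mul, norm_le_zero_iff, sub_eq_zero] at this
  exact this

/-- A potential is constant on balls whose `φ.rOut`-neighborhood does not charge `κ`. -/
theorem IsPotential.eq_of_measure_eq_zero (hf : IsPotential φ κ v f) {x y : V} {r : ℝ}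
    (hr : ‖x‖ + r + φ.rOut < 1) (h0 : κ (closedBall x (r + φ.rOut)) = 0)
    (hy : y ∈ closedBall x r) : f y = f x := by
  have hd : ∀ z ∈ closedBall x r, HasFDerivWithinAt f (0 : V →L[ℝ] ℝ) (closedBall x r) z := by
    intro z hz
    have h1 := hf z (by have := norm_le_of_mem_closedBall hz; linarith)
    rw [mollify_eq_zero, map_zero] at h1
    · exact h1.hasFDerivWithinAt
    · refine measure_mono_null ?_ h0
      refine ball_subset_closedBall.trans (closedBall_subset_closedBall' ?_)
      rw [mem_closedBall] at hz; linarith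
  have := (convex_closedBall x r).norm_image_sub_le_of_norm_hasFDerivWithin_le
    (C := 0) hd (fun z _ => by simp) (x := x) (y := y)
    (mem_closedBall_self (dist_nonneg.trans (mem_closedBall.1 hy))) hy
  rw [zero_mul, norm_le_zero_iff, sub_eq_zero] at this
  exact this

theorem integral_normed_mul_eq_of_const {x : V} {c : ℝ}
    (h : ∀ y ∈ closedBall x ψ.rOut, f y = c) :
    ∫ s, ψ.normed volume s * f (x - s) = c := by
  have : ∀ s, ψ.normed volume s * f (x - s) = ψ.normed volume s * c := by
    intro s
    by_cases h0 : ψ.normed volume s = 0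
    · simp [h0]
    · rw [h]
      simpa [dist_eq_norm] using (norm_lt_of_normed_ne_zero ψ h0).le
  simp_rw [this]
  rw [integral_mul_const, ψ.integral_normed, one_mul]

/-- Two potentials which are normalized at the same point agree at the points that are far from
the support of `κ`. -/
theorem IsPotential.eq_of_far [IsFiniteMeasure κ] (hv : Integrable v κ)
    (hf : IsPotential φ κ v f) (hg : IsPotential ψ κ v g) {x p : V}
    (hfp : f p = 0) (hgp : g p = 0)
    (hx : ‖x‖ + φ.rOut + ψ.rOut < 1) (hp : ‖p‖ + φ.rOut + ψ.rOut < 1)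
    (hx0 : κ (closedBall x (φ.rOut + ψ.rOut)) = 0) (hp0 : κ (closedBall p (φ.rOut + ψ.rOut)) = 0) :
    f x = g x := by
  have key := hf.average_sub_average hv hg hx hp
  have hx0' := hx0
  have hp0' := hp0
  rw [add_comm] at hx0' hp0'
  rw [integral_normed_mul_eq_of_const (f := f) (c := f x),
    integral_normed_mul_eq_of_const (f := g) (c := g x),
    integral_normed_mul_eq_of_const (f := f) (c := f p),
    integral_normed_mul_eq_of_const (f := g) (c := g p), hfp, hgp] at key
  · linarith
  · exact fun y hy => hg.eq_of_measure_eq_zero (by linarith) hp0 hy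
  · exact fun y hy => hf.eq_of_measure_eq_zero (by linarith) hp0' hy
  · exact fun y hy => hg.eq_of_measure_eq_zero (by linarith) hx0 hy
  · exact fun y hy => hf.eq_of_measure_eq_zero (by linarith) hx0' hy

/-- For potentials normalized at the same point off the support of `κ`, averaging the first one
with the kernel of the second is averaging the second one with the kernel of the first. -/
theorem IsPotential.average_eq_average [IsFiniteMeasure κ] (hv : Integrable v κ)
    (hf : IsPotential φ κ v f) (hg : IsPotential ψ κ v g) {x p : V}
    (hfp : f p = 0) (hgp : g p = 0)
    (hx : ‖x‖ + φ.rOut + ψ.rOut < 1) (hp : ‖p‖ + φ.rOut + ψ.rOut < 1)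
    (hp0 : κ (closedBall p (φ.rOut + ψ.rOut)) = 0) :
    ∫ s, ψ.normed volume s * f (x - s) = ∫ s, φ.normed volume s * g (x - s) := by
  have key := hf.average_sub_average hv hg hx hp
  have hp0' := hp0
  rw [add_comm] at hp0'
  rw [integral_normed_mul_eq_of_const (f := f) (x := p) (c := f p),
    integral_normed_mul_eq_of_const (f := g) (x := p) (c := g p), hfp, hgp] at key
  · linarith
  · exact fun y hy => hg.eq_of_measure_eq_zero (by linarith) hp0 hy
  · exact fun y hy => hf.eq_of_measure_eq_zero (by linarith) hp0' hy

/-- The `L¹` modulus of continuity of a potential: averaging at scale `ψ.rOut` moves it by at most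
`ψ.rOut * κ(V)` in `L¹`. -/
theorem IsPotential.lintegral_average_sub_le [IsFiniteMeasure κ] (hvm : Measurable v)
    (hv1 : ∀ y, ‖v y‖ ≤ 1)
    (hf : IsPotential φ κ v f) {R : ℝ} (hR : R + φ.rOut + ψ.rOut < 1) :
    ∫⁻ x in ball 0 R, ‖(∫ s, ψ.normed volume s * f (x - s)) - f x‖ₑ ≤
      ENNReal.ofReal ψ.rOut * κ univ := by
  have hv : Integrable v κ := Integrable.of_bound hvm.aestronglyMeasurable 1
    (Eventually.of_forall hv1)
  have hmass : Measurable fun p : V => ∫⁻ y, ENNReal.ofReal (φ.normed volume (p - y)) ∂κ := by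
    refine Measurable.lintegral_prod_right' (f := fun z : V × V =>
      ENNReal.ofReal (φ.normed volume (z.1 - z.2))) ?_
    exact (φ.continuous_normed.comp (by fun_prop)).measurable.ennreal_ofReal
  have hψm : Measurable fun s => ENNReal.ofReal (ψ.normed (volume : Measure V) s) :=
    ψ.continuous_normed.measurable.ennreal_ofReal
  -- pointwise bound by an average of the mollified mass along segments
  have h1 : ∀ x ∈ ball (0 : V) R, ‖(∫ s, ψ.normed volume s * f (x - s)) - f x‖ₑ ≤
      ∫⁻ s, ∫⁻ t in Icc (0 : ℝ) 1, ENNReal.ofReal (ψ.normed volume s) * (ENNReal.ofReal ψ.rOut *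
        ∫⁻ y, ENNReal.ofReal (φ.normed volume (x - t • s - y)) ∂κ) := by
    intro x hx
    rw [mem_ball_zero_iff] at hx
    have e1 : (∫ s, ψ.normed volume s * f (x - s)) - f x =
        ∫ s, ψ.normed volume s * (f (x - s) - f x) := by
      simp_rw [mul_sub]
      rw [integral_sub (hf.integrable (by linarith)) (ψ.integrable_normed.mul_const _),
        integral_mul_const, ψ.integral_normed, one_mul]
    rw [e1]
    refine (enorm_integral_le_lintegral_enorm _).trans (lintegral_mono fun s => ?_)
    rw [enorm_mul, Real.enorm_of_nonneg (ψ.nonneg_normed s)]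
    by_cases h0 : ψ.normed volume s = 0
    · simp [h0]
    rw [lintegral_const_mul' _ _ ENNReal.ofReal_ne_top]
    refine mul_le_mul_right ?_ _
    have hs := norm_lt_of_normed_ne_zero ψ h0
    have hin : ∀ t ∈ Icc (0 : ℝ) 1, ‖x - t • s‖ + φ.rOut < 1 := by
      intro t ht
      have h3 : ‖t • s‖ ≤ ‖s‖ := by
        rw [norm_smul, Real.norm_of_nonneg ht.1]
        exact mul_le_of_le_one_left (norm_nonneg _) ht.2
      have := norm_sub_le x (t • s)
      linarith
    have hder : ∀ t ∈ Icc (0 : ℝ) 1, HasDerivAt (fun t : ℝ => f (x - t • s))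
        ⟪mollify φ κ v (x - t • s), -s⟫ t := by
      intro t ht
      have h4 : HasDerivAt (fun t : ℝ => x - t • s) (-s) t := by
        simpa using ((hasDerivAt_id t).smul_const s).const_sub x
      exact (hf _ (hin t ht)).comp_hasDerivAt t h4
    have hcont : Continuous fun t : ℝ => ⟪mollify φ κ v (x - t • s), -s⟫ := by
      have := (contDiff_mollify φ hv).continuous
      fun_prop
    have hftc : ∫ t in (0 : ℝ)..1, ⟪mollify φ κ v (x - t • s), -s⟫ = f (x - s) - f x := by
      rw [intervalIntegral.integral_eq_sub_of_hasDerivAt (f := fun t : ℝ => f (x - t • s))]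
      · simp
      · intro t ht
        rw [uIcc_of_le zero_le_one] at ht
        exact hder t ht
      · exact hcont.intervalIntegrable _ _
    rw [← hftc, intervalIntegral.integral_of_le zero_le_one]
    refine (enorm_integral_le_lintegral_enorm _).trans ?_
    refine (lintegral_mono fun t => ?_).trans (lintegral_mono_set Ioc_subset_Icc_self)
    refine (enorm_inner_le _ _).trans ?_
    rw [mul_comm, enorm_neg]
    gcongr
    · rw [← ofReal_norm]
      exact ENNReal.ofReal_le_ofReal hs.le
    · refine (enorm_integral_le_lintegral_enorm _).trans (lintegral_mono fun y => ?_)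
      rw [enorm_smul, Real.enorm_of_nonneg (φ.nonneg_normed _)]
      refine mul_le_of_le_one_right (zero_le) ?_
      rw [← ofReal_norm]
      exact ENNReal.ofReal_le_one.2 (hv1 y)
  refine (setLIntegral_mono' measurableSet_ball h1).trans ((setLIntegral_le_lintegral _ _).trans ?_)
  -- Tonelli, and translation invariance of the Lebesgue measure
  have hmass1 : ∀ q : V, ∫⁻ x, ∫⁻ y, ENNReal.ofReal (φ.normed volume (x - q - y)) ∂κ = κ univ := by
    intro q
    rw [lintegral_lintegral_swap]
    · have : ∀ y, ∫⁻ x, ENNReal.ofReal (φ.normed volume (x - q - y)) = 1 := by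
        intro y
        simp_rw [sub_sub]
        rw [lintegral_sub_right_eq_self (fun x => ENNReal.ofReal (φ.normed volume x)) (q + y),
          ← ofReal_integral_eq_lintegral_ofReal φ.integrable_normed
          (Eventually.of_forall φ.nonneg_normed), φ.integral_normed, ENNReal.ofReal_one]
      simp [this]
    · refine Measurable.aemeasurable ?_
      refine (φ.continuous_normed.comp ?_).measurable.ennreal_ofReal
      change Continuous fun z : V × V => z.1 - q - z.2
      fun_prop
  obtain ⟨H, hH⟩ : ∃ H : V → V → ℝ → ℝ≥0∞, H = fun x s t => ENNReal.ofReal (ψ.normed volume s) *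
      (ENNReal.ofReal ψ.rOut *
        ∫⁻ y, ENNReal.ofReal (φ.normed volume (x - t • s - y)) ∂κ) := ⟨_, rfl⟩
  have hm3 : Measurable fun z : V × V × ℝ => H z.1 z.2.1 z.2.2 := by
    simp only [hH]
    refine (hψm.comp (measurable_fst.comp measurable_snd)).mul (measurable_const.mul ?_)
    exact hmass.comp (by fun_prop : Measurable fun z : V × V × ℝ => z.1 - z.2.2 • z.2.1)
  have hH1 : ∀ s t, ∫⁻ x, H x s t = ENNReal.ofReal (ψ.normed volume s) *
      (ENNReal.ofReal ψ.rOut * κ univ) := by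
    intro s t
    simp only [hH]
    rw [lintegral_const_mul' _ _ ENNReal.ofReal_ne_top,
      lintegral_const_mul' _ _ ENNReal.ofReal_ne_top, hmass1]
  calc _ = ∫⁻ x, ∫⁻ s, ∫⁻ t in Icc (0 : ℝ) 1, H x s t := by rw [hH]
    _ = ∫⁻ s, ∫⁻ x, ∫⁻ t in Icc (0 : ℝ) 1, H x s t := by
        refine lintegral_lintegral_swap (Measurable.aemeasurable ?_)
        exact Measurable.lintegral_prod_right' (f := fun z : (V × V) × ℝ => H z.1.1 z.1.2 z.2)
          (hm3.comp (by fun_prop : Measurable fun z : (V × V) × ℝ => (z.1.1, z.1.2, z.2)))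
    _ = ∫⁻ s, ∫⁻ t in Icc (0 : ℝ) 1, ∫⁻ x, H x s t := by
        refine lintegral_congr fun s => lintegral_lintegral_swap (Measurable.aemeasurable ?_)
        exact hm3.comp (by fun_prop : Measurable fun z : V × ℝ => (z.1, s, z.2))
    _ ≤ ENNReal.ofReal ψ.rOut * κ univ := by
        simp only [hH1, lintegral_const, MeasurableSet.univ, Measure.restrict_apply, univ_inter,
          Real.volume_Icc, sub_zero, ENNReal.ofReal_one, mul_one]
        rw [lintegral_mul_const _ hψm, ← ofReal_integral_eq_lintegral_ofReal ψ.integrable_normed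
          (Eventually.of_forall ψ.nonneg_normed), ψ.integral_normed, ENNReal.ofReal_one, one_mul]

end Potential

/-! ### The function whose gradient is a curl free vector measure -/

section JumpFunction

variable {V : Type*} [NormedAddCommGroup V] [InnerProductSpace ℝ V] [FiniteDimensional ℝ V]
  [MeasurableSpace V] [BorelSpace V]

/-- The bump function at scale `1 / (k + 2)`. -/
def bump (V : Type*) [NormedAddCommGroup V] [InnerProductSpace ℝ V] (k : ℕ) :
    ContDiffBump (0 : V) where
  rIn := 1 / ((k : ℝ) + 2) / 2
  rOut := 1 / ((k : ℝ) + 2)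
  rIn_pos := by positivity
  rIn_lt_rOut := half_lt_self (by positivity)

omit [FiniteDimensional ℝ V] [MeasurableSpace V] [BorelSpace V] in
variable (V) in
theorem tendsto_bump_rOut : Tendsto (fun k => (bump V k).rOut) atTop (𝓝 0) := by
  have := (tendsto_one_div_add_atTop_nhds_zero_nat (𝕜 := ℝ)).comp (tendsto_add_atTop_nat 1)
  refine this.congr fun k => ?_
  simp only [bump, Function.comp_apply]
  push_cast
  ring

/-- The average of `u` at the scale of `φ`. -/
def average (φ : ContDiffBump (0 : V)) (u : V → ℝ) (x : V) : ℝ :=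
  ∫ s, φ.normed volume s * u (x - s)

/-- The ball of twice the radius of `φ` around `x` is contained in the unit ball and does not meet
`C`. -/
def Far (C : Set V) (φ : ContDiffBump (0 : V)) (x : V) : Prop :=
  ‖x‖ + 2 * φ.rOut < 1 ∧ Disjoint (closedBall x (2 * φ.rOut)) C

/-- Points near a point off `C` are far from `C`, at all sufficiently small scales. -/
theorem exists_far_of_mem {C : Set V} (hC : IsClosed C) {x : V} (hx : x ∈ ball (0 : V) 1 \ C) :
    ∃ δ > 0, ∀ φ : ContDiffBump (0 : V), φ.rOut < δ → ∀ y ∈ closedBall x φ.rOut, Far C φ y := by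
  obtain ⟨r, hr, hr'⟩ := Metric.isOpen_iff.1 hC.isOpen_compl x hx.2
  have hx1 : ‖x‖ < 1 := by simpa using hx.1
  refine ⟨min (r / 3) ((1 - ‖x‖) / 3), by
    refine lt_min (by positivity) (by linarith), fun φ hφ y hy => ⟨?_, ?_⟩⟩
  · have := norm_le_of_mem_closedBall hy
    have := lt_of_lt_of_le hφ (min_le_right _ _)
    linarith
  · rw [Set.disjoint_left]
    intro z hz
    refine hr' ?_
    have h1 := lt_of_lt_of_le hφ (min_le_left _ _)
    rw [mem_ball]
    rw [mem_closedBall] at hy hz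
    have := dist_triangle z y x
    linarith

theorem eventually_far {C : Set V} (hC : IsClosed C) {x : V} (hx : x ∈ ball (0 : V) 1 \ C) :
    ∀ᶠ k in atTop, Far C (bump V k) x := by
  obtain ⟨δ, hδ, h⟩ := exists_far_of_mem hC hx
  filter_upwards [(tendsto_bump_rOut V).eventually (gt_mem_nhds hδ)] with k hk
  exact h _ hk x (mem_closedBall_self (bump V k).rOut_pos.le)

variable {κ : Measure V} [IsFiniteMeasure κ] {v : V → V} {C : Set V}

/-- The pointwise limit of the normalized potentials off the support of the measure. -/
theorem exists_limit_potential (hv : Integrable v κ) (hcurl : IsCurlFreeOn v κ (ball 0 1))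
    (hκC : κ Cᶜ = 0) (p : V) :
    ∃ (F : ContDiffBump (0 : V) → V → ℝ) (u : V → ℝ), (∀ φ, IsPotential φ κ v (F φ) ∧ F φ p = 0) ∧
      (∀ φ x, Far C φ p → Far C φ x → F φ x = u x) ∧ (∀ x ∉ ball (0 : V) 1 \ C, u x = 0) := by
  choose F hF using fun φ => hcurl.exists_isPotential hv φ p
  classical
  have hnull : ∀ x r, Disjoint (closedBall x r) C → κ (closedBall x r) = 0 := fun x r h =>
    measure_mono_null (Set.disjoint_left.1 h) hκC
  have hagree : ∀ φ ψ x, Far C φ p → Far C ψ p → Far C φ x → Far C ψ x → F φ x = F ψ x := by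
    intro φ ψ x h1 h2 h3 h4
    have hle : φ.rOut + ψ.rOut ≤ 2 * φ.rOut ∨ φ.rOut + ψ.rOut ≤ 2 * ψ.rOut := by
      rcases le_total φ.rOut ψ.rOut with h | h
      · right; linarith
      · left; linarith
    have hz : ∀ y, Far C φ y → Far C ψ y → ‖y‖ + φ.rOut + ψ.rOut < 1 ∧
        κ (closedBall y (φ.rOut + ψ.rOut)) = 0 := by
      intro y hy hy'
      rcases hle with h | h
      · exact ⟨by have := hy.1; linarith,
          measure_mono_null (closedBall_subset_closedBall h) (hnull _ _ hy.2)⟩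
      · exact ⟨by have := hy'.1; linarith,
          measure_mono_null (closedBall_subset_closedBall h) (hnull _ _ hy'.2)⟩
    exact (hF φ).1.eq_of_far hv (hF ψ).1 (hF φ).2 (hF ψ).2 (hz x h3 h4).1 (hz p h1 h2).1
      (hz x h3 h4).2 (hz p h1 h2).2
  refine ⟨F, fun x => if h : x ∈ ball (0 : V) 1 \ C ∧ ∃ φ, Far C φ p ∧ Far C φ x then
    F h.2.choose x else 0, hF, fun φ x hp hx => ?_, fun x hx => dif_neg fun h => hx h.1⟩
  have h : x ∈ ball (0 : V) 1 \ C ∧ ∃ φ, Far C φ p ∧ Far C φ x := by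
    refine ⟨⟨?_, ?_⟩, φ, hp, hx⟩
    · have := hx.1
      have := φ.rOut_pos
      rw [mem_ball_zero_iff]; linarith
    · exact Set.disjoint_left.1 hx.2 (mem_closedBall_self (by have := φ.rOut_pos; linarith))
  simp only [dif_pos h]
  exact hagree _ _ x hp h.2.choose_spec.1 hx h.2.choose_spec.2

/-- `u` is locally constant on the part of the unit ball off `C`. -/
def LocConst (C : Set V) (u : V → ℝ) : Prop :=
  ∀ x ∈ ball (0 : V) 1 \ C, ∀ᶠ y in 𝓝 x, u y = u x

theorem LocConst.measurable {u : V → ℝ} (hC : IsClosed C) (hu : LocConst C u)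
    (h0 : ∀ x ∉ ball (0 : V) 1 \ C, u x = 0) : Measurable u := by
  have hO : IsOpen (ball (0 : V) 1 \ C) := isOpen_ball.sdiff hC
  refine measurable_of_isOpen fun s hs => ?_
  have h1 : IsOpen (u ⁻¹' s ∩ (ball (0 : V) 1 \ C)) := by
    rw [isOpen_iff_mem_nhds]
    rintro x ⟨hx, hx'⟩
    filter_upwards [hu x hx', hO.mem_nhds hx'] with y hy hy'
    exact ⟨by rw [mem_preimage, hy]; exact hx, hy'⟩
  by_cases h2 : (0 : ℝ) ∈ s
  · have : u ⁻¹' s = (u ⁻¹' s ∩ (ball (0 : V) 1 \ C)) ∪ (ball (0 : V) 1 \ C)ᶜ := by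
      ext x
      by_cases hx : x ∈ ball (0 : V) 1 \ C
      · simp [hx]
      · simp [hx, h0 x hx, h2]
    rw [this]
    exact h1.measurableSet.union hO.measurableSet.compl
  · have : u ⁻¹' s = u ⁻¹' s ∩ (ball (0 : V) 1 \ C) := by
      ext x
      by_cases hx : x ∈ ball (0 : V) 1 \ C
      · simp [hx]
      · simp [hx, h0 x hx, h2]
    rw [this]
    exact h1.measurableSet

/-- The limit `u` of the potentials is close to the potential at scale `φ.rOut` in `L¹`: let the
other scale tend to zero in `IsPotential.lintegral_average_sub_le`. -/
theorem lintegral_sub_potential_le (hvm : Measurable v) (hv1 : ∀ y, ‖v y‖ ≤ 1)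
    (hC : IsClosed C) (hκC : κ Cᶜ = 0) (hC0 : volume C = 0) {p : V}
    {F : ContDiffBump (0 : V) → V → ℝ} {u : V → ℝ}
    (hp : p ∈ ball (0 : V) 1 \ C)
    (hF : ∀ φ, IsPotential φ κ v (F φ) ∧ F φ p = 0)
    (hFu : ∀ φ x, Far C φ p → Far C φ x → F φ x = u x) {φ : ContDiffBump (0 : V)}
    (hφ : Far C φ p) {R : ℝ} (hR : R + φ.rOut < 1) :
    ∫⁻ x in ball 0 R, ‖F φ x - u x‖ₑ ≤ ENNReal.ofReal φ.rOut * κ univ := by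
  have hv : Integrable v κ := Integrable.of_bound hvm.aestronglyMeasurable 1
    (Eventually.of_forall hv1)
  have hmeas : ∀ ψ : ContDiffBump (0 : V), R + ψ.rOut < 1 →
      AEMeasurable (F ψ) (volume.restrict (ball 0 R)) := by
    intro ψ hψ
    refine ContinuousOn.aemeasurable (fun x hx => ?_) measurableSet_ball
    rw [mem_ball_zero_iff] at hx
    exact ((hF ψ).1.continuousAt (by linarith)).continuousWithinAt
  have hnull : ∀ x r, Disjoint (closedBall x r) C → κ (closedBall x r) = 0 := fun x r h =>
    measure_mono_null (Set.disjoint_left.1 h) hκC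
  have hsmall : ∀ᶠ k in atTop, R + φ.rOut + (bump V k).rOut < 1 ∧ (bump V k).rOut < φ.rOut := by
    filter_upwards [(tendsto_bump_rOut V).eventually (gt_mem_nhds (sub_pos.2 hR)),
      (tendsto_bump_rOut V).eventually (gt_mem_nhds φ.rOut_pos)] with k hk hk'
    exact ⟨by linarith, hk'⟩
  obtain ⟨N, hN⟩ := eventually_atTop.1 hsmall
  have hb0 : Tendsto (fun k => (bump V (k + N)).rOut) atTop (𝓝 0) :=
    (tendsto_bump_rOut V).comp (tendsto_add_atTop_nat N)
  have hae : ∀ᵐ x ∂(volume.restrict (ball (0 : V) R)),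
      ‖F φ x - u x‖ₑ = liminf (fun k => ‖F φ x - F (bump V (k + N)) x‖ₑ) atTop := by
    rw [ae_restrict_iff' measurableSet_ball]
    filter_upwards [measure_eq_zero_iff_ae_notMem.1 hC0] with x hxC hxR
    have hx : x ∈ ball (0 : V) 1 \ C := by
      refine ⟨?_, hxC⟩
      rw [mem_ball_zero_iff] at hxR ⊢
      have := φ.rOut_pos
      linarith
    refine (Tendsto.liminf_eq ?_).symm
    refine tendsto_const_nhds.congr' ?_
    filter_upwards [(tendsto_add_atTop_nat N).eventually (eventually_far hC hx),
      (tendsto_add_atTop_nat N).eventually (eventually_far hC hp)] with k h1 h2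
    rw [hFu _ _ h2 h1]
  rw [lintegral_congr_ae hae]
  refine (lintegral_liminf_le' fun k => ?_).trans ?_
  · have hk := hN (k + N) le_add_self
    have := φ.rOut_pos
    exact ((hmeas φ hR).sub (hmeas _ (by linarith [hk.1]))).enorm
  have hbound : ∀ᶠ k in atTop, ∫⁻ x in ball 0 R, ‖F φ x - F (bump V (k + N)) x‖ₑ ≤
      ENNReal.ofReal (bump V (k + N)).rOut * κ univ + ENNReal.ofReal φ.rOut * κ univ := by
    filter_upwards [(tendsto_add_atTop_nat N).eventually (eventually_far hC hp)] with k hkp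
    have hk := hN (k + N) le_add_self
    have h1 := (hF φ).1.lintegral_average_sub_le (ψ := bump V (k + N)) hvm hv1 hk.1
    have h2 := (hF (bump V (k + N))).1.lintegral_average_sub_le (ψ := φ) hvm hv1
      (R := R) (by linarith [hk.1])
    refine le_trans ?_ (add_le_add h1 h2)
    rw [← lintegral_add_left']
    · refine setLIntegral_mono' measurableSet_ball fun x hx => ?_
      rw [mem_ball_zero_iff] at hx
      have hav := (hF φ).1.average_eq_average (ψ := bump V (k + N)) hv (hF (bump V (k + N))).1
        (x := x) (p := p)
        (hF φ).2 (hF _).2 (by linarith [hk.1]) (by linarith [hk.2, hφ.1])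
        (measure_mono_null (closedBall_subset_closedBall (by linarith [hk.2])) (hnull _ _ hφ.2))
      rw [hav]
      have : F φ x - F (bump V (k + N)) x =
          -((∫ s, φ.normed volume s * F (bump V (k + N)) (x - s)) - F φ x) +
          ((∫ s, φ.normed volume s * F (bump V (k + N)) (x - s)) - F (bump V (k + N)) x) := by ring
      rw [this]
      refine (enorm_add_le _ _).trans ?_
      rw [enorm_neg]
    · refine AEMeasurable.enorm (AEMeasurable.sub ?_ (hmeas φ hR))
      refine ContinuousOn.aemeasurable (fun x hx => ?_) measurableSet_ball
      rw [mem_ball_zero_iff] at hx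
      exact ((hF φ).1.hasFDerivAt_average hv (bump V (k + N))
        (by linarith [hk.1])).continuousAt.continuousWithinAt
  refine (liminf_le_liminf hbound).trans ?_
  refine le_of_eq (Tendsto.liminf_eq ?_)
  have h0 : Tendsto (fun k => ENNReal.ofReal (bump V (k + N)).rOut * κ univ) atTop
      (𝓝 (0 * κ univ)) := by
    refine ENNReal.Tendsto.mul_const ?_ (Or.inr (measure_ne_top _ _))
    simpa using ENNReal.tendsto_ofReal hb0
  rw [zero_mul] at h0
  simpa using h0.add_const (ENNReal.ofReal φ.rOut * κ univ)

theorem tendsto_average_bump {f : V → ℝ} {x : V} (hf : ∀ᶠ y in 𝓝 x, ContinuousAt f y) :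
    Tendsto (fun k => average (bump V k) f x) atTop (𝓝 (f x)) := by
  rw [Metric.tendsto_atTop']
  intro ε hε
  obtain ⟨r, hr, hr'⟩ := Metric.eventually_nhds_iff_ball.1
    (hf.and (Metric.continuousAt_iff'.1 hf.self_of_nhds (ε / 2) (half_pos hε)))
  obtain ⟨n, hn⟩ := eventually_atTop.1 ((tendsto_bump_rOut V).eventually (gt_mem_nhds hr))
  refine ⟨n, fun k hk => ?_⟩
  have hk' := hn k hk.le
  have hI : Integrable fun s => (bump V k).normed volume s * f (x - s) :=
    integrable_normed_mul_of_continuousAt _ fun y hy =>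
      (hr' y (closedBall_subset_ball hk' hy)).1
  have : average (bump V k) f x - f x =
      ∫ s, (bump V k).normed volume s * (f (x - s) - f x) := by
    simp_rw [mul_sub]
    rw [integral_sub hI ((bump V k).integrable_normed.mul_const _), integral_mul_const,
      (bump V k).integral_normed, one_mul]
    rfl
  rw [dist_eq_norm, this]
  have hle : ‖∫ s, (bump V k).normed volume s * (f (x - s) - f x)‖ ≤
      ∫ s, (bump V k).normed volume s * (ε / 2) := by
    refine norm_integral_le_of_norm_le ((bump V k).integrable_normed.mul_const _)
      (Eventually.of_forall fun s => ?_)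
    rw [norm_mul, Real.norm_of_nonneg ((bump V k).nonneg_normed s)]
    by_cases h0 : (bump V k).normed volume s = 0
    · simp [h0]
    · refine mul_le_mul_of_nonneg_left ?_ ((bump V k).nonneg_normed s)
      have hs := norm_lt_of_normed_ne_zero _ h0
      have := (hr' (x - s) (by rw [mem_ball, dist_eq_norm]; simp; linarith)).2
      rw [dist_eq_norm] at this
      exact this.le
  rw [integral_mul_const, (bump V k).integral_normed, one_mul] at hle
  linarith

/-- A curl free vector measure on the unit ball which is carried by a closed null set `C` is the
distributional gradient of a function which is locally constant off `C`. -/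
theorem exists_jump_function (hvm : Measurable v) (hv1 : ∀ y, ‖v y‖ ≤ 1)
    (hcurl : IsCurlFreeOn v κ (ball 0 1)) (hC : IsClosed C) (hκC : κ Cᶜ = 0) (hC0 : volume C = 0)
    (hbdd : ∀ u : V → ℝ, LocConst C u → ∃ L, ∀ x ∈ ball (0 : V) 1 \ C, |u x| ≤ L) :
    ∃ u : V → ℝ, LocConst C u ∧ Measurable u ∧ (∃ L, ∀ x, |u x| ≤ L) ∧
      ∃ δ > 0, ∀ φ : ContDiffBump (0 : V), φ.rOut < δ → IsPotential φ κ v (average φ u) := by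
  have hv : Integrable v κ := Integrable.of_bound hvm.aestronglyMeasurable 1
    (Eventually.of_forall hv1)
  obtain ⟨p, hp⟩ : (ball (0 : V) 1 \ C).Nonempty := by
    by_contra h
    rw [not_nonempty_iff_eq_empty, sdiff_eq_empty] at h
    exact (measure_ball_pos volume (0 : V) one_pos).ne' (measure_mono_null h hC0)
  obtain ⟨F, u, hF, hFu, hu0⟩ := exists_limit_potential hv hcurl hκC p
  obtain ⟨δp, hδp, hfarp⟩ := exists_far_of_mem hC hp
  have hnull : ∀ x r, Disjoint (closedBall x r) C → κ (closedBall x r) = 0 := fun x r h =>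
    measure_mono_null (Set.disjoint_left.1 h) hκC
  have hloc : LocConst C u := by
    intro x hx
    obtain ⟨δ, hδ, hfar⟩ := exists_far_of_mem hC hx
    obtain ⟨k, hk, hk'⟩ := (((tendsto_bump_rOut V).eventually (gt_mem_nhds hδ)).and
      ((tendsto_bump_rOut V).eventually (gt_mem_nhds hδp))).exists
    have hpk := hfarp _ hk' p (mem_closedBall_self (bump V k).rOut_pos.le)
    have hxk := hfar _ hk x (mem_closedBall_self (bump V k).rOut_pos.le)
    filter_upwards [closedBall_mem_nhds x (bump V k).rOut_pos] with y hy
    rw [← hFu _ y hpk (hfar _ hk y hy), ← hFu _ x hpk hxk]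
    refine (hF _).1.eq_of_measure_eq_zero (r := (bump V k).rOut) (by linarith [hxk.1]) ?_ hy
    rw [← two_mul]
    exact hnull _ _ hxk.2
  have hum := hloc.measurable hC hu0
  obtain ⟨L, hL⟩ := hbdd u hloc
  have hL' : ∀ x, |u x| ≤ max L 0 := by
    intro x
    by_cases hx : x ∈ ball (0 : V) 1 \ C
    · exact (hL x hx).trans (le_max_left _ _)
    · rw [hu0 x hx, abs_zero]; exact le_max_right _ _
  refine ⟨u, hloc, hum, ⟨_, hL'⟩, δp, hδp, fun φ hφ => ?_⟩
  have hφp := hfarp φ hφ p (mem_closedBall_self φ.rOut_pos.le)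
  have key : ∀ x, ‖x‖ + φ.rOut < 1 → average φ u x = F φ x := by
    intro x hx
    have hIu : Integrable fun s => φ.normed volume s * u (x - s) :=
      φ.integrable_normed.mul_bdd (c := max L 0)
        (hum.comp (measurable_const.sub measurable_id)).aestronglyMeasurable
        (Eventually.of_forall fun s => hL' _)
    have h1 : Tendsto (fun k => average (bump V k) (F φ) x) atTop (𝓝 (F φ x)) := by
      refine tendsto_average_bump ?_
      have : ∀ᶠ y in 𝓝 x, ‖y‖ + φ.rOut < 1 :=
        (continuous_norm.add continuous_const).continuousAt.eventually (gt_mem_nhds hx)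
      exact this.mono fun y hy => (hF φ).1.continuousAt hy
    have h2 : Tendsto (fun k => average φ (F (bump V k)) x) atTop (𝓝 (average φ u x)) := by
      obtain ⟨K, hK0, hK⟩ := exists_bound_normed φ
      rw [tendsto_iff_edist_tendsto_0]
      have hlim : Tendsto (fun k => ENNReal.ofReal K * (ENNReal.ofReal (bump V k).rOut * κ univ))
          atTop (𝓝 0) := by
        have h0 : Tendsto (fun k => ENNReal.ofReal K * (ENNReal.ofReal (bump V k).rOut * κ univ))
            atTop (𝓝 (ENNReal.ofReal K * (0 * κ univ))) := by
          refine ENNReal.Tendsto.const_mul (ENNReal.Tendsto.mul_const ?_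
            (Or.inr (measure_ne_top _ _))) (Or.inr ENNReal.ofReal_ne_top)
          simpa using ENNReal.tendsto_ofReal (tendsto_bump_rOut V)
        simpa using h0
      refine tendsto_of_tendsto_of_tendsto_of_le_of_le' tendsto_const_nhds hlim
        (Eventually.of_forall fun _ => zero_le) ?_
      filter_upwards [(tendsto_bump_rOut V).eventually (gt_mem_nhds (sub_pos.2 hx)),
        eventually_far hC hp] with k hk hkp
      have hIk := (hF (bump V k)).1.integrable (ψ := φ) (x := x) (by linarith)
      have hb := lintegral_sub_potential_le hvm hv1 hC hκC hC0 hp hF hFu hkp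
        (R := ‖x‖ + φ.rOut) (by linarith)
      rw [edist_eq_enorm_sub]
      unfold average
      rw [← integral_sub hIk hIu]
      refine (enorm_integral_le_lintegral_enorm _).trans ?_
      calc _ ≤ ∫⁻ s, ENNReal.ofReal K * (ball (0 : V) (‖x‖ + φ.rOut)).indicator
            (fun y => ‖F (bump V k) y - u y‖ₑ) (x - s) := by
            refine lintegral_mono fun s => ?_
            by_cases h0 : φ.normed volume s = 0
            · simp [h0]
            · have hs := norm_lt_of_normed_ne_zero _ h0
              rw [indicator_of_mem, ← mul_sub, enorm_mul]
              · gcongr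
                rw [← ofReal_norm]
                exact ENNReal.ofReal_le_ofReal (hK s)
              · rw [mem_ball_zero_iff]
                have := norm_sub_le x s
                linarith
        _ = ENNReal.ofReal K * ∫⁻ y in ball (0 : V) (‖x‖ + φ.rOut),
            ‖F (bump V k) y - u y‖ₑ := by
            rw [lintegral_const_mul' _ _ ENNReal.ofReal_ne_top,
              lintegral_sub_left_eq_self, lintegral_indicator measurableSet_ball]
        _ ≤ _ := by gcongr
    refine tendsto_nhds_unique_of_eventuallyEq h2 h1 ?_
    filter_upwards [(tendsto_bump_rOut V).eventually (gt_mem_nhds (sub_pos.2 hx)),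
      (tendsto_bump_rOut V).eventually (gt_mem_nhds φ.rOut_pos)] with k hk hk'
    exact ((hF φ).1.average_eq_average (ψ := bump V k) hv (hF (bump V k)).1 (x := x) (p := p)
        (hF φ).2 (hF _).2 (by linarith) (by linarith [hφp.1])
        (measure_mono_null (closedBall_subset_closedBall (by linarith)) (hnull _ _ hφp.2))).symm
  intro x hx
  refine ((hF φ).1 x hx).congr_of_eventuallyEq ?_
  have : ∀ᶠ y in 𝓝 x, ‖y‖ + φ.rOut < 1 :=
    (continuous_norm.add continuous_const).continuousAt.eventually (gt_mem_nhds hx)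
  filter_upwards [this] with y hy using key y hy

end JumpFunction

/-! ### Jump functions of cones -/

section ConeField

variable {V : Type*} [NormedAddCommGroup V] [InnerProductSpace ℝ V] [FiniteDimensional ℝ V]
  [MeasurableSpace V] [BorelSpace V]

/-- A closed null cone `C` is two-sided away from its vertex: its points have arbitrarily small
neighborhoods which `C` cuts into two connected pieces. -/
structure IsTwoSidedCone (C : Set V) : Prop where
  isClosed : IsClosed C
  null : volume C = 0
  smul_mem : ∀ x ∈ C, ∀ t : ℝ, 0 ≤ t → t • x ∈ C
  sides : ∀ y ∈ C, y ≠ 0 → ∀ O ∈ 𝓝 y, ∃ N ∈ 𝓝 y, N ⊆ O ∧ ∃ N₁ N₂ : Set V,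
    IsPreconnected N₁ ∧ IsPreconnected N₂ ∧ N \ C = N₁ ∪ N₂

/-- The data that a calibration leaves on the cone `C`: `v` is a weakly divergence free field of
norm at most one in the unit ball, continuous on `W`, and `v κ` is a curl free vector measure
carried by `C` on which `v` has norm one. -/
structure IsCalibratingField (v : V → V) (W : Set V) (κ : Measure V) (C : Set V) : Prop where
  measurable : Measurable v
  norm_le : ∀ x, ‖v x‖ ≤ 1
  isOpen : IsOpen W
  subset : W ⊆ ball 0 1
  contOn : ContinuousOn v W
  null : volume (ball 0 1 \ W) = 0
  divFree : ∀ φ : V → ℝ, ContDiff ℝ 1 φ → HasCompactSupport φ → tsupport φ ⊆ ball 0 1 →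
    ∫ x, fderiv ℝ φ x (v x) = 0
  carrier : κ Wᶜ = 0
  carrier_cone : κ Cᶜ = 0
  unit : ∀ᵐ x ∂κ, ‖v x‖ = 1
  curlFree : IsCurlFreeOn v κ (ball 0 1)
  pos : ∀ O : Set V, IsOpen O → (O ∩ (C ∩ ball 0 1)).Nonempty → κ O ≠ 0

/-- `u` is a function whose distributional gradient in the unit ball is the vector measure `v κ`,
and which is locally constant off `C`. -/
structure IsJumpFunction (v : V → V) (κ : Measure V) (C : Set V) (u : V → ℝ) : Prop where
  locConst : LocConst C u
  measurable : Measurable u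
  bounded : ∃ L, ∀ x, |u x| ≤ L
  potential : ∃ δ > 0, ∀ φ : ContDiffBump (0 : V), φ.rOut < δ → IsPotential φ κ v (average φ u)

variable {v : V → V} {W : Set V} {κ : Measure V} {C : Set V} {u : V → ℝ}

theorem IsTwoSidedCone.smul_notMem (hC : IsTwoSidedCone C) {x : V} (hx : x ∉ C) {t : ℝ}
    (ht : 0 < t) : t • x ∉ C := by
  intro h
  have := hC.smul_mem _ h t⁻¹ (inv_nonneg.2 ht.le)
  rw [smul_smul, inv_mul_cancel₀ ht.ne', one_smul] at this
  exact hx this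

theorem LocConst.eq_of_isPreconnected (hu : LocConst C u) {A : Set V} (hA : IsPreconnected A)
    (hAC : A ⊆ ball 0 1 \ C) {x y : V} (hx : x ∈ A) (hy : y ∈ A) : u x = u y := by
  have := isPreconnected_iff_preconnectedSpace.1 hA
  have hl : IsLocallyConstant (A.domRestrict u) := by
    rw [IsLocallyConstant.iff_eventually_eq]
    intro z
    exact (continuous_subtype_val.tendsto z).eventually (hu z (hAC z.2))
  exact hl.apply_eq_of_preconnectedSpace ⟨x, hx⟩ ⟨y, hy⟩

theorem LocConst.smul_of_le (hu : LocConst C u) (hC : IsTwoSidedCone C) {x : V}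
    (hx : x ∈ ball (0 : V) 1 \ C) {t : ℝ} (ht : 0 < t) (ht1 : t ≤ 1) : u (t • x) = u x := by
  have hpre : IsPreconnected ((fun s : ℝ => s • x) '' Icc t 1) :=
    isPreconnected_Icc.image _ (by fun_prop)
  refine hu.eq_of_isPreconnected hpre ?_ ⟨t, ⟨le_rfl, ht1⟩, rfl⟩ ⟨1, ⟨ht1, le_rfl⟩, one_smul _ _⟩
  rintro _ ⟨s, hs, rfl⟩
  have hs0 : 0 < s := ht.trans_le hs.1
  refine ⟨?_, hC.smul_notMem hx.2 hs0⟩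
  have h1 : ‖x‖ < 1 := by simpa using hx.1
  rw [mem_ball_zero_iff, norm_smul, Real.norm_of_nonneg hs0.le]
  exact (mul_le_of_le_one_left (norm_nonneg _) hs.2).trans_lt h1

/-- A locally constant function off a cone is constant along open rays. -/
theorem LocConst.smul (hu : LocConst C u) (hC : IsTwoSidedCone C) {x : V}
    (hx : x ∈ ball (0 : V) 1 \ C) {t : ℝ} (ht : 0 < t) (ht1 : ‖t • x‖ < 1) : u (t • x) = u x := by
  rcases le_total t 1 with h | h
  · exact hu.smul_of_le hC hx ht h
  · have := hu.smul_of_le hC (x := t • x) ⟨by simpa using ht1, hC.smul_notMem hx.2 ht⟩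
      (inv_pos.2 ht) (inv_le_one_of_one_le₀ h)
    rwa [smul_smul, inv_mul_cancel₀ ht.ne', one_smul, eq_comm] at this

/-- The radial projection maps to the sphere of radius `1 / 2`. -/
theorem norm_half_smul {x : V} (hx : x ≠ 0) : ‖(1 / (2 * ‖x‖)) • x‖ = 1 / 2 := by
  have : ‖x‖ ≠ 0 := norm_ne_zero_iff.2 hx
  rw [norm_smul, Real.norm_of_nonneg (by positivity)]
  field_simp

/-- Near each point of a sphere, `u` takes at most two values, as the cone is two-sided; by
homogeneity and compactness it takes finitely many. -/
theorem LocConst.finite_image (hu : LocConst C u) (hC : IsTwoSidedCone C) :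
    (u '' (ball (0 : V) 1 \ C)).Finite := by
  have hloc : ∀ x ∈ sphere (0 : V) (1 / 2), ∃ N ∈ 𝓝 x, (u '' (N \ C)).Finite := by
    intro x hx
    rw [mem_sphere_zero_iff_norm] at hx
    have hxb : x ∈ ball (0 : V) 1 := by rw [mem_ball_zero_iff, hx]; norm_num
    by_cases hxC : x ∈ C
    · obtain ⟨N, hN, hNb, N₁, N₂, h1, h2, h12⟩ := hC.sides x hxC
        (by rintro rfl; norm_num at hx) _ (isOpen_ball.mem_nhds hxb)
      refine ⟨N, hN, ?_⟩
      have hsub : ∀ A, A ⊆ N \ C → IsPreconnected A → (u '' A).Finite := by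
        intro A hA hpre
        refine Set.Subsingleton.finite ?_
        rintro _ ⟨a, ha, rfl⟩ _ ⟨b, hb, rfl⟩
        exact hu.eq_of_isPreconnected hpre (hA.trans (sdiff_subset_sdiff_left hNb)) ha hb
      rw [h12, image_union]
      exact (hsub _ (h12 ▸ subset_union_left) h1).union (hsub _ (h12 ▸ subset_union_right) h2)
    · refine ⟨_, hu x ⟨hxb, hxC⟩, (finite_singleton (u x)).subset ?_⟩
      rintro _ ⟨y, hy, rfl⟩
      exact hy.1
  choose! N hN hfin using hloc
  obtain ⟨t, ht, hcover⟩ := (isCompact_sphere (0 : V) (1 / 2)).elim_nhds_subcover N hN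
  refine ((finite_singleton (u 0)).union
    (t.finite_toSet.biUnion fun x hx => hfin x (ht x hx))).subset ?_
  rintro _ ⟨x, hx, rfl⟩
  by_cases h0 : x = 0
  · left; rw [h0]; rfl
  · right
    have hn := norm_half_smul h0
    have hpos : 0 < 1 / (2 * ‖x‖) := by have := norm_pos_iff.2 h0; positivity
    obtain ⟨z, hz, hz'⟩ := mem_iUnion₂.1 (hcover (mem_sphere_zero_iff_norm.2 hn))
    rw [← hu.smul hC hx hpos (by rw [hn]; norm_num)]
    exact mem_iUnion₂.2 ⟨z, hz, _, ⟨hz', hC.smul_notMem hx.2 hpos⟩, rfl⟩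

/-- The jump function of a calibrated two-sided cone. -/
theorem IsCalibratingField.exists_isJumpFunction [IsFiniteMeasure κ]
    (h : IsCalibratingField v W κ C) (hC : IsTwoSidedCone C) : ∃ u, IsJumpFunction v κ C u := by
  obtain ⟨u, h1, h2, h3, h4⟩ := exists_jump_function h.measurable h.norm_le h.curlFree hC.isClosed
    h.carrier_cone hC.null fun u hu => by
      obtain ⟨L, hL⟩ := ((hu.finite_image hC).image abs).bddAbove
      exact ⟨L, fun x hx => hL ⟨_, ⟨x, hx, rfl⟩, rfl⟩⟩
  exact ⟨u, h1, h2, h3, h4⟩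

theorem IsCalibratingField.integrable [IsFiniteMeasure κ] (h : IsCalibratingField v W κ C) :
    Integrable v κ :=
  Integrable.of_bound h.measurable.aestronglyMeasurable 1 (Eventually.of_forall h.norm_le)

theorem bump_rOut_lt_one (k : ℕ) : (bump V k).rOut < 1 := by
  simp only [bump]
  have : (0 : ℝ) ≤ k := Nat.cast_nonneg k
  rw [div_lt_one (by positivity)]
  linarith

theorem norm_add_lt_one {z : V} {δ s : ℝ} (hδ : 0 ≤ δ) (hs : δ < s) (h1 : δ < 1)
    (h : ball z s ⊆ ball 0 1) : ‖z‖ + δ < 1 := by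
  by_cases hz : z = 0
  · simpa [hz] using h1
  · have hzn : 0 < ‖z‖ := norm_pos_iff.2 hz
    have hmem : (1 + δ / ‖z‖) • z ∈ ball z s := by
      rw [mem_ball, dist_eq_norm, add_smul, one_smul, add_sub_cancel_left, norm_smul,
        Real.norm_of_nonneg (by positivity), div_mul_cancel₀ _ hzn.ne']
      exact hs
    have := h hmem
    rwa [mem_ball_zero_iff, norm_smul, Real.norm_of_nonneg (by positivity), add_mul, one_mul,
      div_mul_cancel₀ _ hzn.ne'] at this

/-- Averages agree with `u` near a point off `C`, uniformly for small scales. -/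
theorem IsJumpFunction.average_eq (hu : IsJumpFunction v κ C u) {x : V}
    (hx : x ∈ ball (0 : V) 1 \ C) : ∃ r > 0, ∀ φ : ContDiffBump (0 : V), φ.rOut < r →
      ∀ y ∈ ball x r, average φ u y = u x := by
  obtain ⟨r, hr, hr'⟩ := Metric.eventually_nhds_iff_ball.1 (hu.locConst x hx)
  refine ⟨r / 2, half_pos hr, fun φ hφ y hy => ?_⟩
  refine integral_normed_mul_eq_of_const fun z hz => hr' z ?_
  rw [mem_ball] at hy ⊢
  rw [mem_closedBall] at hz
  have := dist_triangle z y x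
  linarith

theorem IsJumpFunction.eventually_isPotential (hu : IsJumpFunction v κ C u) :
    ∀ᶠ k in atTop, IsPotential (bump V k) κ v (average (bump V k) u) := by
  obtain ⟨δ, hδ, h⟩ := hu.potential
  filter_upwards [(tendsto_bump_rOut V).eventually (gt_mem_nhds hδ)] with k hk using h _ hk

theorem IsJumpFunction.eventually_average_eq (hu : IsJumpFunction v κ C u) {x : V}
    (hx : x ∈ ball (0 : V) 1 \ C) :
    ∀ᶠ k in atTop, average (bump V k) u x = u x := by
  obtain ⟨r, hr, h⟩ := hu.average_eq hx
  filter_upwards [(tendsto_bump_rOut V).eventually (gt_mem_nhds hr)] with k hk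
  exact h _ hk x (mem_ball_self hr)

/-- The jump function increases in the directions that make an acute angle with `v`. -/
theorem IsJumpFunction.le_of_inner_nonneg [IsFiniteMeasure κ] (h : IsCalibratingField v W κ C)
    (hu : IsJumpFunction v κ C u) {p x y : V} {r : ℝ} (hr : ball p r ⊆ ball 0 1)
    (hx : x ∈ ball p r \ C) (hy : y ∈ ball p r \ C)
    (hv : ∀ᵐ z ∂κ, z ∈ ball p r → 0 ≤ ⟪v z, y - x⟫) : u x ≤ u y := by
  have hlim : ∀ᶠ k in atTop, average (bump V k) u x ≤ average (bump V k) u y := by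
    have hx' := hx.1
    have hy' := hy.1
    rw [mem_ball] at hx' hy'
    filter_upwards [hu.eventually_isPotential,
      (tendsto_bump_rOut V).eventually (gt_mem_nhds (sub_pos.2 hx')),
      (tendsto_bump_rOut V).eventually (gt_mem_nhds (sub_pos.2 hy'))] with k hk hkx hky
    have hseg : ∀ t ∈ Icc (0 : ℝ) 1, x + t • (y - x) ∈ ball p (r - (bump V k).rOut) := by
      intro t ht
      refine (convex_ball p (r - (bump V k).rOut)).add_smul_sub_mem ?_ ?_ ht
      · rw [mem_ball]; linarith
      · rw [mem_ball]; linarith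
    have hin : ∀ z ∈ ball p (r - (bump V k).rOut), ball z (bump V k).rOut ⊆ ball p r := by
      intro z hz
      rw [mem_ball] at hz
      exact ball_subset_ball' (by linarith)
    have hnorm : ∀ z ∈ ball p (r - (bump V k).rOut), ‖z‖ + (bump V k).rOut < 1 := by
      intro z hz
      rw [mem_ball] at hz
      exact norm_add_lt_one (s := r - dist z p) (bump V k).rOut_pos.le (by linarith)
        (bump_rOut_lt_one k) ((ball_subset_ball' (by linarith)).trans hr)
    have hd : ∀ t ∈ Icc (0 : ℝ) 1, HasDerivAt (fun t : ℝ => average (bump V k) u (x + t • (y - x)))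
        ⟪mollify (bump V k) κ v (x + t • (y - x)), y - x⟫ t := by
      intro t ht
      have h4 : HasDerivAt (fun t : ℝ => x + t • (y - x)) (y - x) t := by
        simpa using ((hasDerivAt_id t).smul_const (y - x)).const_add x
      exact (hk _ (hnorm _ (hseg t ht))).comp_hasDerivAt t h4
    have hmono : MonotoneOn (fun t : ℝ => average (bump V k) u (x + t • (y - x))) (Icc 0 1) := by
      refine monotoneOn_of_deriv_nonneg (convex_Icc 0 1)
        (fun t ht => (hd t ht).continuousAt.continuousWithinAt)
        (fun t ht => (hd t (interior_subset ht)).differentiableAt.differentiableWithinAt)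
        fun t ht => ?_
      rw [(hd t (interior_subset ht)).deriv, inner_mollify _ h.integrable]
      refine integral_nonneg_of_ae ?_
      filter_upwards [hv] with z hz
      by_cases h0 : (bump V k).normed volume (x + t • (y - x) - z) = 0
      · simp [h0]
      · refine mul_nonneg ((bump V k).nonneg_normed _) (hz ?_)
        refine hin _ (hseg t (interior_subset ht)) ?_
        rw [mem_ball, dist_comm, dist_eq_norm]
        exact norm_lt_of_normed_ne_zero _ h0
    have := hmono (left_mem_Icc.2 zero_le_one) (right_mem_Icc.2 zero_le_one) zero_le_one
    simpa using this
  obtain ⟨k, h1, h2, h3⟩ := (hlim.and ((hu.eventually_average_eq ⟨hr hx.1, hx.2⟩).and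
    (hu.eventually_average_eq ⟨hr hy.1, hy.2⟩))).exists
  rwa [h2, h3] at h1

/-- The field has norm one on the regular part of the cone. -/
theorem IsCalibratingField.norm_eq_one (h : IsCalibratingField v W κ C) {y : V} (hy : y ∈ C)
    (hyW : y ∈ W) : ‖v y‖ = 1 := by
  by_contra hne
  have hcont : ContinuousAt (fun x => ‖v x‖) y :=
    ((h.contOn y hyW).continuousAt (h.isOpen.mem_nhds hyW)).norm
  obtain ⟨O, hO, hOo, hyO⟩ := _root_.mem_nhds_iff.1 (hcont.eventually_ne hne)
  refine h.pos O hOo ⟨y, hyO, hy, h.subset hyW⟩ ?_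
  refine measure_mono_null (fun x hx => ?_) (ae_iff.1 h.unit)
  exact hO hx

/-- The regular points are dense in the cone. -/
theorem IsCalibratingField.exists_mem (h : IsCalibratingField v W κ C) {y : V} (hy : y ∈ C)
    (hy1 : ‖y‖ < 1) {O : Set V} (hO : O ∈ 𝓝 y) : ∃ z ∈ O, z ∈ C ∧ z ∈ W := by
  obtain ⟨O', hO', hOo, hyO⟩ := _root_.mem_nhds_iff.1 hO
  have hpos := h.pos O' hOo ⟨y, hyO, hy, by simpa using hy1⟩
  by_contra hcon
  push Not at hcon
  refine hpos (measure_mono_null (t := Wᶜ ∪ Cᶜ) (fun x hx => ?_)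
    (measure_union_null h.carrier h.carrier_cone))
  by_cases hxC : x ∈ C
  · exact Or.inl (hcon x (hO' hx) hxC)
  · exact Or.inr hxC

/-- The jump function is not constant near a regular point of the cone. -/
theorem IsJumpFunction.not_const [IsFiniteMeasure κ] (h : IsCalibratingField v W κ C)
    (hu : IsJumpFunction v κ C u) (hC : IsTwoSidedCone C) {y : V} (hy : y ∈ C) (hyW : y ∈ W)
    {O : Set V} (hO : O ∈ 𝓝 y) (c : ℝ) : ∃ x ∈ O, x ∉ C ∧ u x ≠ c := by
  by_contra hcon
  push Not at hcon
  have hcont : ContinuousAt (fun x => ⟪v x, v y⟫) y :=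
    ((h.contOn y hyW).continuousAt (h.isOpen.mem_nhds hyW)).inner continuousAt_const
  have hone : ⟪v y, v y⟫ = 1 := by rw [real_inner_self_eq_norm_sq, h.norm_eq_one hy hyW, one_pow]
  have hev : ∀ᶠ x in 𝓝 y, 1 / 2 < ⟪v x, v y⟫ :=
    hcont.eventually (lt_mem_nhds (show 1 / 2 < ⟪v y, v y⟫ by rw [hone]; norm_num))
  obtain ⟨r, hr, hr'⟩ := Metric.eventually_nhds_iff_ball.1
    (hev.and ((eventually_mem_set.2 hO).and
      (eventually_mem_set.2 (isOpen_ball.mem_nhds (h.subset hyW)))))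
  obtain ⟨k, hk, hkr⟩ := (hu.eventually_isPotential.and
    ((tendsto_bump_rOut V).eventually (gt_mem_nhds (half_pos hr)))).exists
  have hk1 : ∀ x ∈ ball y (r / 2), average (bump V k) u x = c := by
    intro x hx
    unfold average
    have : (fun s => (bump V k).normed volume s * u (x - s)) =ᵐ[volume]
        fun s => (bump V k).normed volume s * c := by
      have hnull : ∀ᵐ s, x - s ∉ C := by
        exact (Measure.measurePreserving_sub_left volume x).quasiMeasurePreserving.ae
          (measure_eq_zero_iff_ae_notMem.1 hC.null)
      filter_upwards [hnull] with s hs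
      by_cases h0 : (bump V k).normed volume s = 0
      · simp [h0]
      · rw [hcon _ _ hs]
        refine (hr' _ ?_).2.1
        have h1 := norm_lt_of_normed_ne_zero _ h0
        rw [mem_ball] at hx ⊢
        have h2 := dist_triangle (x - s) x y
        have h3 : dist (x - s) x = ‖s‖ := by simp
        linarith
    rw [integral_congr_ae this, integral_mul_const, (bump V k).integral_normed, one_mul]
  have hy1 : ‖y‖ + (bump V k).rOut < 1 :=
    norm_add_lt_one (s := r) (bump V k).rOut_pos.le (by linarith)
      (bump_rOut_lt_one k) fun z hz => (hr' z hz).2.2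
  have hd := hk y hy1
  have hd0 : HasFDerivAt (average (bump V k) u) (0 : V →L[ℝ] ℝ) y := by
    refine (hasFDerivAt_const c y).congr_of_eventuallyEq ?_
    filter_upwards [ball_mem_nhds y (half_pos hr)] with x hx using hk1 x hx
  have hzero : mollify (bump V k) κ v y = 0 := by
    have := hd.unique hd0
    have h2 := congrArg (fun T : V →L[ℝ] ℝ => T (mollify (bump V k) κ v y)) this
    simpa using h2
  have hint := inner_mollify (bump V k) h.integrable y (v y)
  rw [hzero, inner_zero_left, eq_comm, integral_eq_zero_iff_of_nonneg_ae] at hint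
  · refine h.pos (ball y (bump V k).rOut) isOpen_ball
      ⟨y, mem_ball_self (bump V k).rOut_pos, hy, h.subset hyW⟩ ?_
    refine measure_mono_null (fun x hx => ?_) (ae_iff.1 hint)
    have hx' := hx
    rw [mem_ball, dist_comm, dist_eq_norm] at hx'
    have h1 := normed_pos_of_lt _ hx'
    have h2 := (hr' x (ball_subset_ball (by linarith) hx)).1
    have h3 : 0 < (bump V k).normed volume (y - x) * ⟪v x, v y⟫ := mul_pos h1 (by linarith)
    exact h3.ne'
  · refine Eventually.of_forall fun x => ?_
    by_cases h0 : (bump V k).normed volume (y - x) = 0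
    · simp [h0]
    · have hx' := norm_lt_of_normed_ne_zero _ h0
      have h2 := (hr' x (by rw [mem_ball, dist_comm, dist_eq_norm]; linarith)).1
      exact mul_nonneg ((bump V k).nonneg_normed _) (by linarith)
  · refine integrable_normed_mul _ ?_ y
    exact Integrable.of_bound (h.measurable.inner measurable_const).aestronglyMeasurable 1
      (Eventually.of_forall fun z => (norm_inner_le_norm _ _).trans
        (mul_le_one₀ (h.norm_le z) (norm_nonneg _) (h.norm_le y)))

end ConeField

/-! ### Unit jumps, and the defect of a field -/

section Translation

variable {V : Type*} [NormedAddCommGroup V] [InnerProductSpace ℝ V] [FiniteDimensional ℝ V]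
  [MeasurableSpace V] [BorelSpace V]

variable {v : V → V} {W : Set V} {κ : Measure V} {C : Set V} {u : V → ℝ}

/-- Near `y`, the function `u` takes exactly the two values `c < c'` off `C`, and it takes both of
them in every neighborhood of `y`. -/
structure HasJump (C : Set V) (u : V → ℝ) (y : V) (c c' : ℝ) : Prop where
  lt : c < c'
  eventually : ∀ᶠ x in 𝓝 y, x ∉ C → u x = c ∨ u x = c'
  left : ∀ O ∈ 𝓝 y, ∃ x ∈ O, x ∉ C ∧ u x = c
  right : ∀ O ∈ 𝓝 y, ∃ x ∈ O, x ∉ C ∧ u x = c'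

/-- On each of the two sides of the cone, `u` is constant; the two constants differ, as regular
points are dense and `u` is not constant near them. -/
theorem IsJumpFunction.exists_hasJump [IsFiniteMeasure κ] (h : IsCalibratingField v W κ C)
    (hu : IsJumpFunction v κ C u) (hC : IsTwoSidedCone C) {y : V} (hy : y ∈ C) (hy0 : y ≠ 0)
    (hy1 : ‖y‖ < 1) : ∃ c c', HasJump C u y c c' := by
  have hyb : y ∈ ball (0 : V) 1 := by simpa using hy1
  obtain ⟨N, hN, hNb, N₁, N₂, h1, h2, h12⟩ := hC.sides y hy hy0 _ (isOpen_ball.mem_nhds hyb)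
  have hconst : ∀ A, A ⊆ N \ C → IsPreconnected A → ∃ c, ∀ x ∈ A, u x = c := by
    intro A hA hpre
    rcases A.eq_empty_or_nonempty with rfl | ⟨a, ha⟩
    · exact ⟨0, by simp⟩
    · exact ⟨u a, fun x hx => hu.locConst.eq_of_isPreconnected hpre
        (hA.trans (sdiff_subset_sdiff_left hNb)) hx ha⟩
  obtain ⟨c₁, hc₁⟩ := hconst N₁ (h12 ▸ subset_union_left) h1
  obtain ⟨c₂, hc₂⟩ := hconst N₂ (h12 ▸ subset_union_right) h2
  have hev : ∀ᶠ x in 𝓝 y, x ∉ C → u x = c₁ ∨ u x = c₂ := by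
    filter_upwards [hN] with x hx hxC
    have : x ∈ N₁ ∪ N₂ := h12 ▸ ⟨hx, hxC⟩
    exact this.imp (hc₁ x) (hc₂ x)
  have hne : ∀ O ∈ 𝓝 y, ∀ c : ℝ, ∃ x ∈ O, x ∉ C ∧ u x ≠ c ∧ (u x = c₁ ∨ u x = c₂) := by
    intro O hO c
    obtain ⟨O', hO', hOo, hyO⟩ := _root_.mem_nhds_iff.1 (inter_mem hO hev)
    obtain ⟨z, hz, hzC, hzW⟩ := h.exists_mem hy hy1 (hOo.mem_nhds hyO)
    obtain ⟨x, hx, hxC, hxc⟩ := hu.not_const h hC hzC hzW (hOo.mem_nhds hz) c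
    exact ⟨x, (hO' hx).1, hxC, hxc, (hO' hx).2 hxC⟩
  have hA1 : ∀ O ∈ 𝓝 y, ∃ x ∈ O, x ∉ C ∧ u x = c₁ := by
    intro O hO
    obtain ⟨x, hx, hxC, hxc, h⟩ := hne O hO c₂
    exact ⟨x, hx, hxC, h.resolve_right hxc⟩
  have hA2 : ∀ O ∈ 𝓝 y, ∃ x ∈ O, x ∉ C ∧ u x = c₂ := by
    intro O hO
    obtain ⟨x, hx, hxC, hxc, h⟩ := hne O hO c₁
    exact ⟨x, hx, hxC, h.resolve_left hxc⟩
  rcases lt_trichotomy c₁ c₂ with hlt | heq | hlt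
  · exact ⟨c₁, c₂, hlt, hev, hA1, hA2⟩
  · obtain ⟨x, -, -, hxc, h⟩ := hne univ univ_mem c₁
    rw [← heq, or_self] at h
    exact absurd h hxc
  · exact ⟨c₂, c₁, hlt, hev.mono fun x hx hxC => (hx hxC).symm, hA2, hA1⟩

/-- All jumps of `u` across the cone, away from its vertex, have height one. -/
def UnitJumps (C : Set V) (u : V → ℝ) : Prop :=
  ∀ y ∈ C, y ≠ 0 → ‖y‖ < 1 → ∃ c, HasJump C u y c (c + 1)

/-- As `C` is a cone, the oscillation of `u` at distances comparable to the distance from the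
vertex is at most one. -/
theorem UnitJumps.exists_oscillation_le (hJ : UnitJumps C u) (hu : LocConst C u)
    (hC : IsTwoSidedCone C) : ∃ ρ > 0, ρ < 1 ∧ ∀ x ∈ ball (0 : V) 1 \ C, ∀ y ∈ ball (0 : V) 1 \ C,
      ‖y - x‖ < ρ * ‖x‖ → u y - u x ≤ 1 := by
  have hloc : ∀ x ∈ sphere (0 : V) (1 / 2), ∃ O : Set V, IsOpen O ∧ x ∈ O ∧
      ∀ a ∈ O \ C, ∀ b ∈ O \ C, u b - u a ≤ 1 := by
    intro x hx
    rw [mem_sphere_zero_iff_norm] at hx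
    have hx1 : ‖x‖ < 1 := by rw [hx]; norm_num
    have hxb : x ∈ ball (0 : V) 1 := by simpa using hx1
    by_cases hxC : x ∈ C
    · obtain ⟨c, hc⟩ := hJ x hxC (by rintro rfl; norm_num at hx) hx1
      obtain ⟨O, hO, hOo, hxO⟩ := _root_.mem_nhds_iff.1 hc.eventually
      refine ⟨O, hOo, hxO, fun a ha b hb => ?_⟩
      rcases hO ha.1 ha.2 with h1 | h1 <;> rcases hO hb.1 hb.2 with h2 | h2 <;>
        rw [h1, h2] <;> linarith
    · obtain ⟨O, hO, hOo, hxO⟩ := _root_.mem_nhds_iff.1 (hu x ⟨hxb, hxC⟩)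
      refine ⟨O, hOo, hxO, fun a ha b hb => ?_⟩
      rw [show u a = u x from hO ha.1, show u b = u x from hO hb.1]; simp
  choose! O hOo hxO hosc using hloc
  obtain ⟨δ, hδ, hleb⟩ := lebesgue_number_lemma_of_metric (isCompact_sphere (0 : V) (1 / 2))
    (c := fun x : sphere (0 : V) (1 / 2) => O x) (fun x => hOo x x.2)
    fun x hx => mem_iUnion.2 ⟨⟨x, hx⟩, hxO x hx⟩
  refine ⟨min δ (1 / 2), lt_min hδ (by norm_num), (min_le_right _ _).trans_lt (by norm_num),
    fun x hx y hy hxy => ?_⟩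
  have hx0 : x ≠ 0 := by
    rintro rfl
    rw [norm_zero, mul_zero] at hxy
    exact (norm_nonneg _).not_gt hxy
  have hpos : 0 < ‖x‖ := norm_pos_iff.2 hx0
  have htpos : 0 < 1 / (2 * ‖x‖) := by positivity
  have hn := norm_half_smul hx0
  have hd : ‖(1 / (2 * ‖x‖)) • y - (1 / (2 * ‖x‖)) • x‖ < min δ (1 / 2) / 2 := by
    rw [← smul_sub, norm_smul, Real.norm_of_nonneg htpos.le]
    calc _ < 1 / (2 * ‖x‖) * (min δ (1 / 2) * ‖x‖) := by gcongr
      _ = _ := by field_simp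
  have hm1 := min_le_left δ (1 / 2)
  have hm2 := min_le_right δ (1 / 2)
  have hny : ‖(1 / (2 * ‖x‖)) • y‖ < 1 := by
    have := norm_le_insert' ((1 / (2 * ‖x‖)) • y) ((1 / (2 * ‖x‖)) • x)
    linarith
  obtain ⟨i, hi⟩ := hleb _ (mem_sphere_zero_iff_norm.2 hn)
  rw [← hu.smul hC hx htpos (by rw [hn]; norm_num), ← hu.smul hC hy htpos hny]
  refine hosc i i.2 _ ⟨hi (mem_ball_self hδ), hC.smul_notMem hx.2 htpos⟩ _
    ⟨hi ?_, hC.smul_notMem hy.2 htpos⟩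
  rw [mem_ball, dist_eq_norm]
  linarith

/-- The values on two constancy balls differ by little if the `L¹` norm of the gradient on a ball
containing them is small: integrate along the parallel segments that join the two balls. -/
theorem enorm_sub_mul_volume_le {f : V → ℝ} (hf : ContDiff ℝ 1 f) {p x y : V} {τ σ a b : ℝ}
    (hx : ball x σ ⊆ ball p τ) (hy : ball y σ ⊆ ball p τ) (hfx : ∀ z ∈ ball x σ, f z = a)
    (hfy : ∀ z ∈ ball y σ, f z = b) :
    ‖a - b‖ₑ * volume (ball (0 : V) σ) ≤ ‖x - y‖ₑ * ∫⁻ z in ball p τ, ‖fderiv ℝ f z‖ₑ := by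
  have hcf : Continuous (fderiv ℝ f) := hf.continuous_fderiv one_ne_zero
  have h1 : ∀ s ∈ ball (0 : V) σ, ‖a - b‖ₑ ≤ ∫⁻ t in Icc (0 : ℝ) 1,
      ‖x - y‖ₑ * (ball p τ).indicator (fun z => ‖fderiv ℝ f z‖ₑ) (s + (y + t • (x - y))) := by
    intro s hs
    rw [mem_ball_zero_iff] at hs
    have hsx : x + s ∈ ball x σ := by simpa using hs
    have hsy : y + s ∈ ball y σ := by simpa using hs
    have hd : ∀ t : ℝ, HasDerivAt (fun t : ℝ => f (s + (y + t • (x - y))))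
        (fderiv ℝ f (s + (y + t • (x - y))) (x - y)) t := by
      intro t
      have h4 : HasDerivAt (fun t : ℝ => s + (y + t • (x - y))) (x - y) t := by
        simpa using (((hasDerivAt_id t).smul_const (x - y)).const_add y).const_add s
      exact ((hf.differentiable one_ne_zero) _).hasFDerivAt.comp_hasDerivAt t h4
    have hc : Continuous fun t : ℝ => fderiv ℝ f (s + (y + t • (x - y))) (x - y) :=
      (hcf.comp (by fun_prop)).clm_apply continuous_const
    have hftc := intervalIntegral.integral_eq_sub_of_hasDerivAt (a := 0) (b := 1)
      (fun t _ => hd t) (hc.intervalIntegrable _ _)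
    have e1 : s + (y + (1 : ℝ) • (x - y)) = x + s := by rw [one_smul]; abel
    have e0 : s + (y + (0 : ℝ) • (x - y)) = y + s := by rw [zero_smul]; abel
    rw [e1, e0, hfx _ hsx, hfy _ hsy] at hftc
    rw [← hftc, intervalIntegral.integral_of_le zero_le_one]
    refine (enorm_integral_le_lintegral_enorm _).trans ?_
    refine (setLIntegral_mono' measurableSet_Ioc fun t ht => ?_).trans
      (lintegral_mono_set Ioc_subset_Icc_self)
    have hmem : s + (y + t • (x - y)) ∈ ball p τ := by
      have := (convex_ball p τ).add_smul_sub_mem (hy hsy) (hx hsx) ⟨ht.1.le, ht.2⟩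
      convert this using 1
      rw [add_sub_add_right_eq_sub]; abel
    rw [indicator_of_mem hmem, mul_comm]
    exact ContinuousLinearMap.le_opENorm _ _
  have hmeas : Measurable ((ball p τ).indicator fun z => ‖fderiv ℝ f z‖ₑ) :=
    hcf.enorm.measurable.indicator measurableSet_ball
  calc ‖a - b‖ₑ * volume (ball (0 : V) σ) = ∫⁻ s in ball (0 : V) σ, ‖a - b‖ₑ := by simp
    _ ≤ ∫⁻ s in ball (0 : V) σ, ∫⁻ t in Icc (0 : ℝ) 1,
      ‖x - y‖ₑ * (ball p τ).indicator (fun z => ‖fderiv ℝ f z‖ₑ) (s + (y + t • (x - y))) :=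
        setLIntegral_mono' measurableSet_ball h1
    _ ≤ ∫⁻ s, ∫⁻ t in Icc (0 : ℝ) 1,
      ‖x - y‖ₑ * (ball p τ).indicator (fun z => ‖fderiv ℝ f z‖ₑ) (s + (y + t • (x - y))) :=
        setLIntegral_le_lintegral _ _
    _ = ∫⁻ t in Icc (0 : ℝ) 1, ∫⁻ s,
      ‖x - y‖ₑ * (ball p τ).indicator (fun z => ‖fderiv ℝ f z‖ₑ) (s + (y + t • (x - y))) := by
        refine lintegral_lintegral_swap (Measurable.aemeasurable ?_)
        refine measurable_const.mul (hmeas.comp ?_)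
        fun_prop
    _ = ‖x - y‖ₑ * ∫⁻ z in ball p τ, ‖fderiv ℝ f z‖ₑ := by
        have : ∀ t : ℝ, ∫⁻ s, ‖x - y‖ₑ * (ball p τ).indicator (fun z => ‖fderiv ℝ f z‖ₑ)
            (s + (y + t • (x - y))) = ‖x - y‖ₑ * ∫⁻ z in ball p τ, ‖fderiv ℝ f z‖ₑ := by
          intro t
          rw [lintegral_const_mul' _ _ enorm_ne_top, lintegral_add_right_eq_self,
            lintegral_indicator measurableSet_ball]
        simp [this]

/-- The defect `∫ ρ (a - y) (1 - ⟪v y, v b⟫) dκ(y)`. It measures by how much the field at `b` fails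
to calibrate the part of `v κ` near `a`. -/
def defect (φ : ContDiffBump (0 : V)) (κ : Measure V) (v : V → V) (a b : V) : ℝ :=
  ∫ y, φ.normed volume (a - y) * (1 - ⟪v y, v b⟫) ∂κ

section Defect

variable [IsFiniteMeasure κ] (h : IsCalibratingField v W κ C)
include h

theorem IsCalibratingField.integrable_inner (b : V) : Integrable (fun y => ⟪v y, b⟫) κ :=
  Integrable.of_bound (h.measurable.inner measurable_const).aestronglyMeasurable (1 * ‖b‖)
    (Eventually.of_forall fun z => (norm_inner_le_norm _ _).trans
      (mul_le_mul_of_nonneg_right (h.norm_le z) (norm_nonneg _)))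

theorem IsCalibratingField.inner_le_one (a b : V) : ⟪v a, v b⟫ ≤ 1 :=
  (real_inner_le_norm _ _).trans (mul_le_one₀ (h.norm_le a) (norm_nonneg _) (h.norm_le b))

theorem IsCalibratingField.defect_eq (φ : ContDiffBump (0 : V)) (a b : V) :
    defect φ κ v a b = mollifyMass φ κ a - ⟪mollify φ κ v a, v b⟫ := by
  unfold defect mollifyMass
  rw [inner_mollify φ h.integrable]
  simp_rw [mul_sub, mul_one]
  rw [integral_sub]
  · simpa using integrable_normed_mul φ (integrable_const (1 : ℝ) (μ := κ)) a
  · exact integrable_normed_mul φ (h.integrable_inner _) a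

theorem IsCalibratingField.defect_nonneg (φ : ContDiffBump (0 : V)) (a b : V) :
    0 ≤ defect φ κ v a b :=
  integral_nonneg fun y => mul_nonneg (φ.nonneg_normed _) (sub_nonneg.2 (h.inner_le_one y b))

/-- Where the field at `b` is transversal to the field near `a`, the defect controls the mass. -/
theorem IsCalibratingField.mass_le_defect (φ : ContDiffBump (0 : V)) {a b : V} {c : ℝ}
    (hc : ∀ y ∈ ball a φ.rOut, ⟪v y, v b⟫ ≤ 1 - c) :
    c * mollifyMass φ κ a ≤ defect φ κ v a b := by
  unfold defect mollifyMass
  rw [← integral_const_mul]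
  refine integral_mono ?_ ?_ fun y => ?_
  · simpa using (integrable_normed_mul φ (integrable_const (1 : ℝ) (μ := κ)) a).const_mul c
  · exact integrable_normed_mul φ ((integrable_const _).sub (h.integrable_inner _)) a
  · change c * φ.normed volume (a - y) ≤ φ.normed volume (a - y) * (1 - ⟪v y, v b⟫)
    by_cases h0 : φ.normed volume (a - y) = 0
    · simp [h0]
    · rw [mul_comm]
      refine mul_le_mul_of_nonneg_left ?_ (φ.nonneg_normed _)
      have := hc y (by rw [mem_ball, dist_comm, dist_eq_norm]; exact norm_lt_of_normed_ne_zero _ h0)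
      linarith

theorem IsCalibratingField.integrable_prod_defect (φ : ContDiffBump (0 : V)) :
    Integrable (fun z : V × V => φ.normed volume (z.1 - z.2) * (1 - ⟪v z.2, v z.1⟫))
      (volume.prod κ) := by
  have h1 := Integrable.convolution_integrand (ContinuousLinearMap.mul ℝ ℝ)
    (integrable_const (1 : ℝ) (μ := κ)) (φ.integrable_normed (μ := volume))
  simp only [ContinuousLinearMap.mul_apply', one_mul] at h1
  refine h1.mul_bdd (c := 2) ?_ (Eventually.of_forall fun z => ?_)
  · exact (measurable_const.sub ((h.measurable.comp measurable_snd).inner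
      (h.measurable.comp measurable_fst))).aestronglyMeasurable
  · have := abs_real_inner_le_norm (v z.2) (v z.1)
    have h2 := mul_le_one₀ (h.norm_le z.2) (norm_nonneg (v z.1)) (h.norm_le z.1)
    rw [Real.norm_eq_abs, abs_le]
    have := abs_le.1 (this.trans h2)
    constructor <;> linarith

theorem IsCalibratingField.integrable_defect (φ : ContDiffBump (0 : V)) :
    Integrable fun x => defect φ κ v x x :=
  (h.integrable_prod_defect φ).integral_prod_left

/-- The total defect at scale `φ.rOut` tends to zero, as `v` is continuous with norm one at almost
all points of the cone. -/
theorem IsCalibratingField.tendsto_integral_defect :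
    Tendsto (fun k => ∫ x, defect (bump V k) κ v x x) atTop (𝓝 0) := by
  have hswap : ∀ k, ∫ x, defect (bump V k) κ v x x =
      ∫ y, (∫ x, (bump V k).normed volume (x - y) * (1 - ⟪v y, v x⟫)) ∂κ := fun k =>
    integral_integral_swap (f := fun x y => (bump V k).normed volume (x - y) * (1 - ⟪v y, v x⟫))
      (h.integrable_prod_defect (bump V k))
  simp_rw [hswap]
  have hz : (0 : ℝ) = ∫ _ : V, (0 : ℝ) ∂κ := by simp
  rw [hz]
  have hbd : ∀ (k : ℕ) (y : V), ∀ x, |(bump V k).normed volume (x - y) * (1 - ⟪v y, v x⟫)| ≤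
      (bump V k).normed volume (x - y) * 2 := by
    intro k y x
    rw [abs_mul, abs_of_nonneg ((bump V k).nonneg_normed _)]
    refine mul_le_mul_of_nonneg_left ?_ ((bump V k).nonneg_normed _)
    have := abs_real_inner_le_norm (v y) (v x)
    have h2 := mul_le_one₀ (h.norm_le y) (norm_nonneg (v x)) (h.norm_le x)
    rw [abs_le]
    have := abs_le.1 (this.trans h2)
    constructor <;> linarith
  have hone : ∀ (k : ℕ) (y : V), ∫ x, (bump V k).normed volume (x - y) = 1 := by
    intro k y
    rw [integral_sub_right_eq_self (fun x => (bump V k).normed volume x) y,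
      (bump V k).integral_normed]
  have hint : ∀ (k : ℕ) (y : V), Integrable fun x => (bump V k).normed (volume : Measure V)
      (x - y) := fun k y => (bump V k).integrable_normed.comp_sub_right y
  refine tendsto_integral_of_dominated_convergence (fun _ => (2 : ℝ))
    (fun k => (h.integrable_prod_defect (bump V k)).integral_prod_right.aestronglyMeasurable)
    (integrable_const _) (fun k => Eventually.of_forall fun y => ?_) ?_
  · refine (norm_integral_le_of_norm_le ((hint k y).mul_const 2)
      (Eventually.of_forall (hbd k y))).trans ?_
    rw [integral_mul_const, hone, one_mul]
  · have hW : ∀ᵐ y ∂κ, y ∈ W := by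
      filter_upwards [measure_eq_zero_iff_ae_notMem.1 h.carrier] with y hy
      simpa using hy
    filter_upwards [h.unit, hW] with y hy hyW
    rw [Metric.tendsto_atTop']
    intro ε hε
    have hcont : ContinuousAt (fun x => ⟪v y, v x⟫) y :=
      continuousAt_const.inner ((h.contOn y hyW).continuousAt (h.isOpen.mem_nhds hyW))
    have hyy : ⟪v y, v y⟫ = 1 := by rw [real_inner_self_eq_norm_sq, hy, one_pow]
    obtain ⟨r, hr, hr'⟩ := Metric.eventually_nhds_iff_ball.1
      (hcont.eventually (lt_mem_nhds (show 1 - ε / 2 < ⟪v y, v y⟫ by rw [hyy]; linarith)))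
    obtain ⟨n, hn⟩ := eventually_atTop.1 ((tendsto_bump_rOut V).eventually (gt_mem_nhds hr))
    refine ⟨n, fun k hk => ?_⟩
    have hk' := hn k hk.le
    rw [dist_zero_right]
    have hle : ‖∫ x, (bump V k).normed volume (x - y) * (1 - ⟪v y, v x⟫)‖ ≤
        ∫ x, (bump V k).normed volume (x - y) * (ε / 2) := by
      refine norm_integral_le_of_norm_le ((hint k y).mul_const _)
        (Eventually.of_forall fun x => ?_)
      rw [norm_mul, Real.norm_of_nonneg ((bump V k).nonneg_normed _),
        Real.norm_of_nonneg (sub_nonneg.2 (h.inner_le_one y x))]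
      by_cases h0 : (bump V k).normed volume (x - y) = 0
      · simp [h0]
      · refine mul_le_mul_of_nonneg_left ?_ ((bump V k).nonneg_normed _)
        have hs := norm_lt_of_normed_ne_zero _ h0
        have := hr' x (by rw [mem_ball, dist_eq_norm]; linarith)
        linarith
    rw [integral_mul_const, hone, one_mul] at hle
    linarith

end Defect

/-- The `C¹` truncation `s ↦ max (s - 1) 0 ^ 2`. -/
theorem hasDerivAt_truncation (s : ℝ) :
    HasDerivAt (fun s : ℝ => (max (s - 1) 0) ^ 2) (2 * max (s - 1) 0) s := by
  rcases lt_trichotomy s 1 with hs | rfl | hs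
  · rw [max_eq_right (by linarith), mul_zero]
    refine (hasDerivAt_const s (0 : ℝ)).congr_of_eventuallyEq ?_
    filter_upwards [gt_mem_nhds hs] with t ht
    rw [max_eq_right (by linarith)]; norm_num
  · simp only [sub_self, max_self, mul_zero]
    have : HasFDerivAt (fun s : ℝ => (max (s - 1) 0) ^ 2) (0 : ℝ →L[ℝ] ℝ) 1 := by
      refine Asymptotics.IsBigO.hasFDerivAt (n := 2) (Asymptotics.IsBigO.of_bound 1 ?_)
        (by norm_num)
      refine Eventually.of_forall fun t => ?_
      rw [one_mul, norm_pow, norm_pow, norm_norm]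
      gcongr
      rw [Real.norm_of_nonneg (le_max_right _ _), Real.norm_eq_abs]
      exact max_le (le_abs_self _) (abs_nonneg _)
    simpa using this.hasDerivAt
  · rw [max_eq_left (by linarith)]
    have : HasDerivAt (fun s : ℝ => (s - 1) ^ 2) (2 * (s - 1)) s := by
      simpa using ((hasDerivAt_id s).sub_const 1).fun_pow 2
    refine this.congr_of_eventuallyEq ?_
    filter_upwards [lt_mem_nhds hs] with t ht
    rw [max_eq_left (by linarith)]

theorem contDiff_truncation : ContDiff ℝ 1 (fun s : ℝ => (max (s - 1) 0) ^ 2) := by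
  rw [contDiff_one_iff_deriv]
  refine ⟨fun s => (hasDerivAt_truncation s).differentiableAt, ?_⟩
  have : deriv (fun s : ℝ => (max (s - 1) 0) ^ 2) = fun s => 2 * max (s - 1) 0 :=
    funext fun s => (hasDerivAt_truncation s).deriv
  rw [this]
  fun_prop

theorem IsJumpFunction.contDiff_average (hu : IsJumpFunction v κ C u) (φ : ContDiffBump (0 : V)) :
    ContDiff ℝ ∞ (average φ u) := by
  obtain ⟨L, hL⟩ := hu.bounded
  have hloc : LocallyIntegrable u := by
    intro x
    refine ⟨ball x 1, ball_mem_nhds x one_pos, ?_⟩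
    exact Measure.integrableOn_of_bounded measure_ball_lt_top.ne hu.measurable.aestronglyMeasurable
      (Eventually.of_forall hL)
  exact φ.hasCompactSupport_normed.contDiff_convolution_left (ContinuousLinearMap.lsmul ℝ ℝ)
    φ.contDiff_normed hloc

theorem IsJumpFunction.integrable_average (hu : IsJumpFunction v κ C u) (φ : ContDiffBump (0 : V))
    (x : V) : Integrable fun s => φ.normed volume s * u (x - s) := by
  obtain ⟨L, hL⟩ := hu.bounded
  exact φ.integrable_normed.mul_bdd (c := L)
    (hu.measurable.comp (measurable_const.sub measurable_id)).aestronglyMeasurable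
    (Eventually.of_forall fun s => hL _)

theorem IsJumpFunction.abs_average_le (φ : ContDiffBump (0 : V))
    {L : ℝ} (hL : ∀ x, |u x| ≤ L) (x : V) : |average φ u x| ≤ L := by
  have := norm_integral_le_of_norm_le (f := fun s => φ.normed volume s * u (x - s))
    (φ.integrable_normed.mul_const L)
    (Eventually.of_forall fun s => by
      rw [norm_mul, Real.norm_of_nonneg (φ.nonneg_normed _)]
      exact mul_le_mul_of_nonneg_left (hL _) (φ.nonneg_normed _))
  rw [integral_mul_const, φ.integral_normed, one_mul] at this
  exact this

end Translation

/-! ### Comparison of a jump function with its translates -/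

section Swap

variable {V : Type*} [NormedAddCommGroup V] [InnerProductSpace ℝ V] [FiniteDimensional ℝ V]
  [MeasurableSpace V] [BorelSpace V]

variable {v : V → V} {W : Set V} {κ : Measure V} {C : Set V} {u : V → ℝ}

/-- The part by which the averages of `u` increase by more than one under the translation by `-z`,
squared to make it `C¹`. -/
def excess (φ : ContDiffBump (0 : V)) (u : V → ℝ) (z x : V) : ℝ :=
  if ‖x‖ < 1 / 2 then (max (average φ u (x - z) - average φ u x - 1) 0) ^ 2 else 0

/-- The derivative of the truncation that enters the derivative of `excess`. -/
def excessSlope (φ : ContDiffBump (0 : V)) (u : V → ℝ) (z x : V) : ℝ :=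
  if ‖x‖ < 1 / 2 then 2 * max (average φ u (x - z) - average φ u x - 1) 0 else 0

section Excess

variable {ρ : ℝ} {z : V} {φ : ContDiffBump (0 : V)}

/-- Averages inherit the oscillation bound of `u` at points whose distance from the vertex is
comparable to one. This makes `excess` compactly supported. -/
theorem IsJumpFunction.average_sub_le (hu : IsJumpFunction v κ C u) (hC : IsTwoSidedCone C)
    (hρ1 : ρ < 1) (hosc : ∀ x ∈ ball (0 : V) 1 \ C, ∀ y ∈ ball (0 : V) 1 \ C,
      ‖y - x‖ < ρ * ‖x‖ → u y - u x ≤ 1) (hρ : 0 < ρ) (hz : ‖z‖ < ρ / 8) (hφ : φ.rOut < 1 / 8)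
    {x : V} (hx : 1 / 4 < ‖x‖) (hx2 : ‖x‖ < 1 / 2) :
    average φ u (x - z) - average φ u x ≤ 1 := by
  have hnull : ∀ p : V, ∀ᵐ s, p - s ∉ C := fun p =>
    (Measure.measurePreserving_sub_left volume p).quasiMeasurePreserving.ae
      (measure_eq_zero_iff_ae_notMem.1 hC.null)
  unfold average
  rw [← integral_sub (hu.integrable_average φ _) (hu.integrable_average φ _),
    ← φ.integral_normed (μ := volume)]
  refine integral_mono_ae ((hu.integrable_average φ _).sub (hu.integrable_average φ _))
    φ.integrable_normed ?_
  filter_upwards [hnull x, hnull (x - z)] with s hs hs'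
  rw [← mul_sub]
  by_cases h0 : φ.normed volume s = 0
  · simp [h0]
  · refine mul_le_of_le_one_right (φ.nonneg_normed _) (hosc _ ⟨?_, hs⟩ _ ⟨?_, hs'⟩ ?_)
    · have h1 := norm_lt_of_normed_ne_zero _ h0
      have h2 := norm_sub_le x s
      rw [mem_ball_zero_iff]; linarith
    · have h1 := norm_lt_of_normed_ne_zero _ h0
      have h2 := norm_sub_le x z
      have h3 := norm_sub_le (x - z) s
      rw [mem_ball_zero_iff]; linarith
    · have h1 := norm_lt_of_normed_ne_zero _ h0
      have h2 : ‖x‖ - ‖s‖ ≤ ‖x - s‖ := norm_sub_norm_le x s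
      have h3 : x - z - s - (x - s) = -z := by abel
      rw [h3, norm_neg]
      nlinarith

theorem eventually_norm_gt {x : V} (hx : 1 / 2 ≤ ‖x‖) : ∀ᶠ y in 𝓝 x, 1 / 4 < ‖y‖ :=
  continuous_norm.continuousAt.eventually (lt_mem_nhds (by linarith))

theorem eventually_norm_lt {x : V} (hx : ‖x‖ < 1 / 2) : ∀ᶠ y in 𝓝 x, ‖y‖ < 1 / 2 :=
  continuous_norm.continuousAt.eventually (gt_mem_nhds hx)

variable (hu : IsJumpFunction v κ C u)
  (hle : ∀ x : V, 1 / 4 < ‖x‖ → ‖x‖ < 1 / 2 → average φ u (x - z) - average φ u x ≤ 1)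
include hle

theorem excess_eq_zero {x : V} (hx : 1 / 4 < ‖x‖) : excess φ u z x = 0 := by
  unfold excess
  split_ifs with h
  · rw [max_eq_right (by linarith [hle x hx h])]; norm_num
  · rfl

theorem excessSlope_eq_zero {x : V} (hx : 1 / 4 < ‖x‖) : excessSlope φ u z x = 0 := by
  unfold excessSlope
  split_ifs with h
  · rw [max_eq_right (by linarith [hle x hx h])]; norm_num
  · rfl

theorem tsupport_excess_subset : tsupport (excess φ u z) ⊆ closedBall 0 (1 / 4) := by
  refine closure_minimal (fun x hx => ?_) isClosed_closedBall
  by_contra hx'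
  rw [mem_closedBall_zero_iff, not_le] at hx'
  exact hx (excess_eq_zero hle hx')

include hu

theorem IsJumpFunction.contDiff_excess : ContDiff ℝ 1 (excess φ u z) := by
  have hA : ContDiff ℝ 1 (average φ u) := (hu.contDiff_average φ).of_le (by simp)
  rw [contDiff_iff_contDiffAt]
  intro x
  rcases lt_or_ge ‖x‖ (1 / 2) with h | h
  · have : ContDiff ℝ 1 fun x =>
        (fun s : ℝ => (max (s - 1) 0) ^ 2) (average φ u (x - z) - average φ u x) :=
      contDiff_truncation.comp ((hA.comp (contDiff_id.sub contDiff_const)).sub hA)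
    refine this.contDiffAt.congr_of_eventuallyEq ?_
    filter_upwards [eventually_norm_lt h] with y hy
    rw [excess, if_pos hy]
  · refine (contDiffAt_const (c := (0 : ℝ))).congr_of_eventuallyEq ?_
    filter_upwards [eventually_norm_gt h] with y hy using excess_eq_zero hle hy

theorem IsJumpFunction.continuous_excessSlope : Continuous (excessSlope φ u z) := by
  have hA : Continuous (average φ u) := (hu.contDiff_average φ).continuous
  rw [continuous_iff_continuousAt]
  intro x
  rcases lt_or_ge ‖x‖ (1 / 2) with h | h
  · have : Continuous fun x => 2 * max (average φ u (x - z) - average φ u x - 1) 0 := by fun_prop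
    refine this.continuousAt.congr ?_
    filter_upwards [eventually_norm_lt h] with y hy
    rw [excessSlope, if_pos hy]
  · refine (continuousAt_const (y := (0 : ℝ))).congr ?_
    filter_upwards [eventually_norm_gt h] with y hy using (excessSlope_eq_zero hle hy).symm

theorem IsJumpFunction.fderiv_excess (hpot : IsPotential φ κ v (average φ u)) (hz : ‖z‖ < 1 / 8)
    (hφ : φ.rOut < 1 / 8) (x : V) : fderiv ℝ (excess φ u z) x =
      excessSlope φ u z x • innerSL ℝ (mollify φ κ v (x - z) - mollify φ κ v x) := by
  refine HasFDerivAt.fderiv ?_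
  rcases lt_or_ge ‖x‖ (1 / 2) with h | h
  · have h1 := hpot x (by linarith)
    have h2 := hpot (x - z) (by linarith [norm_sub_le x z])
    have h3 : HasFDerivAt (fun x => average φ u (x - z))
        (innerSL ℝ (mollify φ κ v (x - z))) x := by
      exact h2.comp x ((hasFDerivAt_id x).sub_const z)
    have h4 := (hasDerivAt_truncation (average φ u (x - z) - average φ u x)).comp_hasFDerivAt x
      (h3.sub h1)
    rw [excessSlope, if_pos h, map_sub]
    refine h4.congr_of_eventuallyEq ?_
    filter_upwards [eventually_norm_lt h] with y hy
    rw [excess, if_pos hy]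
    rfl
  · rw [excessSlope_eq_zero hle (by linarith), zero_smul]
    refine (hasFDerivAt_const (0 : ℝ) x).congr_of_eventuallyEq ?_
    filter_upwards [eventually_norm_gt h] with y hy using excess_eq_zero hle hy

omit hle hu in
theorem excessSlope_nonneg (x : V) : 0 ≤ excessSlope φ u z x := by
  unfold excessSlope
  split_ifs
  · exact mul_nonneg zero_le_two (le_max_right _ _)
  · exact le_rfl

omit hle hu in
theorem excessSlope_le {L : ℝ} (hL : ∀ x, |u x| ≤ L) (x : V) : excessSlope φ u z x ≤ 4 * L := by
  have hL0 : 0 ≤ L := (abs_nonneg _).trans (hL 0)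
  unfold excessSlope
  split_ifs
  · have h1 := abs_le.1 (IsJumpFunction.abs_average_le φ hL (x - z))
    have h2 := abs_le.1 (IsJumpFunction.abs_average_le φ hL x)
    have : max (average φ u (x - z) - average φ u x - 1) 0 ≤ 2 * L :=
      max_le (by linarith) (by linarith)
    linarith
  · linarith

/-- Testing the divergence of `v` with `excess` and with its translate, and using that the gradient
of the averages is the mollification of `v κ`, bounds the defects between points at distance `z`. -/
theorem IsJumpFunction.integral_excessSlope_le [IsFiniteMeasure κ] (h : IsCalibratingField v W κ C)
    (hpot : IsPotential φ κ v (average φ u)) (hz : ‖z‖ < 1 / 8)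
    (hφ : φ.rOut < 1 / 8) {L : ℝ} (hL : ∀ x, |u x| ≤ L) :
    Integrable (fun x => excessSlope φ u z x * (defect φ κ v (x - z) x + defect φ κ v x (x - z))) ∧
    ∫ x, excessSlope φ u z x * (defect φ κ v (x - z) x + defect φ κ v x (x - z)) ≤
      8 * L * ∫ x, defect φ κ v x x := by
  have hf := hu.contDiff_excess hle
  have hts := tsupport_excess_subset hle
  have hcs : HasCompactSupport (excess φ u z) :=
    (isCompact_closedBall (0 : V) (1 / 4)).of_isClosed_subset (isClosed_tsupport _) hts
  have hcd : Continuous (fderiv ℝ (excess φ u z)) := hf.continuous_fderiv one_ne_zero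
  have hcsd : HasCompactSupport (fderiv ℝ (excess φ u z)) := hcs.fderiv ℝ
  have hint : ∀ q : V → V, Measurable q → (∀ x, ‖q x‖ ≤ 1) →
      Integrable fun x => fderiv ℝ (excess φ u z) x (q x) := by
    intro q hq hq1
    refine (hcd.integrable_of_hasCompactSupport hcsd).norm.mono' ?_
      (Eventually.of_forall fun x => ?_)
    · have hm := (contDiff_mollify φ h.integrable).continuous.measurable
      have : Measurable fun x => excessSlope φ u z x *
          ⟪mollify φ κ v (x - z) - mollify φ κ v x, q x⟫ :=
        (hu.continuous_excessSlope hle).measurable.mul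
          (((hm.comp (measurable_id.sub_const z)).sub hm).inner hq)
      refine this.aestronglyMeasurable.congr (Eventually.of_forall fun x => ?_)
      simp only [hu.fderiv_excess hle hpot hz hφ]
      rfl
    · exact ((fderiv ℝ (excess φ u z) x).le_opNorm _).trans
        (mul_le_of_le_one_right (norm_nonneg _) (hq1 x))
  have hi1 := hint v h.measurable h.norm_le
  have hi2 := hint (fun x => v (x - z)) (h.measurable.comp (measurable_id.sub_const z))
    (fun x => h.norm_le _)
  have hz1 : ∫ x, fderiv ℝ (excess φ u z) x (v x) = 0 :=
    h.divFree _ hf hcs (hts.trans (closedBall_subset_ball (by norm_num)))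
  have hz2 : ∫ x, fderiv ℝ (excess φ u z) x (v (x - z)) = 0 := by
    have hts2 : tsupport (fun x => excess φ u z (x + z)) ⊆ closedBall (-z) (1 / 4) := by
      refine closure_minimal (fun x hx => ?_) isClosed_closedBall
      have := hts (subset_tsupport _ (a := x + z) hx)
      rw [mem_closedBall_zero_iff] at this
      rwa [mem_closedBall, dist_eq_norm, sub_neg_eq_add]
    have := h.divFree (fun x => excess φ u z (x + z)) (hf.comp (contDiff_id.add contDiff_const))
      ((isCompact_closedBall (-z) (1 / 4)).of_isClosed_subset (isClosed_tsupport _) hts2)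
      (hts2.trans (closedBall_subset_ball' (by
        rw [dist_zero_right, norm_neg]; linarith)))
    rw [← this, ← integral_add_right_eq_self _ z]
    refine integral_congr_ae (Eventually.of_forall fun x => ?_)
    simp only [add_sub_cancel_right]
    rw [fderiv_comp_add_right]
  -- the masses cancel, and the remaining terms pair the gradient of `excess` with the two fields
  have key : ∀ x, excessSlope φ u z x * (defect φ κ v (x - z) x + defect φ κ v x (x - z)) =
      excessSlope φ u z x * (defect φ κ v x x + defect φ κ v (x - z) (x - z)) -
      (fderiv ℝ (excess φ u z) x (v x) - fderiv ℝ (excess φ u z) x (v (x - z))) := by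
    intro x
    rw [hu.fderiv_excess hle hpot hz hφ, h.defect_eq, h.defect_eq, h.defect_eq, h.defect_eq]
    simp only [smul_apply, innerSL_apply_apply, inner_sub_left, smul_eq_mul]
    ring
  have hR := h.integrable_defect φ
  have hRz : Integrable fun x => defect φ κ v (x - z) (x - z) := hR.comp_sub_right z
  have hG : Integrable fun x => excessSlope φ u z x *
      (defect φ κ v x x + defect φ κ v (x - z) (x - z)) := by
    refine (hR.add hRz).bdd_mul (c := 4 * L)
      (hu.continuous_excessSlope hle).aestronglyMeasurable (Eventually.of_forall fun x => ?_)
    rw [Real.norm_of_nonneg (excessSlope_nonneg x)]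
    exact excessSlope_le hL x
  simp_rw [key]
  refine ⟨hG.sub (hi1.sub hi2), ?_⟩
  have hL0 : 0 ≤ L := (abs_nonneg _).trans (hL 0)
  rw [integral_sub hG (by exact hi1.sub hi2), integral_sub hi1 hi2, hz1, hz2, sub_zero, sub_zero]
  calc _ ≤ ∫ x, 4 * L * (defect φ κ v x x + defect φ κ v (x - z) (x - z)) := by
        refine integral_mono hG ((hR.add hRz).const_mul _) fun x => ?_
        exact mul_le_mul_of_nonneg_right (excessSlope_le hL x)
          (add_nonneg (h.defect_nonneg φ _ _) (h.defect_nonneg φ _ _))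
    _ = _ := by
        rw [integral_const_mul, integral_add hR hRz,
          integral_sub_right_eq_self (fun x => defect φ κ v x x) z]
        ring

end Excess

/-- Near the vertex, the field takes the same value at a point `x₀` off the cone and at a point
`y₀` of the cone across which `u` jumps from a value `c` greater than `u x₀`. Otherwise compare `u`
with its translate by `x₀ - y₀`: near `x₀`, their difference takes the two values `c - u x₀` and
`c + 1 - u x₀`, of which the second is greater than one, so `excess` varies near `x₀`; but its
gradient tends to zero in `L¹` there, since it is controlled by the defects. -/
theorem IsJumpFunction.exists_eq_of_lt [IsFiniteMeasure κ] (h : IsCalibratingField v W κ C)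
    (hu : IsJumpFunction v κ C u) (hC : IsTwoSidedCone C) (hJ : UnitJumps C u) :
    ∃ r > 0, r < 1 ∧ ∀ x₀ ∈ W, x₀ ∉ C → ‖x₀‖ < r → ∀ y₀ ∈ W, ‖y₀‖ < r →
      ∀ c, HasJump C u y₀ c (c + 1) → u x₀ < c → v x₀ = v y₀ := by
  obtain ⟨ρ, hρ, hρ1, hosc⟩ := hJ.exists_oscillation_le hu.locConst hC
  obtain ⟨L, hL⟩ := hu.bounded
  refine ⟨ρ / 16, by positivity, by linarith, fun x₀ hx₀ hx₀C hx₀r y₀ hy₀ hy₀r c hc hlt => ?_⟩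
  by_contra hne
  have hinner : ⟪v x₀, v y₀⟫ < 1 := by
    refine lt_of_le_of_ne (h.inner_le_one _ _) fun heq => hne ?_
    have h1 := norm_sub_sq_real (v x₀) (v y₀)
    have h2 : ‖v x₀‖ ^ 2 ≤ 1 := pow_le_one₀ (norm_nonneg _) (h.norm_le _)
    have h3 : ‖v y₀‖ ^ 2 ≤ 1 := pow_le_one₀ (norm_nonneg _) (h.norm_le _)
    have h4 : ‖v x₀ - v y₀‖ ^ 2 ≤ 0 := by rw [h1, heq]; linarith
    have h5 : ‖v x₀ - v y₀‖ = 0 := by nlinarith [norm_nonneg (v x₀ - v y₀)]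
    exact sub_eq_zero.1 (norm_eq_zero.1 h5)
  set z := x₀ - y₀ with hzdef
  have hz : ‖z‖ < ρ / 8 := by
    have := norm_sub_le x₀ y₀
    linarith
  have hz8 : ‖z‖ < 1 / 8 := by linarith
  set e := (1 - ⟪v x₀, v y₀⟫) / 2 with he
  have he0 : 0 < e := by rw [he]; linarith
  -- the two fields remain transversal near the two points
  obtain ⟨τ, hτ, hτ'⟩ : ∃ τ > 0, ∀ a ∈ ball x₀ τ, ∀ b ∈ ball y₀ τ, ⟪v a, v b⟫ ≤ 1 - e := by
    have hcx : ContinuousAt v x₀ := (h.contOn x₀ hx₀).continuousAt (h.isOpen.mem_nhds hx₀)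
    have hcy : ContinuousAt v y₀ := (h.contOn y₀ hy₀).continuousAt (h.isOpen.mem_nhds hy₀)
    have hcont : ContinuousAt (fun q : V × V => ⟪v q.1, v q.2⟫) (x₀, y₀) :=
      (hcx.comp' continuousAt_fst).inner (hcy.comp' continuousAt_snd)
    have := hcont.eventually (gt_mem_nhds (show ⟪v (x₀, y₀).1, v (x₀, y₀).2⟫ < 1 - e by
      change ⟪v x₀, v y₀⟫ < _; rw [he]; linarith))
    obtain ⟨τ, hτ, hτ'⟩ := Metric.eventually_nhds_iff_ball.1 this
    refine ⟨τ, hτ, fun a ha b hb => (hτ' (a, b) ?_).le⟩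
    rw [← ball_prod_same]
    exact ⟨ha, hb⟩
  have hx₀n : ‖x₀‖ < 1 := by linarith
  have hy₀n : ‖y₀‖ < 1 := by linarith
  obtain ⟨η, hη, hη'⟩ := Metric.eventually_nhds_iff_ball.1
    (hu.locConst x₀ ⟨by simpa using hx₀n, hx₀C⟩)
  -- the two values of `u` at `y₀` are seen near `x₀` as two values of the translation difference
  set s := min (τ / 4) (min (η / 2) (1 / 8)) with hs
  have hs0 : 0 < s := by positivity
  have hs1 : s ≤ τ / 4 := min_le_left _ _
  have hs2 : s ≤ η / 2 := (min_le_right _ _).trans (min_le_left _ _)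
  have hs3 : s ≤ 1 / 8 := (min_le_right _ _).trans (min_le_right _ _)
  obtain ⟨y₁, hy₁, hy₁C, huy₁⟩ := hc.left _ (ball_mem_nhds y₀ hs0)
  obtain ⟨y₂, hy₂, hy₂C, huy₂⟩ := hc.right _ (ball_mem_nhds y₀ hs0)
  have hval : ∀ y ∈ ball y₀ s, y ∉ C → ∃ σ > 0, ∀ᶠ k in atTop,
      ∀ q ∈ ball (y + z) σ, excess (bump V k) u z q = (max (u y - u x₀ - 1) 0) ^ 2 := by
    intro y hy hyC
    rw [mem_ball, dist_eq_norm] at hy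
    have hyn : ‖y‖ < 1 / 4 := by
      have := norm_le_insert' y y₀
      linarith
    have hyz : y + z - x₀ = y - y₀ := by rw [hzdef]; abel
    have hxn : ‖y + z‖ < 3 / 8 := by
      have := norm_add_le y z
      linarith
    have hx0 : u (y + z) = u x₀ := hη' _ (by rw [mem_ball, dist_eq_norm, hyz]; linarith)
    have hyzC : y + z ∈ ball x₀ (η / 2) := by
      rw [mem_ball, dist_eq_norm, hyz]; linarith
    obtain ⟨r₁, hr₁, hr₁'⟩ := hu.average_eq (x := y) ⟨by simpa using by linarith, hyC⟩
    refine ⟨min (min r₁ (η / 4)) (1 / 8), by positivity, ?_⟩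
    filter_upwards [(tendsto_bump_rOut V).eventually (gt_mem_nhds hr₁),
      (tendsto_bump_rOut V).eventually (gt_mem_nhds (show (0 : ℝ) < η / 4 by positivity))]
      with k hk1 hk2 q hq
    rw [mem_ball] at hq
    have hq1 : dist q (y + z) < r₁ := hq.trans_le ((min_le_left _ _).trans (min_le_left _ _))
    have hq2 : dist q (y + z) < η / 4 := hq.trans_le ((min_le_left _ _).trans (min_le_right _ _))
    have hq3 : dist q (y + z) < 1 / 8 := hq.trans_le (min_le_right _ _)
    have hqn : ‖q‖ < 1 / 2 := by
      have := norm_le_insert' q (y + z)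
      rw [dist_eq_norm] at hq3
      linarith
    rw [excess, if_pos hqn, hr₁' _ hk1 (q - z)]
    · congr 3
      have : average (bump V k) u q = u x₀ := by
        refine integral_normed_mul_eq_of_const fun p hp => hη' p ?_
        rw [mem_closedBall] at hp
        rw [mem_ball] at hyzC ⊢
        have h1 := dist_triangle p q x₀
        have h2 := dist_triangle q (y + z) x₀
        linarith
      rw [this]
    · rw [mem_ball, dist_eq_norm]
      rwa [dist_eq_norm, ← sub_sub, sub_right_comm] at hq1
  obtain ⟨σ₁, hσ₁, hev₁⟩ := hval y₁ hy₁ hy₁C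
  obtain ⟨σ₂, hσ₂, hev₂⟩ := hval y₂ hy₂ hy₂C
  set σ := min (min σ₁ σ₂) (τ / 4) with hσ
  have hσ0 : 0 < σ := by positivity
  have hσ1 : σ ≤ σ₁ := (min_le_left _ _).trans (min_le_left _ _)
  have hσ2 : σ ≤ σ₂ := (min_le_left _ _).trans (min_le_right _ _)
  have hσ3 : σ ≤ τ / 4 := min_le_right _ _
  have hsub : ∀ y ∈ ball y₀ s, ball (y + z) σ ⊆ ball x₀ (τ / 2) := by
    intro y hy
    refine ball_subset_ball' ?_
    have hyz : y + z - x₀ = y - y₀ := by rw [hzdef]; abel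
    rw [mem_ball, dist_eq_norm] at hy
    rw [dist_eq_norm, hyz]
    linarith
  have hA : 0 < ‖(max (u y₁ - u x₀ - 1) 0) ^ 2 - (max (u y₂ - u x₀ - 1) 0) ^ 2‖ₑ *
      volume (ball (0 : V) σ) := by
    refine ENNReal.mul_pos ?_ (measure_ball_pos _ _ hσ0).ne'
    rw [enorm_ne_zero, sub_ne_zero]
    refine (pow_lt_pow_left₀ ?_ (le_max_right _ _) two_ne_zero).ne
    rw [huy₁, huy₂, max_eq_left (show (0 : ℝ) ≤ c + 1 - u x₀ - 1 by linarith)]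
    exact max_lt (by linarith) (by linarith)
  -- the bound on the `L¹` norm of the gradient of `excess`, which tends to zero
  have hB : Tendsto (fun k => ‖(y₁ + z) - (y₂ + z)‖ₑ *
      ENNReal.ofReal (e⁻¹ * (8 * L * ∫ x, defect (bump V k) κ v x x))) atTop (𝓝 0) := by
    have h1 := ENNReal.tendsto_ofReal ((h.tendsto_integral_defect.const_mul (8 * L)).const_mul e⁻¹)
    have h2 := ENNReal.Tendsto.const_mul (a := ‖(y₁ + z) - (y₂ + z)‖ₑ) h1
      (Or.inr enorm_ne_top)
    simpa using h2
  -- a scale at which this bound is too small for the two values of `excess` near `x₀`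
  obtain ⟨k, hk1, hk2, hk3, hk4, hk5, hk6⟩ := (hev₁.and (hev₂.and ((hB.eventually
    (gt_mem_nhds hA)).and (hu.eventually_isPotential.and (((tendsto_bump_rOut V).eventually
      (gt_mem_nhds (show (0 : ℝ) < 1 / 8 by norm_num))).and ((tendsto_bump_rOut V).eventually
      (gt_mem_nhds (show (0 : ℝ) < τ / 2 by positivity)))))))).exists
  have hle : ∀ x : V, 1 / 4 < ‖x‖ → ‖x‖ < 1 / 2 →
      average (bump V k) u (x - z) - average (bump V k) u x ≤ 1 := fun x hx hx2 =>
    hu.average_sub_le hC hρ1 hosc hρ hz hk5 hx hx2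
  refine (hk3.trans_le ?_).false
  refine (enorm_sub_mul_volume_le (hu.contDiff_excess hle) (hsub y₁ hy₁) (hsub y₂ hy₂)
    (fun q hq => hk1 q (ball_subset_ball hσ1 hq))
    (fun q hq => hk2 q (ball_subset_ball hσ2 hq))).trans ?_
  gcongr
  obtain ⟨hint, hle2⟩ := hu.integral_excessSlope_le hle h hk4 hz8 hk5 hL
  have hD : ∀ x, 0 ≤ excessSlope (bump V k) u z x *
      (defect (bump V k) κ v (x - z) x + defect (bump V k) κ v x (x - z)) := fun x =>
    mul_nonneg (excessSlope_nonneg x)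
      (add_nonneg (h.defect_nonneg _ _ _) (h.defect_nonneg _ _ _))
  -- where the fields are transversal, the gradient of `excess` is controlled by the defects
  calc _ ≤ ∫⁻ x in ball x₀ (τ / 2), ENNReal.ofReal (e⁻¹ * (excessSlope (bump V k) u z x *
        (defect (bump V k) κ v (x - z) x + defect (bump V k) κ v x (x - z)))) := by
        refine setLIntegral_mono' measurableSet_ball fun x hx => ?_
        rw [mem_ball, dist_eq_norm] at hx
        rw [← ofReal_norm]
        refine ENNReal.ofReal_le_ofReal ?_
        rw [hu.fderiv_excess hle hk4 hz8 hk5, norm_smul, innerSL_apply_norm,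
          Real.norm_of_nonneg (excessSlope_nonneg x), mul_left_comm]
        refine mul_le_mul_of_nonneg_left ?_ (excessSlope_nonneg x)
        rw [← div_eq_inv_mul, le_div_iff₀' he0]
        have hxz : x - z - y₀ = x - x₀ := by rw [hzdef]; abel
        have h1 : e * mollifyMass (bump V k) κ (x - z) ≤ defect (bump V k) κ v (x - z) x := by
          refine h.mass_le_defect _ fun y hy => ?_
          rw [real_inner_comm]
          refine hτ' x (by rw [mem_ball, dist_eq_norm]; linarith) y ?_
          rw [mem_ball] at hy ⊢
          have := dist_triangle y (x - z) y₀
          rw [dist_eq_norm (x - z), hxz] at this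
          linarith
        have h2 : e * mollifyMass (bump V k) κ x ≤ defect (bump V k) κ v x (x - z) := by
          refine h.mass_le_defect _ fun y hy => hτ' y ?_ _ ?_
          · rw [mem_ball] at hy ⊢
            have := dist_triangle y x x₀
            rw [dist_eq_norm x] at this
            linarith
          · rw [mem_ball, dist_eq_norm, hxz]
            linarith
        have h3 := norm_sub_le (mollify (bump V k) κ v (x - z)) (mollify (bump V k) κ v x)
        have h4 := norm_mollify_le (bump V k) (κ := κ) h.norm_le (x - z)
        have h5 := norm_mollify_le (bump V k) (κ := κ) h.norm_le x
        have h6 := mul_le_mul_of_nonneg_left (h3.trans (add_le_add h4 h5)) he0.le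
        linarith
    _ ≤ ∫⁻ x, ENNReal.ofReal (e⁻¹ * (excessSlope (bump V k) u z x *
        (defect (bump V k) κ v (x - z) x + defect (bump V k) κ v x (x - z)))) :=
        setLIntegral_le_lintegral _ _
    _ ≤ _ := by
        rw [← ofReal_integral_eq_lintegral_ofReal (hint.const_mul _)
          (Eventually.of_forall fun x => mul_nonneg (inv_nonneg.2 he0.le) (hD x)),
          integral_const_mul]
        exact ENNReal.ofReal_le_ofReal (mul_le_mul_of_nonneg_left hle2 (inv_nonneg.2 he0.le))

end Swap

/-! ### Two values, and integral curves crossing the cone -/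

section Crossing

variable {V : Type*} [NormedAddCommGroup V] [InnerProductSpace ℝ V] [FiniteDimensional ℝ V]
  [MeasurableSpace V] [BorelSpace V]

variable {v : V → V} {W : Set V} {κ : Measure V} {C : Set V} {u : V → ℝ}

theorem IsTwoSidedCone.exists_notMem (hC : IsTwoSidedCone C) {y : V} {O : Set V} (hO : O ∈ 𝓝 y) :
    ∃ x ∈ O, x ∉ C := by
  by_contra hcon
  push Not at hcon
  obtain ⟨r, hr, hrO⟩ := Metric.mem_nhds_iff.1 hO
  exact (measure_ball_pos volume y hr).ne' (measure_mono_null (hrO.trans hcon) hC.null)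

/-- The jump of `u` is constant along rays. -/
theorem HasJump.smul (hu : LocConst C u) (hC : IsTwoSidedCone C) {y : V} {c c' : ℝ}
    (hc : HasJump C u y c c') (hy : ‖y‖ < 1) {t : ℝ} (ht : 0 < t) (ht1 : t ≤ 1) :
    HasJump C u (t • y) c c' := by
  have hyb : y ∈ ball (0 : V) 1 := by simpa using hy
  have key : ∀ x ∈ ball (0 : V) 1, x ∉ C → u (t • x) = u x := fun x hx hxC =>
    hu.smul_of_le hC ⟨hx, hxC⟩ ht ht1
  have hinv : ∀ x : V, t • t⁻¹ • x = x := fun x => by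
    rw [smul_smul, mul_inv_cancel₀ ht.ne', one_smul]
  have hcont : ContinuousAt (fun x : V => t⁻¹ • x) (t • y) := by fun_prop
  have hty : t⁻¹ • t • y = y := by rw [smul_smul, inv_mul_cancel₀ ht.ne', one_smul]
  have hcont2 : ContinuousAt (fun x : V => t • x) y := by fun_prop
  have side : ∀ d, (∀ O ∈ 𝓝 y, ∃ x ∈ O, x ∉ C ∧ u x = d) →
      ∀ O ∈ 𝓝 (t • y), ∃ x ∈ O, x ∉ C ∧ u x = d := by
    intro d hd O hO
    obtain ⟨x, hx, hxC, hxd⟩ := hd _ (inter_mem (hcont2 hO) (isOpen_ball.mem_nhds hyb))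
    exact ⟨t • x, hx.1, hC.smul_notMem hxC ht, by rw [key x hx.2 hxC, hxd]⟩
  refine ⟨hc.lt, ?_, side _ hc.left, side _ hc.right⟩
  have h1 := hcont.eventually (hty.symm ▸ hc.eventually.and (isOpen_ball.eventually_mem hyb))
  filter_upwards [h1] with x hx hxC
  have hxC' : t⁻¹ • x ∉ C := hC.smul_notMem hxC (inv_pos.2 ht)
  rw [← hinv x, key _ hx.2 hxC']
  exact hx.1 hxC'

/-- `u` takes only two values, if it has a jump starting from its smallest value only. -/
theorem LocConst.mem_pair_of_jump (hu : LocConst C u) (hC : IsTwoSidedCone C)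
    (hdim : 1 < Module.rank ℝ V) {c : ℝ}
    (hc : ∀ y ∈ C, y ≠ 0 → ‖y‖ < 1 → HasJump C u y c (c + 1)) {a : V}
    (ha : a ∈ ball (0 : V) 1 \ C) (hac : u a = c) (ha0 : a ≠ 0) {x : V}
    (hx : x ∈ ball (0 : V) 1 \ C) (hx0 : x ≠ 0) : u x = c ∨ u x = c + 1 := by
  by_contra hcon
  set A : Set V := {z | ∀ᶠ y in 𝓝 z, y ∉ C → (u y = c ∨ u y = c + 1)} with hA
  set B : Set V := {z | ∀ᶠ y in 𝓝 z, y ∉ C → ¬(u y = c ∨ u y = c + 1)} with hB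
  have hmem : ∀ z ∈ ball (0 : V) 1 \ C, ((u z = c ∨ u z = c + 1) → z ∈ A) ∧
      (¬(u z = c ∨ u z = c + 1) → z ∈ B) := by
    intro z hz
    refine ⟨fun h => ?_, fun h => ?_⟩ <;> filter_upwards [hu z hz] with y hy _ <;> rwa [hy]
  have hAo : IsOpen A := isOpen_iff_mem_nhds.2 fun z hz => eventually_eventually_nhds.2 hz
  have hBo : IsOpen B := isOpen_iff_mem_nhds.2 fun z hz => eventually_eventually_nhds.2 hz
  have hsph : ∀ z ∈ sphere (0 : V) (1 / 2), ‖z‖ < 1 ∧ z ≠ 0 := by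
    intro z hz
    rw [mem_sphere_zero_iff_norm] at hz
    exact ⟨by rw [hz]; norm_num, by rintro rfl; norm_num at hz⟩
  have hcov : sphere (0 : V) (1 / 2) ⊆ A ∪ B := by
    intro z hz
    obtain ⟨hz1, hz0⟩ := hsph z hz
    have hzb : z ∈ ball (0 : V) 1 := by simpa using hz1
    by_cases hzC : z ∈ C
    · exact Or.inl (hc z hzC hz0 hz1).eventually
    · by_cases h : u z = c ∨ u z = c + 1
      · exact Or.inl ((hmem z ⟨hzb, hzC⟩).1 h)
      · exact Or.inr ((hmem z ⟨hzb, hzC⟩).2 h)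
  have hscale : ∀ z ∈ ball (0 : V) 1 \ C, z ≠ 0 → (1 / (2 * ‖z‖)) • z ∈ sphere (0 : V) (1 / 2) ∧
      (1 / (2 * ‖z‖)) • z ∈ ball (0 : V) 1 \ C ∧ u ((1 / (2 * ‖z‖)) • z) = u z := by
    intro z hz hz0
    have hn := norm_half_smul hz0
    have hpos : 0 < ‖z‖ := norm_pos_iff.2 hz0
    have hlt : ‖(1 / (2 * ‖z‖)) • z‖ < 1 := by rw [hn]; norm_num
    exact ⟨mem_sphere_zero_iff_norm.2 hn, ⟨by simpa using hlt, hC.smul_notMem hz.2 (by positivity)⟩,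
      hu.smul hC hz (by positivity) hlt⟩
  obtain ⟨a1, a2, a3⟩ := hscale a ha ha0
  obtain ⟨x1, x2, x3⟩ := hscale x hx hx0
  obtain ⟨z, -, hzA, hzB⟩ := (isPreconnected_sphere hdim (0 : V) (1 / 2)) A B hAo hBo hcov
    ⟨_, a1, (hmem _ a2).1 (Or.inl (a3.trans hac))⟩ ⟨_, x1, (hmem _ x2).2 (by rwa [x3])⟩
  obtain ⟨y, hy, hyC⟩ := hC.exists_notMem (inter_mem hzA hzB)
  exact hy.2 hyC (hy.1 hyC)

/-- If `v` is constant almost everywhere near the vertex, then `u` cannot take three values. -/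
theorem IsJumpFunction.not_three_values [IsFiniteMeasure κ] (h : IsCalibratingField v W κ C)
    (hu : IsJumpFunction v κ C u) (hC : IsTwoSidedCone C) {e : V} (he : ‖e‖ = 1) {r : ℝ}
    (hr : 0 < r) (hr1 : r < 1) (hv : ∀ᵐ z ∂κ, z ∈ ball (0 : V) r → v z = e) {x₁ x₂ x₃ : V}
    (h₁ : x₁ ∈ ball (0 : V) 1 \ C) (h₂ : x₂ ∈ ball (0 : V) 1 \ C) (h₃ : x₃ ∈ ball (0 : V) 1 \ C)
    (h₁₂ : u x₁ < u x₂) (h₂₃ : u x₂ < u x₃) : False := by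
  -- `u` is monotone in the direction `e` near the vertex, and constant along rays
  have key : ∀ x ∈ ball (0 : V) 1 \ C, ∀ y ∈ ball (0 : V) 1 \ C, u x < u y →
      ∀ s t : ℝ, 0 < s → s ≤ 1 → 0 < t → t ≤ 1 → s * ⟪x, e⟫ < t * ⟪y, e⟫ := by
    intro x hx y hy hxy s t hs hs1 ht ht1
    by_contra hcon
    have hnx : ‖x‖ < 1 := by simpa using hx.1
    have hny : ‖y‖ < 1 := by simpa using hy.1
    have hin : ∀ z : V, ‖z‖ < 1 → ∀ t : ℝ, 0 < t → t ≤ 1 → (r * t) • z ∈ ball (0 : V) r := by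
      intro z hz t ht ht1
      rw [mem_ball_zero_iff, norm_smul, Real.norm_of_nonneg (by positivity), mul_assoc]
      refine mul_lt_of_lt_one_right hr ?_
      exact (mul_le_of_le_one_left (norm_nonneg _) ht1).trans_lt hz
    have hm : ∀ t : ℝ, t ≤ 1 → r * t ≤ 1 := fun t ht => by nlinarith
    have := hu.le_of_inner_nonneg h (p := 0) (r := r) (x := (r * t) • y) (y := (r * s) • x)
      (ball_subset_ball hr1.le)
      ⟨hin y hny t ht ht1, hC.smul_notMem hy.2 (by positivity)⟩
      ⟨hin x hnx s hs hs1, hC.smul_notMem hx.2 (by positivity)⟩ (by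
        filter_upwards [hv] with z hz hzr
        rw [hz hzr, inner_sub_right, inner_smul_right, inner_smul_right, real_inner_comm,
          real_inner_comm y e]
        have := mul_le_mul_of_nonneg_left (not_lt.1 hcon) hr.le
        linarith)
    rw [hu.locConst.smul_of_le hC hy (by positivity) (hm t ht1),
      hu.locConst.smul_of_le hC hx (by positivity) (hm s hs1)] at this
    linarith
  have hsign : ∀ x ∈ ball (0 : V) 1 \ C, ∀ y ∈ ball (0 : V) 1 \ C, u x < u y →
      ⟪x, e⟫ ≤ 0 ∧ 0 ≤ ⟪y, e⟫ := by
    intro x hx y hy hxy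
    constructor
    · by_contra hcon
      push Not at hcon
      have hlim : Tendsto (fun t : ℝ => t * ⟪y, e⟫) (𝓝[>] 0) (𝓝 0) := by
        have : Tendsto (fun t : ℝ => t * ⟪y, e⟫) (𝓝 0) (𝓝 (0 * ⟪y, e⟫)) := by
          exact (continuous_id.mul continuous_const).tendsto 0
        rw [zero_mul] at this
        exact this.mono_left nhdsWithin_le_nhds
      obtain ⟨t, ht, ht1, ht0⟩ := ((hlim.eventually (gt_mem_nhds hcon)).and
        (((show ∀ᶠ t : ℝ in 𝓝 0, t < 1 from gt_mem_nhds one_pos).filter_mono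
          nhdsWithin_le_nhds).and self_mem_nhdsWithin)).exists
      have := key x hx y hy hxy 1 t one_pos le_rfl ht0 (le_of_lt ht1)
      linarith
    · by_contra hcon
      push Not at hcon
      have hlim : Tendsto (fun t : ℝ => t * ⟪x, e⟫) (𝓝[>] 0) (𝓝 0) := by
        have : Tendsto (fun t : ℝ => t * ⟪x, e⟫) (𝓝 0) (𝓝 (0 * ⟪x, e⟫)) := by
          exact (continuous_id.mul continuous_const).tendsto 0
        rw [zero_mul] at this
        exact this.mono_left nhdsWithin_le_nhds
      obtain ⟨t, ht, ht1, ht0⟩ := ((hlim.eventually (lt_mem_nhds hcon)).and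
        (((show ∀ᶠ t : ℝ in 𝓝 0, t < 1 from gt_mem_nhds one_pos).filter_mono
          nhdsWithin_le_nhds).and self_mem_nhdsWithin)).exists
      have := key x hx y hy hxy t 1 ht0 (le_of_lt ht1) one_pos le_rfl
      linarith
  -- move the middle point off the hyperplane orthogonal to `e`
  have hzero : ⟪x₂, e⟫ = 0 := le_antisymm (hsign _ h₂ _ h₃ h₂₃).1 (hsign _ h₁ _ h₂ h₁₂).2
  have hcont : ContinuousAt (fun t : ℝ => x₂ + t • e) 0 := by fun_prop
  have h0 : x₂ + (0 : ℝ) • e = x₂ := by simp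
  have hopen : IsOpen (ball (0 : V) 1 \ C) := isOpen_ball.sdiff hC.isClosed
  have hev := hcont.eventually
    (h0.symm ▸ (hu.locConst x₂ h₂).and (hopen.eventually_mem h₂) : ∀ᶠ y in 𝓝 (x₂ + (0 : ℝ) • e),
      u y = u x₂ ∧ y ∈ ball (0 : V) 1 \ C)
  obtain ⟨t, ⟨ht1, ht2⟩, ht0⟩ := ((hev.filter_mono nhdsWithin_le_nhds).and
    (self_mem_nhdsWithin : ∀ᶠ t : ℝ in 𝓝[>] 0, t ∈ Ioi 0)).exists
  have h5 := (hsign _ ht2 _ h₃ (by rwa [ht1])).1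
  rw [inner_add_left, hzero, inner_smul_left, real_inner_self_eq_norm_sq, he] at h5
  simp at h5
  exact (not_lt.2 h5) ht0

/-- The potential of a calibration takes only two values on the complement of the cone. -/
theorem IsJumpFunction.exists_two_values [IsFiniteMeasure κ] (h : IsCalibratingField v W κ C)
    (hu : IsJumpFunction v κ C u) (hC : IsTwoSidedCone C) (hJ : UnitJumps C u)
    (hdim : 1 < Module.rank ℝ V) (hfin : (u '' (ball (0 : V) 1 \ C)).Finite) :
    ∃ c, ∀ x ∈ ball (0 : V) 1 \ C, u x = c ∨ u x = c + 1 := by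
  rcases (ball (0 : V) 1 \ C).eq_empty_or_nonempty with hemp | hne
  · exact ⟨0, by simp [hemp]⟩
  have : Nontrivial V := by
    rw [← rank_pos_iff_nontrivial (R := ℝ)]
    exact zero_lt_one.trans hdim
  obtain ⟨_, ⟨a, ha, rfl⟩, hmin⟩ := hfin.exists_minimal (hne.image u)
  have hmin' : ∀ x ∈ ball (0 : V) 1 \ C, u a ≤ u x := by
    intro x hx
    by_contra hcon
    exact hcon (hmin ⟨x, hx, rfl⟩ (not_le.1 hcon).le)
  refine ⟨u a, ?_⟩
  by_contra! hcon
  obtain ⟨x, hx, hx1, hx2⟩ := hcon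
  have hopen : IsOpen (ball (0 : V) 1 \ C) := isOpen_ball.sdiff hC.isClosed
  -- perturb points to avoid the origin
  have hmove : ∀ z ∈ ball (0 : V) 1 \ C, ∃ z' ∈ ball (0 : V) 1 \ C, z' ≠ 0 ∧ u z' = u z := by
    intro z hz
    by_cases hz0 : z = 0
    · subst hz0
      obtain ⟨z', hz', hz0'⟩ := ((((hu.locConst 0 hz).and
        (hopen.eventually_mem hz)).filter_mono nhdsWithin_le_nhds).and
          (self_mem_nhdsWithin : ∀ᶠ t in 𝓝[≠] (0 : V), t ∈ ({0} : Set V)ᶜ)).exists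
      exact ⟨z', hz'.2, hz0', hz'.1⟩
    · exact ⟨z, hz, hz0, rfl⟩
  obtain ⟨r, hr, hr1, hswap⟩ := hu.exists_eq_of_lt h hC hJ
  have hjump : ∃ y ∈ C, ‖y‖ < 1 ∧ y ≠ 0 ∧ ∃ c, u a < c ∧ HasJump C u y c (c + 1) := by
    by_contra! hno
    obtain ⟨a', ha', ha0, haa⟩ := hmove a ha
    obtain ⟨x', hx', hx0, hxx⟩ := hmove x hx
    have := hu.locConst.mem_pair_of_jump hC hdim (c := u a) (fun y hyC hy0 hy1 => ?_) ha' haa ha0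
      hx' hx0
    · rw [hxx] at this
      exact this.elim hx1 hx2
    · obtain ⟨c, hc⟩ := hJ y hyC hy0 hy1
      obtain ⟨q, hq, hqC, hqc⟩ := hc.left _ (isOpen_ball.mem_nhds (show y ∈ ball (0 : V) 1 by
        simpa using hy1))
      have hle := hmin' q ⟨hq, hqC⟩
      rw [hqc] at hle
      rcases hle.lt_or_eq with hlt | heq
      · exact absurd hc (hno y hyC hy1 hy0 c hlt)
      · rwa [heq]
  obtain ⟨y, hyC, hy1, hy0, c, hac, hjc⟩ := hjump
  -- a regular point of the cone near the vertex with this jump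
  have hypos : 0 < ‖y‖ := norm_pos_iff.2 hy0
  have hsmall : ∀ z : V, ‖z‖ < 1 → ‖(r / 2) • z‖ < r := by
    intro z hz
    rw [norm_smul, Real.norm_of_nonneg (by positivity)]
    nlinarith [norm_nonneg z]
  have hjr := hjc.smul hu.locConst hC hy1 (t := r / 2) (by positivity) (by linarith)
  obtain ⟨O, hO, hOo, hyO⟩ := _root_.mem_nhds_iff.1 (inter_mem hjr.eventually
    (inter_mem (isOpen_ball.mem_nhds (show (r / 2) • y ∈ ball (0 : V) r by
      simpa using hsmall y hy1)) (isOpen_compl_singleton.mem_nhds (show (r / 2) • y ≠ 0 from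
        smul_ne_zero (by positivity) hy0))))
  obtain ⟨y₁, hy₁O, hy₁C, hy₁W⟩ := h.exists_mem (hC.smul_mem y hyC _ (by positivity))
    ((hsmall y hy1).trans hr1) (hOo.mem_nhds hyO)
  have hy₁r : ‖y₁‖ < r := by simpa using (hO hy₁O).2.1
  obtain ⟨d, hd⟩ := hJ y₁ hy₁C (hO hy₁O).2.2 (hy₁r.trans hr1)
  have hac' : u a < d := by
    obtain ⟨q, hq, hqC, hqd⟩ := hd.left _ (hOo.mem_nhds hy₁O)
    rcases (hO hq).1 hqC with h1 | h1 <;> rw [h1] at hqd <;> linarith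
  set e := v y₁ with he
  -- the field is equal to `e` near the vertex wherever `u` is minimal
  have hlow : ∀ x₀ ∈ W, x₀ ∉ C → ‖x₀‖ < r → u x₀ = u a → v x₀ = e := fun x₀ hx₀ hx₀C hx₀r hux =>
    hswap x₀ hx₀ hx₀C hx₀r y₁ hy₁W hy₁r d hd (by rwa [hux])
  have hlim : ∀ p ∈ W, ‖p‖ < r → (∀ O ∈ 𝓝 p, ∃ x ∈ O, x ∉ C ∧ u x = u a) → v p = e := by
    intro p hp hpr hpO
    by_contra hne
    have hcont : ContinuousAt v p := (h.contOn p hp).continuousAt (h.isOpen.mem_nhds hp)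
    obtain ⟨q, ⟨hq1, hq2, hq3⟩, hqC, hqa⟩ := hpO _ ((hcont.eventually_ne hne).and
      ((h.isOpen.eventually_mem hp).and (isOpen_ball.eventually_mem
        (show p ∈ ball (0 : V) r by simpa using hpr))))
    exact hq1 (hlow q hq2 hqC (by simpa using hq3) hqa)
  have ha1 : ‖a‖ < 1 := by simpa using ha.1
  -- a regular point near the vertex where `u` is minimal
  obtain ⟨x₀, hx₀W, hx₀C, hx₀r, hx₀a⟩ : ∃ x₀ ∈ W, x₀ ∉ C ∧ ‖x₀‖ < r ∧ u x₀ = u a := by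
    have hb : (r / 2) • a ∈ ball (0 : V) 1 \ C :=
      ⟨by simpa using (hsmall a ha1).trans hr1, hC.smul_notMem ha.2 (by positivity)⟩
    have hN : ∀ᶠ q in 𝓝 ((r / 2) • a), u q = u ((r / 2) • a) ∧ q ∈ ball (0 : V) 1 \ C ∧
        q ∈ ball (0 : V) r := (hu.locConst _ hb).and ((hopen.eventually_mem hb).and
      (isOpen_ball.eventually_mem (by simpa using hsmall a ha1)))
    obtain ⟨s, hs, hsO⟩ := Metric.eventually_nhds_iff_ball.1 hN
    have : ∃ q ∈ ball ((r / 2) • a) s, q ∈ W := by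
      by_contra! hno
      refine (measure_ball_pos volume ((r / 2) • a) hs).ne' (measure_mono_null ?_ h.null)
      exact fun q hq => ⟨(hsO q hq).2.1.1, hno q hq⟩
    obtain ⟨q, hq, hqW⟩ := this
    refine ⟨q, hqW, (hsO q hq).2.1.2, by simpa using (hsO q hq).2.2, ?_⟩
    rw [(hsO q hq).1, hu.locConst.smul_of_le hC ha (by positivity) (by linarith)]
  -- either the jump at `p` starts above the minimum, or `p` is a limit of points of minimal value
  have hcone : ∀ p ∈ C, p ∈ W → ‖p‖ < r → v p = e := by
    intro p hpC hpW hpr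
    by_cases hp0 : p = 0
    · subst hp0
      refine hlim 0 hpW hpr fun O hO => ?_
      have hct : Tendsto (fun t : ℝ => t • a) (𝓝[>] 0) (𝓝 0) := by
        have : Tendsto (fun t : ℝ => t • a) (𝓝 0) (𝓝 ((0 : ℝ) • a)) :=
          (continuous_id.smul continuous_const).tendsto 0
        rw [zero_smul] at this
        exact this.mono_left nhdsWithin_le_nhds
      obtain ⟨t, ht, ht1, ht0⟩ := ((hct.eventually hO).and
        (((show ∀ᶠ t : ℝ in 𝓝 0, t < 1 from gt_mem_nhds one_pos).filter_mono
          nhdsWithin_le_nhds).and self_mem_nhdsWithin)).exists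
      exact ⟨t • a, ht, hC.smul_notMem ha.2 ht0, hu.locConst.smul_of_le hC ha ht0 (le_of_lt ht1)⟩
    · obtain ⟨b, hb⟩ := hJ p hpC hp0 (hpr.trans hr1)
      obtain ⟨q, hq, hqC, hqb⟩ := hb.left _ (isOpen_ball.mem_nhds (show p ∈ ball (0 : V) 1 by
        simpa using hpr.trans hr1))
      have hle := hmin' q ⟨hq, hqC⟩
      rw [hqb] at hle
      rcases hle.lt_or_eq with hlt | heq
      · rw [← hswap x₀ hx₀W hx₀C hx₀r p hpW hpr b hb (by rwa [hx₀a]),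
          hlow x₀ hx₀W hx₀C hx₀r hx₀a]
      · exact hlim p hpW hpr (heq ▸ hb.left)
  have hae : ∀ᵐ z ∂κ, z ∈ ball (0 : V) r → v z = e := by
    filter_upwards [measure_eq_zero_iff_ae_notMem.1 h.carrier,
      measure_eq_zero_iff_ae_notMem.1 h.carrier_cone] with z hzW hzC hzr
    exact hcone z (by simpa using hzC) (by simpa using hzW) (by simpa using hzr)
  have hy₁b : y₁ ∈ ball (0 : V) 1 := by simpa using hy₁r.trans hr1
  obtain ⟨q₁, hq₁, hq₁C, hq₁d⟩ := hd.left _ (isOpen_ball.mem_nhds hy₁b)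
  obtain ⟨q₂, hq₂, hq₂C, hq₂d⟩ := hd.right _ (isOpen_ball.mem_nhds hy₁b)
  exact hu.not_three_values h hC (h.norm_eq_one hy₁C hy₁W) hr hr1 hae ha ⟨hq₁, hq₁C⟩ ⟨hq₂, hq₂C⟩
    (by rwa [hq₁d]) (by rw [hq₁d, hq₂d]; linarith)

/-- Near a regular point `p` of the cone, `u` increases along directions close to `v p`. -/
theorem IsJumpFunction.exists_le_of_near [IsFiniteMeasure κ] (h : IsCalibratingField v W κ C)
    (hu : IsJumpFunction v κ C u) {p : V} (hp : p ∈ C) (hpW : p ∈ W) :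
    ∃ r > 0, ∀ x ∈ ball p r \ C, ∀ y ∈ ball p r \ C, ∀ s : ℝ, ‖y - x - s • v p‖ ≤ 3 / 16 * s →
      u x ≤ u y := by
  have hcont : ContinuousAt v p := (h.contOn p hpW).continuousAt (h.isOpen.mem_nhds hpW)
  obtain ⟨r, hr, hr'⟩ := Metric.eventually_nhds_iff_ball.1
    ((hcont.eventually (ball_mem_nhds (v p) (ε := 1 / 2) (by norm_num))).and
      (isOpen_ball.eventually_mem (h.subset hpW)))
  refine ⟨r, hr, fun x hx y hy s hs => hu.le_of_inner_nonneg h (fun z hz => (hr' z hz).2) hx hy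
    (Eventually.of_forall fun z hz => ?_)⟩
  have h1 := (hr' z hz).1
  have he := h.norm_eq_one hp hpW
  rw [dist_eq_norm] at h1
  have hs0 : 0 ≤ s := by nlinarith [norm_nonneg (y - x - s • v p)]
  have h2 : ⟪v z, y - x⟫ = s + ⟪v p, y - x - s • v p⟫ + ⟪v z - v p, y - x⟫ := by
    rw [inner_sub_left, inner_sub_right (v p) (y - x), inner_smul_right,
      real_inner_self_eq_norm_sq, he]
    ring
  have h3 := abs_le.1 (abs_real_inner_le_norm (v p) (y - x - s • v p))
  have h4 := abs_le.1 (abs_real_inner_le_norm (v z - v p) (y - x))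
  have h5 : ‖y - x‖ ≤ 3 / 16 * s + s := by
    have := norm_add_le (y - x - s • v p) (s • v p)
    rw [sub_add_cancel, norm_smul, he, Real.norm_of_nonneg hs0] at this
    linarith
  rw [he, one_mul] at h3
  have h6 : ‖v z - v p‖ * ‖y - x‖ ≤ 1 / 2 * (3 / 16 * s + s) := by gcongr
  linarith [h3.1, h4.1]

/-- A curve that passes through a regular point of the cone in the direction of `v` enters the
region where `u` is larger and leaves the region where `u` is smaller. -/
theorem IsJumpFunction.eventually_crossing [IsFiniteMeasure κ] (h : IsCalibratingField v W κ C)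
    (hu : IsJumpFunction v κ C u) (hC : IsTwoSidedCone C) {c : ℝ}
    (hc : ∀ x ∈ ball (0 : V) 1 \ C, u x = c ∨ u x = c + 1) {γ : ℝ → V} {a : ℝ}
    (hp : γ a ∈ C) (hpW : γ a ∈ W) (hγ : HasDerivAt γ (v (γ a)) a) :
    (∀ᶠ t in 𝓝[>] a, γ t ∉ C ∧ u (γ t) = c + 1) ∧ (∀ᶠ t in 𝓝[<] a, γ t ∉ C ∧ u (γ t) = c) := by
  obtain ⟨r, hr, hmono⟩ := hu.exists_le_of_near h hp hpW
  have hpb := h.subset hpW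
  have hlit : ∀ᶠ t in 𝓝 a, ‖γ t - γ a - (t - a) • v (γ a)‖ ≤ 1 / 16 * ‖t - a‖ :=
    (hasDerivAt_iff_isLittleO.1 hγ).def (by norm_num)
  have hball : ∀ᶠ t in 𝓝 a, γ t ∈ ball (γ a) (r / 2) :=
    hγ.continuousAt.eventually (ball_mem_nhds _ (half_pos hr))
  have hW : ∀ᶠ t in 𝓝 a, γ t ∈ W := hγ.continuousAt.eventually (h.isOpen.mem_nhds hpW)
  have hta : ∀ᶠ t in 𝓝 a, ‖t - a‖ < r := by
    have : ContinuousAt (fun t : ℝ => ‖t - a‖) a := by fun_prop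
    exact this.eventually (gt_mem_nhds (by simpa using hr))
  have hvals : ∀ y ∈ C, y ∈ W → ∀ O ∈ 𝓝 y, (∃ x ∈ O, x ∉ C ∧ u x = c) ∧
      ∃ x ∈ O, x ∉ C ∧ u x = c + 1 := by
    intro y hy hyW O hO
    have hO' := inter_mem hO (isOpen_ball.mem_nhds (h.subset hyW))
    constructor
    · obtain ⟨x, hx, hxC, hxu⟩ := hu.not_const h hC hy hyW hO' (c + 1)
      exact ⟨x, hx.1, hxC, (hc x ⟨hx.2, hxC⟩).resolve_right hxu⟩
    · obtain ⟨x, hx, hxC, hxu⟩ := hu.not_const h hC hy hyW hO' c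
      exact ⟨x, hx.1, hxC, (hc x ⟨hx.2, hxC⟩).resolve_left hxu⟩
  have hnear : ∀ t, 0 < ‖t - a‖ → ‖t - a‖ < r → γ t ∈ ball (γ a) (r / 2) →
      ball (γ a) (‖t - a‖ / 16) ⊆ ball (γ a) r ∧ ball (γ t) (‖t - a‖ / 16) ⊆ ball (γ a) r := by
    intro t ht htr htb
    rw [mem_ball] at htb
    exact ⟨ball_subset_ball (by linarith), ball_subset_ball' (by linarith)⟩
  constructor
  · filter_upwards [nhdsWithin_le_nhds hlit, nhdsWithin_le_nhds hball, nhdsWithin_le_nhds hW,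
      nhdsWithin_le_nhds hta, self_mem_nhdsWithin] with t h1 h2 h3 h4 h5
    have hpos : 0 < t - a := sub_pos.2 h5
    have hn : ‖t - a‖ = t - a := Real.norm_of_nonneg hpos.le
    obtain ⟨hb1, hb2⟩ := hnear t (by rwa [hn]) h4 h2
    obtain ⟨q, hq, hqC, hqu⟩ := (hvals _ hp hpW _ (ball_mem_nhds _
      (show 0 < ‖t - a‖ / 16 by rw [hn]; positivity))).2
    have key : ∀ x ∈ ball (γ t) (‖t - a‖ / 16), x ∉ C → c + 1 ≤ u x := by
      intro x hx hxC
      rw [← hqu]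
      refine hmono q ⟨hb1 hq, hqC⟩ x ⟨hb2 hx, hxC⟩ (t - a) ?_
      rw [mem_ball, dist_eq_norm, hn] at hx hq
      rw [hn] at h1
      have e1 : x - q - (t - a) • v (γ a) =
          (x - γ t) + (γ t - γ a - (t - a) • v (γ a)) - (q - γ a) := by abel
      rw [e1]
      have e2 := norm_sub_le ((x - γ t) + (γ t - γ a - (t - a) • v (γ a))) (q - γ a)
      have e3 := norm_add_le (x - γ t) (γ t - γ a - (t - a) • v (γ a))
      linarith
    have hbt : γ t ∈ ball (γ t) (‖t - a‖ / 16) := mem_ball_self (by rw [hn]; positivity)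
    have hnC : γ t ∉ C := by
      intro hCt
      obtain ⟨x, hx, hxC, hxu⟩ := (hvals _ hCt h3 _ (isOpen_ball.mem_nhds hbt)).1
      have := key x hx hxC
      linarith
    refine ⟨hnC, (hc _ ⟨h.subset h3, hnC⟩).resolve_left fun heq => ?_⟩
    have := key _ hbt hnC
    linarith
  · filter_upwards [nhdsWithin_le_nhds hlit, nhdsWithin_le_nhds hball, nhdsWithin_le_nhds hW,
      nhdsWithin_le_nhds hta, self_mem_nhdsWithin] with t h1 h2 h3 h4 h5
    have hpos : 0 < a - t := sub_pos.2 h5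
    have hn : ‖t - a‖ = a - t := by rw [Real.norm_eq_abs, abs_sub_comm, abs_of_pos hpos]
    obtain ⟨hb1, hb2⟩ := hnear t (by rwa [hn]) h4 h2
    obtain ⟨q, hq, hqC, hqu⟩ := (hvals _ hp hpW _ (ball_mem_nhds _
      (show 0 < ‖t - a‖ / 16 by rw [hn]; positivity))).1
    have key : ∀ x ∈ ball (γ t) (‖t - a‖ / 16), x ∉ C → u x ≤ c := by
      intro x hx hxC
      rw [← hqu]
      refine hmono x ⟨hb2 hx, hxC⟩ q ⟨hb1 hq, hqC⟩ (a - t) ?_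
      rw [mem_ball, dist_eq_norm, hn] at hx hq
      rw [hn] at h1
      have e1 : q - x - (a - t) • v (γ a) =
          (q - γ a) - (γ t - γ a - (t - a) • v (γ a)) - (x - γ t) := by
        rw [← neg_sub t a, neg_smul]; abel
      rw [e1]
      have e2 := norm_sub_le ((q - γ a) - (γ t - γ a - (t - a) • v (γ a))) (x - γ t)
      have e3 := norm_sub_le (q - γ a) (γ t - γ a - (t - a) • v (γ a))
      linarith
    have hbt : γ t ∈ ball (γ t) (‖t - a‖ / 16) := mem_ball_self (by rw [hn]; positivity)
    have hnC : γ t ∉ C := by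
      intro hCt
      obtain ⟨x, hx, hxC, hxu⟩ := (hvals _ hCt h3 _ (isOpen_ball.mem_nhds hbt)).2
      have := key x hx hxC
      linarith
    refine ⟨hnC, (hc _ ⟨h.subset h3, hnC⟩).resolve_right fun heq => ?_⟩
    have := key _ hbt hnC
    linarith

/-- An integral curve of `v` meets the cone at most once. -/
theorem IsJumpFunction.subsingleton_hits [IsFiniteMeasure κ] (h : IsCalibratingField v W κ C)
    (hu : IsJumpFunction v κ C u) (hC : IsTwoSidedCone C) {c : ℝ}
    (hc : ∀ x ∈ ball (0 : V) 1 \ C, u x = c ∨ u x = c + 1) {γ : ℝ → V} {I : Set ℝ}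
    (hI : I.OrdConnected) (hmaps : MapsTo γ I W) (hγ : ∀ t ∈ I, HasDerivAt γ (v (γ t)) t) :
    {t ∈ I | γ t ∈ C}.Subsingleton := by
  have main : ∀ a ∈ I, ∀ b ∈ I, a < b → γ a ∈ C → γ b ∈ C → False := by
    intro a ha b hb hab hγa hγb
    have hIab : Icc a b ⊆ I := hI.out ha hb
    have hcont : ContinuousOn γ (Icc a b) := fun t ht =>
      (hγ t (hIab ht)).continuousAt.continuousWithinAt
    obtain ⟨hright, -⟩ := hu.eventually_crossing h hC hc hγa (hmaps ha) (hγ a ha)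
    obtain ⟨t₀, ht₀, hfree⟩ := mem_nhdsGT_iff_exists_Ioo_subset.1 hright
    rw [mem_Ioi] at ht₀
    have ht₀b : t₀ ≤ b := by
      by_contra hlt
      exact (hfree ⟨hab, not_le.1 hlt⟩).1 hγb
    -- the first time after `a` at which the curve meets the cone
    have hclosed : IsCompact (Icc t₀ b ∩ γ ⁻¹' C) := by
      refine isCompact_Icc.of_isClosed_subset ?_ inter_subset_left
      exact (hcont.mono (Icc_subset_Icc_left ht₀.le)).preimage_isClosed_of_isClosed isClosed_Icc
        hC.isClosed
    obtain ⟨t₁, ⟨ht₁, ht₁C⟩, hleast⟩ := hclosed.exists_isLeast ⟨b, ⟨ht₀b, le_rfl⟩, hγb⟩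
    have hat₁ : a < t₁ := ht₀.trans_le ht₁.1
    have ht₁I : t₁ ∈ I := hIab ⟨hat₁.le, ht₁.2⟩
    have hoff : ∀ t ∈ Ioo a t₁, γ t ∉ C := by
      intro t ht
      rcases lt_or_ge t t₀ with hlt | hge
      · exact (hfree ⟨ht.1, hlt⟩).1
      · exact fun hCt => (hleast ⟨⟨hge, ht.2.le.trans ht₁.2⟩, hCt⟩).not_gt ht.2
    have hpre : IsPreconnected (γ '' Ioo a t₁) := isPreconnected_Ioo.image _
      (hcont.mono (Ioo_subset_Icc_self.trans (Icc_subset_Icc_right ht₁.2)))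
    have hsub : γ '' Ioo a t₁ ⊆ ball 0 1 \ C := by
      rintro _ ⟨t, ht, rfl⟩
      exact ⟨h.subset (hmaps (hIab ⟨ht.1.le, ht.2.le.trans ht₁.2⟩)), hoff t ht⟩
    obtain ⟨-, hleft⟩ := hu.eventually_crossing h hC hc ht₁C (hmaps ht₁I) (hγ t₁ ht₁I)
    obtain ⟨s, hs, hsI⟩ := (hright.and (Ioo_mem_nhdsGT hat₁)).exists
    obtain ⟨s', hs', hsI'⟩ := (hleft.and (Ioo_mem_nhdsLT hat₁)).exists
    have := hu.locConst.eq_of_isPreconnected hpre hsub ⟨s, hsI, rfl⟩ ⟨s', hsI', rfl⟩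
    rw [hs.2, hs'.2] at this
    linarith
  rintro a ⟨ha, hγa⟩ b ⟨hb, hγb⟩
  rcases lt_trichotomy a b with hlt | heq | hlt
  · exact (main a ha b hb hlt hγa hγb).elim
  · exact heq
  · exact (main b hb a ha hlt hγb hγa).elim

end Crossing

/-! ### Flux through small cylinders -/

section Cylinder

variable {V : Type*} [NormedAddCommGroup V] [InnerProductSpace ℝ V] [FiniteDimensional ℝ V]
  [MeasurableSpace V] [BorelSpace V]

variable {v : V → V} {W : Set V} {κ : Measure V} {C : Set V} {u : V → ℝ}

/-- Cylindrical coordinates with axis `e` around `y` preserve the volume. -/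
theorem measurePreserving_cylinder {e : V} (he : ‖e‖ = 1) (y : V) :
    MeasurePreserving (fun p : ℝ × (ℝ ∙ e)ᗮ => y + (p.1 • e + (p.2 : V)))
      ((volume : Measure ℝ).prod volume) volume := by
  have h1 := ((ℝ ∙ e).measurePreserving_measurableEquivProd y).symm
  rw [InnerProductSpace.euclideanHausdorffMeasure_eq_volume] at h1
  have h2 := (LinearIsometryEquiv.toSpanUnitSingleton e he).measurePreserving.prod
    (MeasurePreserving.id (volume : Measure (ℝ ∙ e)ᗮ))
  have h3 := h1.comp h2
  have heq : (fun p : ℝ × (ℝ ∙ e)ᗮ => y + (p.1 • e + (p.2 : V))) =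
      ⇑((ℝ ∙ e).measurableEquivProd y).symm ∘
        Prod.map (LinearIsometryEquiv.toSpanUnitSingleton e he) id := by
    funext p
    simp [LinearIsometryEquiv.toSpanUnitSingleton_apply, add_comm]
  rw [heq]
  exact h3

theorem IsCalibratingField.integrable_mul_prod [IsFiniteMeasure κ] (h : IsCalibratingField v W κ C)
    (φ : ContDiffBump (0 : V)) {g : V → ℝ} (hg : Measurable g) {K : ℝ} (hK : ∀ x, |g x| ≤ K)
    (e : V) : Integrable (fun z : V × V => g z.1 * (φ.normed volume (z.1 - z.2) * ⟪v z.2, e⟫))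
      (volume.prod κ) := by
  have h1 := Integrable.convolution_integrand (ContinuousLinearMap.mul ℝ ℝ)
    (integrable_const (1 : ℝ) (μ := κ)) (φ.integrable_normed (μ := volume))
  simp only [ContinuousLinearMap.mul_apply', one_mul] at h1
  refine (h1.mul_bdd (c := 1 * ‖e‖) ?_ (Eventually.of_forall fun z => ?_)).bdd_mul (c := K) ?_
    (Eventually.of_forall fun z => hK _)
  · exact ((h.measurable.comp measurable_snd).inner measurable_const).aestronglyMeasurable
  · exact (norm_inner_le_norm _ _).trans
      (mul_le_mul_of_nonneg_right (h.norm_le z.2) (norm_nonneg _))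
  · exact (hg.comp measurable_fst).aestronglyMeasurable

/-- Mollification is a symmetric operation. -/
theorem IsCalibratingField.integral_mul_inner_mollify [IsFiniteMeasure κ]
    (h : IsCalibratingField v W κ C) (φ : ContDiffBump (0 : V)) {g : V → ℝ} (hg : Measurable g)
    {K : ℝ} (hK : ∀ x, |g x| ≤ K) (e : V) :
    ∫ x, g x * ⟪mollify φ κ v x, e⟫ = ∫ z, average φ g z * ⟪v z, e⟫ ∂κ := by
  have h1 : ∀ x, g x * ⟪mollify φ κ v x, e⟫ =
      ∫ z, g x * (φ.normed volume (x - z) * ⟪v z, e⟫) ∂κ := fun x => by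
    rw [inner_mollify φ h.integrable, integral_const_mul]
  simp_rw [h1]
  rw [integral_integral_swap (f := fun x z => g x * (φ.normed volume (x - z) * ⟪v z, e⟫))
    (h.integrable_mul_prod φ hg hK e)]
  refine integral_congr_ae (Eventually.of_forall fun z => ?_)
  simp only
  unfold average
  rw [← integral_mul_const, ← integral_sub_left_eq_self _ _ z]
  refine integral_congr_ae (Eventually.of_forall fun s => ?_)
  simp only [sub_sub_cancel_left]
  rw [φ.normed_neg]
  ring

/-- The mollifications of `v κ` converge weakly to `v κ`. -/
theorem IsCalibratingField.tendsto_integral_mul_mollify [IsFiniteMeasure κ]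
    (h : IsCalibratingField v W κ C) {g : V → ℝ} (hg : Measurable g) {K : ℝ}
    (hK : ∀ x, |g x| ≤ K) (hcont : ∀ᵐ z ∂κ, ContinuousAt g z) (e : V) :
    Tendsto (fun k => ∫ x, g x * ⟪mollify (bump V k) κ v x, e⟫) atTop
      (𝓝 (∫ z, g z * ⟪v z, e⟫ ∂κ)) := by
  simp_rw [fun k => h.integral_mul_inner_mollify (bump V k) hg hK e]
  have hav : ∀ k z, |average (bump V k) g z| ≤ K := fun k z =>
    IsJumpFunction.abs_average_le (bump V k) hK z
  refine tendsto_integral_of_dominated_convergence (fun _ => K * (1 * ‖e‖)) (fun k => ?_)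
    (integrable_const _) (fun k => Eventually.of_forall fun z => ?_) ?_
  · have : Measurable (average (bump V k) g) := by
      have hm : StronglyMeasurable fun p : V × V =>
          (bump V k).normed volume p.2 * g (p.1 - p.2) := by
        refine Measurable.stronglyMeasurable ?_
        exact ((bump V k).continuous_normed.measurable.comp measurable_snd).mul
          (hg.comp (measurable_fst.sub measurable_snd))
      exact hm.integral_prod_right.measurable
    exact (this.mul (h.measurable.inner measurable_const)).aestronglyMeasurable
  · rw [norm_mul]
    refine mul_le_mul (hav k z) ((norm_inner_le_norm _ _).trans
      (mul_le_mul_of_nonneg_right (h.norm_le z) (norm_nonneg _))) (norm_nonneg _)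
      ((abs_nonneg _).trans (hK z))
  · filter_upwards [hcont] with z hz
    refine Tendsto.mul_const _ ?_
    refine ContDiffBump.convolution_tendsto_right (φ := fun k => bump V k) (g := fun _ => g)
      (k := fun _ => z) (tendsto_bump_rOut V)
      (Eventually.of_forall fun _ => hg.aestronglyMeasurable) ?_ tendsto_const_nhds
    exact Tendsto.comp (g := g) hz tendsto_snd

/-- In the ball of radius `r` around `y`, the cone is a graph of slope at most `ε` over a hyperplane
with normal `e`, and `u` is equal to `c` below and to `c'` above this graph. -/
structure IsFlatAt (v : V → V) (C : Set V) (u : V → ℝ) (y e : V) (ε r c c' : ℝ) : Prop where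
  unit : ‖e‖ = 1
  pos : 0 < r
  lt : c < c'
  ball_subset : ball y r ⊆ ball 0 1
  near : ∀ z ∈ ball y r, ‖v z - e‖ ≤ ε
  lip : ∀ p ∈ C, p ∈ ball y r → ∀ p' ∈ C, p' ∈ ball y r → ⟪p' - p, e⟫ ≤ ε * ‖p' - p‖
  above : ∀ x ∈ ball y r, ε * ‖x - y‖ < ⟪x - y, e⟫ → x ∉ C ∧ u x = c'
  below : ∀ x ∈ ball y r, ε * ‖x - y‖ < ⟪y - x, e⟫ → x ∉ C ∧ u x = c

/-- A jump persists, with the same two values, at the nearby points of the cone. -/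
theorem HasJump.eq_of_nhds [IsFiniteMeasure κ] (h : IsCalibratingField v W κ C)
    (hu : IsJumpFunction v κ C u) (hC : IsTwoSidedCone C) {p : V} (hp : p ∈ C) (hp0 : p ≠ 0)
    (hp1 : ‖p‖ < 1) {c c' : ℝ} (hlt : c < c')
    (hev : ∀ᶠ x in 𝓝 p, x ∉ C → u x = c ∨ u x = c') : HasJump C u p c c' := by
  obtain ⟨d, d', hd⟩ := hu.exists_hasJump h hC hp hp0 hp1
  obtain ⟨x, hx, hxC, hxd⟩ := hd.left _ hev
  obtain ⟨x', hx', hxC', hxd'⟩ := hd.right _ hev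
  have hdd := hd.lt
  rcases hx hxC with h1 | h1 <;> rcases hx' hxC' with h2 | h2
  · linarith
  · rwa [← h1, ← h2, hxd, hxd']
  · linarith
  · linarith

/-- At a regular point, the cone is flat at small scales: `u` increases along all directions at an
acute angle with `v`, so such a direction cannot lead from a point of the cone to another one. -/
theorem IsJumpFunction.exists_isFlatAt [IsFiniteMeasure κ] (h : IsCalibratingField v W κ C)
    (hu : IsJumpFunction v κ C u) (hC : IsTwoSidedCone C) {y : V} (hy : y ∈ C) (hyW : y ∈ W)
    (hy0 : y ≠ 0) {c c' : ℝ} (hc : HasJump C u y c c') {ε : ℝ} (hε : 0 < ε) :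
    ∃ r, IsFlatAt v C u y (v y) ε r c c' := by
  have hcont : ContinuousAt v y := (h.contOn y hyW).continuousAt (h.isOpen.mem_nhds hyW)
  have hone := h.norm_eq_one hy hyW
  obtain ⟨r, hr, hr'⟩ := Metric.eventually_nhds_iff_ball.1
    ((hcont.eventually (closedBall_mem_nhds (v y) hε)).and
      ((isOpen_ball.eventually_mem (h.subset hyW)).and (hc.eventually.and
        (isOpen_compl_singleton.eventually_mem hy0))))
  have hnear : ∀ z ∈ ball y r, ‖v z - v y‖ ≤ ε := fun z hz => by
    have := (hr' z hz).1
    rwa [← dist_eq_norm]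
  have hmono : ∀ x ∈ ball y r \ C, ∀ x' ∈ ball y r \ C, ε * ‖x' - x‖ ≤ ⟪x' - x, v y⟫ →
      u x ≤ u x' := by
    intro x hx x' hx' hle
    refine hu.le_of_inner_nonneg h (fun z hz => (hr' z hz).2.1) hx hx'
      (Eventually.of_forall fun z hz => ?_)
    have h1 : ⟪v z, x' - x⟫ = ⟪x' - x, v y⟫ + ⟪v z - v y, x' - x⟫ := by
      rw [real_inner_comm (v y) (x' - x), inner_sub_left]; ring
    have h2 := (abs_le.1 (abs_real_inner_le_norm (v z - v y) (x' - x))).1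
    have h3 : ‖v z - v y‖ * ‖x' - x‖ ≤ ε * ‖x' - x‖ :=
      mul_le_mul_of_nonneg_right (hnear z hz) (norm_nonneg _)
    linarith
  have hjump : ∀ p ∈ C, p ∈ ball y r → HasJump C u p c c' := by
    intro p hp hpr
    have hp1 : ‖p‖ < 1 := by simpa using (hr' p hpr).2.1
    refine HasJump.eq_of_nhds h hu hC hp (hr' p hpr).2.2.2 hp1 hc.lt ?_
    filter_upwards [isOpen_ball.mem_nhds hpr] with x hx using (hr' x hx).2.2.1
  -- strict inequalities persist for nearby points
  have hopen : ∀ p q : V, ε * ‖q - p‖ < ⟪q - p, v y⟫ → ∃ N ∈ 𝓝 p, ∃ N' ∈ 𝓝 q,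
      ∀ a ∈ N, ∀ b ∈ N', ε * ‖b - a‖ ≤ ⟪b - a, v y⟫ := by
    intro p q hpq
    have hO : IsOpen {z : V × V | ε * ‖z.2 - z.1‖ < ⟪z.2 - z.1, v y⟫} :=
      isOpen_lt (by fun_prop) (by fun_prop)
    obtain ⟨N, hN, N', hN', hNN⟩ := mem_nhds_prod_iff.1 (hO.mem_nhds (show (p, q) ∈ _ from hpq))
    exact ⟨N, hN, N', hN', fun a ha b hb => le_of_lt (hNN (mk_mem_prod ha hb))⟩
  have hlip : ∀ p ∈ C, p ∈ ball y r → ∀ p' ∈ C, p' ∈ ball y r →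
      ⟪p' - p, v y⟫ ≤ ε * ‖p' - p‖ := by
    intro p hp hpr p' hp' hpr'
    by_contra! hlt
    obtain ⟨N, hN, N', hN', hNN⟩ := hopen p p' hlt
    obtain ⟨a, ha, haC, hau⟩ := (hjump p hp hpr).right _ (inter_mem hN (isOpen_ball.mem_nhds hpr))
    obtain ⟨b, hb, hbC, hbu⟩ := (hjump p' hp' hpr').left _
      (inter_mem hN' (isOpen_ball.mem_nhds hpr'))
    have := hmono a ⟨ha.2, haC⟩ b ⟨hb.2, hbC⟩ (hNN a ha.1 b hb.1)
    rw [hau, hbu] at this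
    exact this.not_gt hc.lt
  have hyr : y ∈ ball y r := mem_ball_self hr
  refine ⟨r, hone, hr, hc.lt, fun z hz => (hr' z hz).2.1, hnear, hlip, ?_, ?_⟩
  · intro x hx hlt
    have hxC : x ∉ C := fun hxC => (hlip y hy hyr x hxC hx).not_gt hlt
    obtain ⟨N, hN, N', hN', hNN⟩ := hopen y x hlt
    obtain ⟨a, ha, haC, hau⟩ := hc.right _ (inter_mem hN (isOpen_ball.mem_nhds hyr))
    have := hmono a ⟨ha.2, haC⟩ x ⟨hx, hxC⟩ (hNN a ha.1 x (mem_of_mem_nhds hN'))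
    refine ⟨hxC, ((hr' x hx).2.2.1 hxC).resolve_left fun heq => ?_⟩
    rw [hau, heq] at this
    exact this.not_gt hc.lt
  · intro x hx hlt
    rw [norm_sub_rev] at hlt
    have hxC : x ∉ C := fun hxC => (hlip x hxC hx y hy hyr).not_gt hlt
    obtain ⟨N, hN, N', hN', hNN⟩ := hopen x y hlt
    obtain ⟨a, ha, haC, hau⟩ := hc.left _ (inter_mem hN' (isOpen_ball.mem_nhds hyr))
    have := hmono x ⟨hx, hxC⟩ a ⟨ha.2, haC⟩ (hNN x (mem_of_mem_nhds hN) a ha.1)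
    refine ⟨hxC, ((hr' x hx).2.2.1 hxC).resolve_right fun heq => ?_⟩
    rw [hau, heq] at this
    exact this.not_gt hc.lt

section Flat

variable {y e : V} {ε r c c' : ℝ}

theorem inner_orthogonal_eq_zero (q : (ℝ ∙ e)ᗮ) : ⟪(q : V), e⟫ = 0 :=
  Submodule.inner_left_of_mem_orthogonal (Submodule.mem_span_singleton_self e) q.2

theorem inner_smul_add_orthogonal (he : ‖e‖ = 1) (t : ℝ) (q : (ℝ ∙ e)ᗮ) :
    ⟪t • e + (q : V), e⟫ = t := by
  rw [inner_add_left, inner_orthogonal_eq_zero, inner_smul_left, real_inner_self_eq_norm_sq, he]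
  simp

theorem norm_smul_add_orthogonal_le (he : ‖e‖ = 1) (t : ℝ) (q : (ℝ ∙ e)ᗮ) :
    ‖t • e + (q : V)‖ ≤ |t| + ‖q‖ := by
  refine (norm_add_le _ _).trans ?_
  rw [norm_smul, he, mul_one, Real.norm_eq_abs, Submodule.coe_norm]

/-- The projection to the hyperplane through `y` with normal `e`. -/
def hyperProj (y e x : V) : (ℝ ∙ e)ᗮ := (ℝ ∙ e)ᗮ.orthogonalProjectionOnto (x - y)

theorem continuous_hyperProj : Continuous (hyperProj y e) := by
  unfold hyperProj; fun_prop

theorem hyperProj_cylinder (t : ℝ) (q : (ℝ ∙ e)ᗮ) :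
    hyperProj y e (y + (t • e + (q : V))) = q := by
  unfold hyperProj
  rw [add_sub_cancel_left, map_add, map_smul,
    Submodule.orthogonalProjectionOnto_mem_subspace_eq_self]
  have : (ℝ ∙ e)ᗮ.orthogonalProjectionOnto e = 0 := by
    rw [Submodule.orthogonalProjectionOnto_eq_zero_iff]
    exact Submodule.le_orthogonal_orthogonal _ (Submodule.mem_span_singleton_self e)
  rw [this, smul_zero, zero_add]

theorem cylinder_hyperProj (he : ‖e‖ = 1) (x : V) :
    y + (⟪x - y, e⟫ • e + (hyperProj y e x : V)) = x := by
  have h1 := (ℝ ∙ e).starProjection_add_starProjection_orthogonal (x - y)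
  have h2 : (ℝ ∙ e).starProjection (x - y) = ⟪x - y, e⟫ • e := by
    rw [Submodule.starProjection_unit_singleton ℝ he, real_inner_comm]
  rw [h2] at h1
  change y + (⟪x - y, e⟫ • e + (ℝ ∙ e)ᗮ.starProjection (x - y)) = x
  rw [h1]; abel

theorem norm_hyperProj_sub_le (x x' : V) : ‖hyperProj y e x - hyperProj y e x'‖ ≤ ‖x - x'‖ := by
  unfold hyperProj
  rw [← map_sub, sub_sub_sub_cancel_right]
  exact Submodule.norm_orthogonalProjectionOnto_apply_le _ _

theorem norm_sub_le_hyperProj (he : ‖e‖ = 1) (x x' : V) :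
    ‖x - x'‖ ≤ |⟪x - x', e⟫| + ‖hyperProj y e x - hyperProj y e x'‖ := by
  have h1 := cylinder_hyperProj (y := y) he x
  have h2 := cylinder_hyperProj (y := y) he x'
  have h3 : x - x' = ⟪x - x', e⟫ • e +
      ((hyperProj y e x - hyperProj y e x' : (ℝ ∙ e)ᗮ) : V) := by
    rw [Submodule.coe_sub, show ⟪x - x', e⟫ = ⟪x - y, e⟫ - ⟪x' - y, e⟫ by
      rw [← inner_sub_left, sub_sub_sub_cancel_right], sub_smul]
    nth_rewrite 1 [← h1, ← h2]
    abel
  calc ‖x - x'‖ = ‖⟪x - x', e⟫ • e + ((hyperProj y e x - hyperProj y e x' : (ℝ ∙ e)ᗮ) : V)‖ := by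
        rw [← h3]
    _ ≤ _ := norm_smul_add_orthogonal_le he _ _

variable (hf : IsFlatAt v C u y e ε r c c') (hε : ε ≤ 1 / 4)
include hf hε

theorem IsFlatAt.cylinder_mem {t : ℝ} (ht : |t| ≤ r / 4) {q : (ℝ ∙ e)ᗮ} (hq : ‖q‖ < r / 8) :
    y + (t • e + (q : V)) ∈ ball y r := by
  have hr := hf.pos
  rw [mem_ball, dist_eq_norm, add_sub_cancel_left]
  have := norm_smul_add_orthogonal_le hf.unit t q
  linarith

theorem IsFlatAt.above_cylinder {t : ℝ} (ht : t ≤ r / 4) (ht' : r / 8 ≤ t) {x : V} {q : (ℝ ∙ e)ᗮ}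
    (hq : ‖q‖ < r / 8) (hx : dist x (y + (t • e + (q : V))) < r / 64) :
    x ∈ ball y r ∧ x ∉ C ∧ u x = c' := by
  have hr := hf.pos
  rw [dist_eq_norm] at hx
  have h1 : x - y = (x - (y + (t • e + (q : V)))) + (t • e + (q : V)) := by abel
  have h2 := norm_smul_add_orthogonal_le hf.unit t q
  rw [abs_of_nonneg (by linarith)] at h2
  have h3 : ‖x - y‖ ≤ r / 64 + (t + ‖q‖) := by
    rw [h1]; exact (norm_add_le _ _).trans (by linarith)
  have h4 : t - r / 64 ≤ ⟪x - y, e⟫ := by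
    rw [h1, inner_add_left, inner_smul_add_orthogonal hf.unit]
    have := (abs_le.1 (abs_real_inner_le_norm (x - (y + (t • e + (q : V)))) e)).1
    rw [hf.unit, mul_one] at this
    linarith
  have hxr : x ∈ ball y r := by rw [mem_ball, dist_eq_norm]; linarith
  refine ⟨hxr, hf.above x hxr ?_⟩
  have : ε * ‖x - y‖ ≤ 1 / 4 * ‖x - y‖ := by gcongr
  linarith

theorem IsFlatAt.below_cylinder {t : ℝ} (ht : t ≤ r / 4) (ht' : r / 8 ≤ t) {x : V} {q : (ℝ ∙ e)ᗮ}
    (hq : ‖q‖ < r / 8) (hx : dist x (y + ((-t) • e + (q : V))) < r / 64) :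
    x ∈ ball y r ∧ x ∉ C ∧ u x = c := by
  have hr := hf.pos
  rw [dist_eq_norm] at hx
  have h1 : x - y = (x - (y + ((-t) • e + (q : V)))) + ((-t) • e + (q : V)) := by abel
  have h2 := norm_smul_add_orthogonal_le hf.unit (-t) q
  rw [abs_neg, abs_of_nonneg (by linarith)] at h2
  have h3 : ‖x - y‖ ≤ r / 64 + (t + ‖q‖) := by
    rw [h1]; exact (norm_add_le _ _).trans (by linarith)
  have h4 : t - r / 64 ≤ ⟪y - x, e⟫ := by
    rw [← neg_sub x y, inner_neg_left, h1, inner_add_left, inner_smul_add_orthogonal hf.unit]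
    have := (abs_le.1 (abs_real_inner_le_norm (x - (y + ((-t) • e + (q : V)))) e)).2
    rw [hf.unit, mul_one] at this
    linarith
  have hxr : x ∈ ball y r := by rw [mem_ball, dist_eq_norm]; linarith
  refine ⟨hxr, hf.below x hxr ?_⟩
  have : ε * ‖x - y‖ ≤ 1 / 4 * ‖x - y‖ := by gcongr
  linarith

/-- The cone meets every vertical segment of the cylinder, since `u` changes along it. -/
theorem IsFlatAt.exists_mem_cone (hu : LocConst C u) {q : (ℝ ∙ e)ᗮ} (hq : ‖q‖ < r / 8) :
    ∃ t : ℝ, |t| < r / 4 ∧ y + (t • e + (q : V)) ∈ C := by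
  have hr := hf.pos
  have hr64 : 0 < r / 64 := by positivity
  by_contra! hcon
  obtain ⟨-, hC1, hu1⟩ := hf.above_cylinder hε le_rfl (by linarith) hq
    (x := y + ((r / 4) • e + (q : V))) (by rwa [dist_self])
  obtain ⟨-, hC2, hu2⟩ := hf.below_cylinder hε le_rfl (by linarith) hq
    (x := y + ((-(r / 4)) • e + (q : V))) (by rwa [dist_self])
  have hpre : IsPreconnected ((fun t : ℝ => y + (t • e + (q : V))) '' Icc (-(r / 4)) (r / 4)) :=
    isPreconnected_Icc.image _ (by fun_prop)
  have := hu.eq_of_isPreconnected hpre ?_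
    ⟨-(r / 4), left_mem_Icc.2 (by linarith), rfl⟩ ⟨r / 4, right_mem_Icc.2 (by linarith), rfl⟩
  · rw [hu1, hu2] at this
    exact hf.lt.ne this
  · rintro _ ⟨t, ht, rfl⟩
    refine ⟨hf.ball_subset (hf.cylinder_mem hε (abs_le.2 ht) hq), ?_⟩
    rcases (abs_le.2 ht).lt_or_eq with hlt | heq
    · exact hcon t hlt
    · rcases eq_or_eq_neg_of_abs_eq heq with rfl | rfl
      · exact hC1
      · exact hC2

/-- The vertical flux of `v κ` through the cylinder over a function `f` is the jump times the
integral of `f`. -/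
theorem IsFlatAt.jump_mul_integral [IsFiniteMeasure κ] (h : IsCalibratingField v W κ C)
    (hu : IsJumpFunction v κ C u) {f : (ℝ ∙ e)ᗮ → ℝ} (hfc : Continuous f)
    (hfs : tsupport f ⊆ closedBall 0 (r / 16)) :
    (c' - c) * ∫ q, f q =
      ∫ z, (if |⟪z - y, e⟫| < r / 4 then f (hyperProj y e z) else 0) * ⟪v z, e⟫ ∂κ := by
  have hr := hf.pos
  have hcs : HasCompactSupport f :=
    (isCompact_closedBall (0 : (ℝ ∙ e)ᗮ) (r / 16)).of_isClosed_subset (isClosed_tsupport _) hfs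
  obtain ⟨K, hK⟩ := hcs.exists_bound_of_continuous hfc
  have hK0 : 0 ≤ K := (norm_nonneg _).trans (hK 0)
  set g : V → ℝ := fun z => if |⟪z - y, e⟫| < r / 4 then f (hyperProj y e z) else 0 with hg
  have hopen : IsOpen {z : V | |⟪z - y, e⟫| < r / 4} := isOpen_lt (by fun_prop) continuous_const
  have hgm : Measurable g := Measurable.ite hopen.measurableSet
    (hfc.comp continuous_hyperProj).measurable measurable_const
  have hgK : ∀ z, |g z| ≤ K := by
    intro z
    rw [hg]; dsimp only
    split_ifs
    · exact hK _
    · simpa using hK0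
  -- the cone does not meet the top and the bottom of the cylinder
  have hgcont : ∀ᵐ z ∂κ, ContinuousAt g z := by
    filter_upwards [measure_eq_zero_iff_ae_notMem.1 h.carrier_cone] with z hzC
    rw [mem_compl_iff, not_not] at hzC
    by_cases hs : hyperProj y e z ∈ closedBall (0 : (ℝ ∙ e)ᗮ) (r / 16)
    · have hq : ‖hyperProj y e z‖ < r / 8 := by
        rw [mem_closedBall_zero_iff] at hs; linarith
      rcases lt_trichotomy |⟪z - y, e⟫| (r / 4) with hlt | heq | hgt
      · refine (hfc.comp (continuous_hyperProj (y := y))).continuousAt.congr ?_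
        filter_upwards [hopen.mem_nhds hlt] with x hx
        exact (if_pos hx).symm
      · exfalso
        have hr64 : 0 < r / 64 := by positivity
        have hz := cylinder_hyperProj (y := y) hf.unit z
        rcases eq_or_eq_neg_of_abs_eq heq with h1 | h1 <;> rw [h1] at hz
        · exact (hf.above_cylinder hε le_rfl (by linarith) hq (x := z)
            (by rwa [hz, dist_self])).2.1 hzC
        · exact (hf.below_cylinder hε le_rfl (by linarith) hq (x := z)
            (by rwa [hz, dist_self])).2.1 hzC
      · refine (continuousAt_const (y := (0 : ℝ))).congr ?_
        have : IsOpen {z : V | r / 4 < |⟪z - y, e⟫|} := isOpen_lt continuous_const (by fun_prop)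
        filter_upwards [this.mem_nhds hgt] with x hx
        exact (if_neg (not_lt.2 (le_of_lt hx))).symm
    · refine (continuousAt_const (y := (0 : ℝ))).congr ?_
      have : IsOpen {z : V | hyperProj y e z ∈ (closedBall (0 : (ℝ ∙ e)ᗮ) (r / 16))ᶜ} :=
        isClosed_closedBall.isOpen_compl.preimage continuous_hyperProj
      filter_upwards [this.mem_nhds hs] with x hx
      have : f (hyperProj y e x) = 0 := image_eq_zero_of_notMem_tsupport fun hx' => hx (hfs hx')
      rw [hg]; dsimp only
      rw [this, ite_self]
  refine tendsto_nhds_unique ?_ (h.tendsto_integral_mul_mollify hgm hgK hgcont e)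
  refine tendsto_const_nhds.congr' ?_
  filter_upwards [hu.eventually_isPotential, (tendsto_bump_rOut V).eventually
    (gt_mem_nhds (show (0 : ℝ) < r / 64 by positivity))] with k hk hkr
  have hmc : Continuous (mollify (bump V k) κ v) := (contDiff_mollify _ h.integrable).continuous
  obtain ⟨Km, hKm⟩ : ∃ Km : ℝ, ∀ x, ‖mollify (bump V k) κ v x‖ ≤ Km := by
    obtain ⟨K', hK0', hK'⟩ := exists_bound_normed (bump V k)
    refine ⟨K' * κ.real univ, fun x => ?_⟩
    have := norm_integral_le_of_norm_le (integrable_const K') (Eventually.of_forall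
      (fun z => ?_) : ∀ᵐ z ∂κ, ‖(bump V k).normed volume (x - z) • v z‖ ≤ K')
    · simpa [mul_comm, mollify] using this
    · rw [norm_smul]
      exact (mul_le_of_le_one_right (norm_nonneg _) (h.norm_le z)).trans (hK' _)
  -- pass to cylindrical coordinates, and integrate along the vertical segments first
  have hmp := measurePreserving_cylinder hf.unit y
  have hme : MeasurableEmbedding (fun p : ℝ × (ℝ ∙ e)ᗮ => y + (p.1 • e + (p.2 : V))) := by
    refine Continuous.measurableEmbedding (by fun_prop) fun p p' hpp => ?_
    have h1 := congrArg (hyperProj y e) hpp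
    have h2 := congrArg (fun x => ⟪x - y, e⟫) hpp
    simp only [hyperProj_cylinder, add_sub_cancel_left,
      inner_smul_add_orthogonal hf.unit] at h1 h2
    exact Prod.ext h2 h1
  rw [← hmp.integral_comp hme]
  have hform : ∀ p : ℝ × (ℝ ∙ e)ᗮ, g (y + (p.1 • e + (p.2 : V))) *
      ⟪mollify (bump V k) κ v (y + (p.1 • e + (p.2 : V))), e⟫ =
      (Ioo (-(r / 4)) (r / 4)).indicator (fun t => f p.2 *
        ⟪mollify (bump V k) κ v (y + (t • e + (p.2 : V))), e⟫) p.1 := by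
    intro p
    rw [hg]; dsimp only
    rw [hyperProj_cylinder, add_sub_cancel_left, inner_smul_add_orthogonal hf.unit]
    by_cases hp : |p.1| < r / 4
    · rw [if_pos hp, indicator_of_mem (show p.1 ∈ Ioo _ _ from abs_lt.1 hp)]
    · rw [if_neg hp, indicator_of_notMem (s := Ioo _ _) fun h' => hp (abs_lt.2 h'), zero_mul]
  simp_rw [hform]
  have hint : Integrable (fun p : ℝ × (ℝ ∙ e)ᗮ =>
      (Ioo (-(r / 4)) (r / 4)).indicator (fun t => f p.2 *
        ⟪mollify (bump V k) κ v (y + (t • e + (p.2 : V))), e⟫) p.1)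
      ((volume : Measure ℝ).prod volume) := by
    have h1 : Integrable (fun p : ℝ × (ℝ ∙ e)ᗮ =>
        (Ioo (-(r / 4)) (r / 4)).indicator (fun _ => (1 : ℝ)) p.1 * f p.2)
        ((volume : Measure ℝ).prod volume) :=
      Integrable.mul_prod (f := (Ioo (-(r / 4)) (r / 4)).indicator (fun _ => (1 : ℝ)))
        ((integrable_indicator_iff measurableSet_Ioo).2 (integrableOn_const (by simp)))
        (hfc.integrable_of_hasCompactSupport hcs)
    have hc2 : Continuous fun p : ℝ × (ℝ ∙ e)ᗮ =>
        ⟪mollify (bump V k) κ v (y + (p.1 • e + (p.2 : V))), e⟫ := by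
      have : Continuous fun p : ℝ × (ℝ ∙ e)ᗮ =>
        mollify (bump V k) κ v (y + (p.1 • e + (p.2 : V))) := hmc.comp (by fun_prop)
      exact this.inner continuous_const
    refine (h1.mul_bdd (c := Km * ‖e‖) hc2.aestronglyMeasurable
      (Eventually.of_forall fun p => (norm_inner_le_norm _ _).trans
        (mul_le_mul_of_nonneg_right (hKm _) (norm_nonneg _)))).congr
        (Eventually.of_forall fun p => ?_)
    by_cases hp : p.1 ∈ Ioo (-(r / 4)) (r / 4)
    · simp only [indicator_of_mem hp, one_mul]
    · simp only [indicator_of_notMem hp, zero_mul]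
  rw [integral_prod_symm _ hint, ← integral_const_mul]
  refine integral_congr_ae (Eventually.of_forall fun q => ?_)
  simp only
  rw [integral_indicator measurableSet_Ioo, integral_const_mul, mul_comm]
  by_cases hq : q ∈ closedBall (0 : (ℝ ∙ e)ᗮ) (r / 16)
  · congr 1
    have hq8 : ‖q‖ < r / 8 := by rw [mem_closedBall_zero_iff] at hq; linarith
    rw [← integral_Ioc_eq_integral_Ioo, ← intervalIntegral.integral_of_le (by linarith)]
    have hval : ∀ t, |t| ≤ r / 4 → ‖y + (t • e + (q : V))‖ + (bump V k).rOut < 1 := by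
      intro t ht
      have h1 := norm_smul_add_orthogonal_le hf.unit t q
      refine norm_add_lt_one (s := r / 2) (bump V k).rOut_pos.le (by linarith)
        (bump_rOut_lt_one k) ((ball_subset_ball' ?_).trans hf.ball_subset)
      rw [dist_eq_norm, add_sub_cancel_left]
      linarith
    have hder : ∀ t ∈ uIcc (-(r / 4)) (r / 4),
        HasDerivAt (fun t : ℝ => average (bump V k) u (y + (t • e + (q : V))))
          ⟪mollify (bump V k) κ v (y + (t • e + (q : V))), e⟫ t := by
      intro t ht
      rw [uIcc_of_le (by linarith)] at ht
      have h4 : HasDerivAt (fun t : ℝ => y + (t • e + (q : V))) e t := by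
        simpa using (((hasDerivAt_id t).smul_const e).add_const (q : V)).const_add y
      exact (hk _ (hval t (abs_le.2 ht))).comp_hasDerivAt t h4
    have hci : Continuous fun t : ℝ => ⟪mollify (bump V k) κ v (y + (t • e + (q : V))), e⟫ := by
      have : Continuous fun t : ℝ => mollify (bump V k) κ v (y + (t • e + (q : V))) :=
        hmc.comp (by fun_prop)
      exact this.inner continuous_const
    -- the ends of the segment lie in the regions where `u` is equal to `c'` and to `c`
    rw [intervalIntegral.integral_eq_sub_of_hasDerivAt hder (hci.intervalIntegrable _ _)]
    congr 1
    · refine (integral_normed_mul_eq_of_const fun z hz => ?_).symm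
      rw [mem_closedBall] at hz
      exact (hf.above_cylinder hε le_rfl (by linarith) hq8 (hz.trans_lt hkr)).2.2
    · refine (integral_normed_mul_eq_of_const fun z hz => ?_).symm
      rw [mem_closedBall] at hz
      exact (hf.below_cylinder hε le_rfl (by linarith) hq8 (hz.trans_lt hkr)).2.2
  · rw [image_eq_zero_of_notMem_tsupport fun hq' => hq (hfs hq'), zero_mul, zero_mul]

end Flat

end Cylinder

/-! ### Multiplicity and jump heights -/

section UnitJump

variable {V : Type*} [NormedAddCommGroup V] [InnerProductSpace ℝ V] [FiniteDimensional ℝ V]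
  [MeasurableSpace V] [BorelSpace V]

variable {v : V → V} {W : Set V} {κ : Measure V} {C : Set V} {u : V → ℝ}
  {y e : V} {ε r c c' : ℝ}

theorem euclideanHausdorffMeasure_image_le {X Y : Type*} [MetricSpace X] [MetricSpace Y]
    [MeasurableSpace X] [BorelSpace X] [MeasurableSpace Y] [BorelSpace Y] {K : NNReal} {f : X → Y}
    {s : Set X} (hf : LipschitzOnWith K f s) (d : ℕ) :
    μHE[d] (f '' s) ≤ (K : ℝ≥0∞) ^ d * μHE[d] s := by
  have h := hf.hausdorffMeasure_image_le (d := d) (Nat.cast_nonneg d)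
  rw [ENNReal.rpow_natCast] at h
  simp_rw [Measure.euclideanHausdorffMeasure_def, Measure.smul_apply, ENNReal.smul_def,
    smul_eq_mul]
  rw [mul_left_comm]
  gcongr

/-- The part over `A` of the cylinder of half height `r / 4` around `y` with axis `e`. -/
def cylinder (y e : V) (r : ℝ) (A : Set (ℝ ∙ e)ᗮ) : Set V :=
  {z | |⟪z - y, e⟫| < r / 4 ∧ hyperProj y e z ∈ A}

theorem measurableSet_cylinder {A : Set (ℝ ∙ e)ᗮ} (hA : MeasurableSet A) :
    MeasurableSet (cylinder y e r A) :=
  (isOpen_lt (f := fun z : V => |⟪z - y, e⟫|) (by fun_prop) continuous_const).measurableSet.inter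
    (continuous_hyperProj.measurable hA)

theorem cylinder_mem_nhds (hr : 0 < r) {A : Set (ℝ ∙ e)ᗮ} (hA : A ∈ 𝓝 0) :
    cylinder y e r A ∈ 𝓝 y := by
  refine inter_mem ((isOpen_lt (f := fun z : V => |⟪z - y, e⟫|) (by fun_prop)
    continuous_const).mem_nhds ?_) (continuous_hyperProj.continuousAt ?_)
  · simpa using hr
  · simpa [hyperProj] using hA

section Flat

variable (hf : IsFlatAt v C u y e ε r c c') (hε : ε ≤ 1 / 4)
include hf

theorem IsFlatAt.cylinder_subset {A : Set (ℝ ∙ e)ᗮ} (hA : A ⊆ closedBall 0 (r / 16)) :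
    cylinder y e r A ⊆ ball y r := by
  intro z hz
  have hr := hf.pos
  have h1 := norm_smul_add_orthogonal_le hf.unit ⟪z - y, e⟫ (hyperProj y e z)
  have h2 := cylinder_hyperProj (y := y) hf.unit z
  have h3 := mem_closedBall_zero_iff.1 (hA hz.2)
  rw [← h2, mem_ball, dist_eq_norm, add_sub_cancel_left]
  linarith [hz.1]

theorem IsFlatAt.inner_ge {z : V} (hz : z ∈ ball y r) : 1 - ε ≤ ⟪v z, e⟫ := by
  have h1 : ⟪v z, e⟫ = 1 + ⟪v z - e, e⟫ := by
    rw [inner_sub_left, real_inner_self_eq_norm_sq, hf.unit]; ring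
  have h2 := (abs_le.1 (abs_real_inner_le_norm (v z - e) e)).1
  rw [hf.unit, mul_one] at h2
  linarith [hf.near z hz]

/-- The projection of the cone to the hyperplane has a Lipschitz inverse. -/
theorem IsFlatAt.norm_sub_le {p p' : V} (hp : p ∈ C) (hpr : p ∈ ball y r) (hp' : p' ∈ C)
    (hpr' : p' ∈ ball y r) :
    (1 - ε) * ‖p - p'‖ ≤ ‖hyperProj y e p - hyperProj y e p'‖ := by
  have h1 := norm_sub_le_hyperProj (y := y) hf.unit p p'
  have h2 := hf.lip p hp hpr p' hp' hpr'
  have h3 := hf.lip p' hp' hpr' p hp hpr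
  have h4 : |⟪p - p', e⟫| ≤ ε * ‖p - p'‖ := by
    rw [abs_le]
    rw [norm_sub_rev, ← neg_sub, inner_neg_left] at h2
    constructor <;> linarith
  linarith

include hε

theorem IsFlatAt.injOn {A : Set (ℝ ∙ e)ᗮ} (hA : A ⊆ closedBall 0 (r / 16)) :
    InjOn (hyperProj y e) (C ∩ cylinder y e r A) := by
  intro p hp p' hp' heq
  have := hf.norm_sub_le hp.1 (hf.cylinder_subset hA hp.2) hp'.1 (hf.cylinder_subset hA hp'.2)
  rw [heq, sub_self, norm_zero] at this
  have h0 : ‖p - p'‖ ≤ 0 := by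
    by_contra hcon
    have : 0 < (1 - ε) * ‖p - p'‖ := mul_pos (by linarith) (not_le.1 hcon)
    linarith
  exact sub_eq_zero.1 (norm_le_zero_iff.1 h0)

theorem IsFlatAt.image_eq (hu : LocConst C u) {A : Set (ℝ ∙ e)ᗮ}
    (hA : A ⊆ closedBall 0 (r / 16)) : hyperProj y e '' (C ∩ cylinder y e r A) = A := by
  refine Subset.antisymm ?_ fun q hq => ?_
  · rintro _ ⟨z, hz, rfl⟩
    exact hz.2.2
  · have hq' := mem_closedBall_zero_iff.1 (hA hq)
    obtain ⟨t, ht, htC⟩ := hf.exists_mem_cone hε hu (q := q) (by linarith [hf.pos])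
    refine ⟨_, ⟨htC, ?_, ?_⟩, hyperProj_cylinder t q⟩
    · rwa [add_sub_cancel_left, inner_smul_add_orthogonal hf.unit]
    · rwa [hyperProj_cylinder]

/-- The projection to the hyperplane is a contraction and covers `A`. -/
theorem IsFlatAt.volume_le (hu : LocConst C u) {d : ℕ} (hd : Module.finrank ℝ V = d + 1)
    {A : Set (ℝ ∙ e)ᗮ} (hA : A ⊆ closedBall 0 (r / 16)) :
    volume A ≤ μHE[d] (C ∩ cylinder y e r A) := by
  have : Fact (Module.finrank ℝ V = d + 1) := ⟨hd⟩
  have he : e ≠ 0 := by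
    rintro rfl
    simpa using hf.unit
  have hfr : Module.finrank ℝ (ℝ ∙ e)ᗮ = d := Submodule.finrank_orthogonal_span_singleton he
  have hl : LipschitzOnWith 1 (hyperProj y e) (C ∩ cylinder y e r A) := by
    refine LipschitzOnWith.of_dist_le_mul fun p _ p' _ => ?_
    rw [NNReal.coe_one, one_mul, dist_eq_norm, dist_eq_norm]
    exact norm_hyperProj_sub_le p p'
  have := euclideanHausdorffMeasure_image_le hl d
  rw [hf.image_eq hε hu hA] at this
  rw [← InnerProductSpace.euclideanHausdorffMeasure_eq_volume, hfr]
  simpa using this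

/-- A graph of small slope has almost the measure of its projection. -/
theorem IsFlatAt.measure_le (hu : LocConst C u) {d : ℕ} (hd : Module.finrank ℝ V = d + 1)
    {A : Set (ℝ ∙ e)ᗮ} (hA : A ⊆ closedBall 0 (r / 16)) :
    μHE[d] (C ∩ cylinder y e r A) ≤ ENNReal.ofReal (1 - ε)⁻¹ ^ d * volume A := by
  have : Fact (Module.finrank ℝ V = d + 1) := ⟨hd⟩
  have he : e ≠ 0 := by
    rintro rfl
    simpa using hf.unit
  have hfr : Module.finrank ℝ (ℝ ∙ e)ᗮ = d := Submodule.finrank_orthogonal_span_singleton he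
  have himg := hf.image_eq hε hu hA
  have hl : LipschitzOnWith (1 - ε)⁻¹.toNNReal
      (Function.invFunOn (hyperProj y e) (C ∩ cylinder y e r A)) A := by
    refine LipschitzOnWith.of_dist_le_mul fun q hq q' hq' => ?_
    rw [← himg] at hq hq'
    have h1 := Function.invFunOn_mem hq
    have h2 := Function.invFunOn_eq hq
    have h1' := Function.invFunOn_mem hq'
    have h2' := Function.invFunOn_eq hq'
    have h3 := hf.norm_sub_le h1.1 (hf.cylinder_subset hA h1.2) h1'.1
      (hf.cylinder_subset hA h1'.2)
    rw [h2, h2'] at h3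
    rw [dist_eq_norm, dist_eq_norm, Real.coe_toNNReal _ (inv_nonneg.2 (by linarith)),
      ← div_eq_inv_mul, le_div_iff₀' (by linarith)]
    exact h3
  have h4 := euclideanHausdorffMeasure_image_le hl d
  have h5 : Function.invFunOn (hyperProj y e) (C ∩ cylinder y e r A) '' A =
      C ∩ cylinder y e r A := by
    nth_rewrite 2 [← himg]
    exact (hf.injOn hε hA).invFunOn_image Subset.rfl
  rw [h5] at h4
  rw [← InnerProductSpace.euclideanHausdorffMeasure_eq_volume, hfr]
  exact h4

variable [IsFiniteMeasure κ] (h : IsCalibratingField v W κ C) (hu : IsJumpFunction v κ C u)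
include h hu

/-- The flux identity `IsFlatAt.jump_mul_integral`, extended from continuous functions to measurable
sets. -/
theorem IsFlatAt.jump_mul_volume {A : Set (ℝ ∙ e)ᗮ} (hAm : MeasurableSet A)
    (hA : A ⊆ closedBall 0 (r / 32)) : ENNReal.ofReal (c' - c) * volume A =
      ∫⁻ z in cylinder y e r A, ENNReal.ofReal ⟪v z, e⟫ ∂κ := by
  have hr := hf.pos
  set η : (ℝ ∙ e)ᗮ → ℝ := fun q => max 0 (min 1 (2 - 32 * ‖q‖ / r)) with hη
  have hηc : Continuous η := by fun_prop
  have hη0 : ∀ q, 0 ≤ η q := fun q => le_max_left _ _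
  have hη1 : ∀ q, η q ≤ 1 := fun q => max_le zero_le_one (min_le_left _ _)
  have hηs : tsupport η ⊆ closedBall 0 (r / 16) := by
    refine closure_minimal (fun q hq => ?_) isClosed_closedBall
    by_contra hcon
    rw [mem_closedBall_zero_iff, not_le] at hcon
    refine hq (max_eq_left ((min_le_right _ _).trans ?_))
    rw [sub_nonpos, le_div_iff₀ hr]
    linarith
  have hηA : ∀ q ∈ closedBall (0 : (ℝ ∙ e)ᗮ) (r / 32), η q = 1 := by
    intro q hq
    rw [mem_closedBall_zero_iff] at hq
    have : 32 * ‖q‖ / r ≤ 1 := by rw [div_le_one hr]; linarith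
    rw [hη]; dsimp only
    rw [min_eq_left (by linarith), max_eq_right zero_le_one]
  have hηi : Integrable η := hηc.integrable_of_hasCompactSupport
    ((isCompact_closedBall (0 : (ℝ ∙ e)ᗮ) (r / 16)).of_isClosed_subset (isClosed_tsupport _) hηs)
  have hJ : 0 < c' - c := sub_pos.2 hf.lt
  set S : Set V := {z | |⟪z - y, e⟫| < r / 4} with hS
  have hSm : MeasurableSet S :=
    (isOpen_lt (f := fun z : V => |⟪z - y, e⟫|) (by fun_prop) continuous_const).measurableSet
  have hpos : ∀ z ∈ S, 0 ≤ η (hyperProj y e z) * ⟪v z, e⟫ := by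
    intro z hz
    by_cases hq : hyperProj y e z ∈ closedBall (0 : (ℝ ∙ e)ᗮ) (r / 16)
    · have h1 := hf.inner_ge (hf.cylinder_subset Subset.rfl ⟨hz, hq⟩)
      exact mul_nonneg (hη0 _) (by linarith)
    · rw [image_eq_zero_of_notMem_tsupport fun h' => hq (hηs h'), zero_mul]
  set μ₁ : Measure (ℝ ∙ e)ᗮ := volume.withDensity fun q => ENNReal.ofReal ((c' - c) * η q) with hμ₁
  set μ₂ : Measure (ℝ ∙ e)ᗮ := ((κ.restrict S).withDensity fun z =>
    ENNReal.ofReal (η (hyperProj y e z) * ⟪v z, e⟫)).map (hyperProj y e) with hμ₂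
  have hdm : Measurable fun z => ENNReal.ofReal (η (hyperProj y e z) * ⟪v z, e⟫) :=
    ((hηc.comp continuous_hyperProj).measurable.mul
      (h.measurable.inner measurable_const)).ennreal_ofReal
  have hηm : Measurable fun q => ENNReal.ofReal ((c' - c) * η q) :=
    (hηc.measurable.const_mul _).ennreal_ofReal
  have : IsFiniteMeasure μ₁ := isFiniteMeasure_withDensity_ofReal (hηi.const_mul _).2
  have : IsFiniteMeasure ((κ.restrict S).withDensity fun z =>
      ENNReal.ofReal (η (hyperProj y e z) * ⟪v z, e⟫)) := by
    refine isFiniteMeasure_withDensity_ofReal (Integrable.hasFiniteIntegral (μ := κ.restrict S) ?_)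
    refine (h.integrable_inner e).restrict.bdd_mul (c := 1)
      (hηc.comp continuous_hyperProj).aestronglyMeasurable (Eventually.of_forall fun z => ?_)
    rw [Real.norm_of_nonneg (hη0 _)]
    exact hη1 _
  have : IsFiniteMeasure μ₂ := by rw [hμ₂]; infer_instance
  -- the two finite measures have the same integrals of continuous functions
  have heq : μ₁ = μ₂ := by
    refine ext_of_forall_integral_eq_of_IsFiniteMeasure fun f => ?_
    have hfη : tsupport (fun q => η q * f q) ⊆ closedBall 0 (r / 16) :=
      (tsupport_mul_subset_left).trans hηs
    have key := hf.jump_mul_integral hε h hu (hηc.mul f.continuous) hfη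
    simp only [Pi.mul_apply] at key
    rw [hμ₁, integral_withDensity_eq_integral_toReal_smul hηm
      (Eventually.of_forall fun _ => ENNReal.ofReal_lt_top), hμ₂,
      integral_map continuous_hyperProj.aemeasurable f.continuous.aestronglyMeasurable,
      integral_withDensity_eq_integral_toReal_smul hdm
      (Eventually.of_forall fun _ => ENNReal.ofReal_lt_top)]
    have h1 : ∀ q, (ENNReal.ofReal ((c' - c) * η q)).toReal • f q = (c' - c) * (η q * f q) := by
      intro q
      rw [ENNReal.toReal_ofReal (mul_nonneg hJ.le (hη0 q)), smul_eq_mul, mul_assoc]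
    simp_rw [h1]
    rw [integral_const_mul, key, ← integral_indicator hSm]
    refine integral_congr_ae (Eventually.of_forall fun z => ?_)
    by_cases hz : z ∈ S
    · have hz' : |⟪z - y, e⟫| < r / 4 := hz
      simp only [indicator_of_mem hz, if_pos hz']
      rw [ENNReal.toReal_ofReal (hpos z hz), smul_eq_mul]
      ring
    · have hz' : ¬|⟪z - y, e⟫| < r / 4 := hz
      simp only [indicator_of_notMem hz, if_neg hz', zero_mul]
  have h1 : μ₁ A = ENNReal.ofReal (c' - c) * volume A := by
    rw [hμ₁, withDensity_apply _ hAm, ← setLIntegral_const]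
    refine setLIntegral_congr_fun hAm fun q hq => ?_
    simp only [hηA q (hA hq), mul_one]
  have h2 : μ₂ A = ∫⁻ z in cylinder y e r A, ENNReal.ofReal ⟪v z, e⟫ ∂κ := by
    rw [hμ₂, Measure.map_apply continuous_hyperProj.measurable hAm,
      withDensity_apply _ (continuous_hyperProj.measurable hAm),
      Measure.restrict_restrict (continuous_hyperProj.measurable hAm), inter_comm]
    refine setLIntegral_congr_fun (measurableSet_cylinder hAm) fun z hz => ?_
    simp only [hηA _ (hA hz.2), one_mul]
  rw [← h1, ← h2, heq]

/-- The flux is at most the mass, as `v` has norm at most one. -/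
theorem IsFlatAt.jump_mul_volume_le {A : Set (ℝ ∙ e)ᗮ} (hAm : MeasurableSet A)
    (hA : A ⊆ closedBall 0 (r / 32)) :
    ENNReal.ofReal (c' - c) * volume A ≤ κ (cylinder y e r A) := by
  rw [hf.jump_mul_volume hε h hu hAm hA, ← setLIntegral_one]
  refine lintegral_mono fun z => ?_
  refine ENNReal.ofReal_le_one.2 ((real_inner_le_norm _ _).trans ?_)
  rw [hf.unit, mul_one]
  exact h.norm_le z

/-- The flux is almost the mass, as `v` is almost vertical. -/
theorem IsFlatAt.le_jump_mul_volume {A : Set (ℝ ∙ e)ᗮ} (hAm : MeasurableSet A)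
    (hA : A ⊆ closedBall 0 (r / 32)) :
    ENNReal.ofReal (1 - ε) * κ (cylinder y e r A) ≤ ENNReal.ofReal (c' - c) * volume A := by
  rw [hf.jump_mul_volume hε h hu hAm hA, ← setLIntegral_const]
  refine setLIntegral_mono' (measurableSet_cylinder hAm) fun z hz => ?_
  refine ENNReal.ofReal_le_ofReal (hf.inner_ge (hf.cylinder_subset ?_ hz))
  exact hA.trans (closedBall_subset_closedBall (by linarith [hf.pos]))

/-- Almost all points of the cone near `y` belong to each set that carries `κ`. -/
theorem IsFlatAt.measure_diff_eq_zero (hC : IsTwoSidedCone C) {d : ℕ}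
    (hd : Module.finrank ℝ V = d + 1) {Z : Set V} (hZ : MeasurableSet Z) (hκ : κ Zᶜ = 0) :
    μHE[d] ((C ∩ cylinder y e r (closedBall 0 (r / 32))) \ Z) = 0 := by
  have hr := hf.pos
  have h16 : closedBall (0 : (ℝ ∙ e)ᗮ) (r / 32) ⊆ closedBall 0 (r / 16) :=
    closedBall_subset_closedBall (by linarith)
  set N := (C ∩ cylinder y e r (closedBall 0 (r / 32))) \ Z with hN
  have hNm : MeasurableSet N :=
    (hC.isClosed.measurableSet.inter (measurableSet_cylinder measurableSet_closedBall)).diff hZ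
  have hinj : InjOn (hyperProj y e) N := (hf.injOn hε h16).mono sdiff_subset
  have hAm : MeasurableSet (hyperProj y e '' N) :=
    hNm.image_of_continuousOn_injOn continuous_hyperProj.continuousOn hinj
  have hA : hyperProj y e '' N ⊆ closedBall 0 (r / 32) := by
    rintro _ ⟨z, hz, rfl⟩
    exact hz.1.2.2
  have hcyl : C ∩ cylinder y e r (hyperProj y e '' N) = N := by
    refine Subset.antisymm ?_ fun z hz => ⟨hz.1.1, hz.1.2.1, z, hz, rfl⟩
    rintro z ⟨hzC, hz1, z', hz', heq⟩
    have : z = z' := hf.injOn hε h16 ⟨hzC, hz1, heq ▸ hA ⟨z', hz', rfl⟩⟩ hz'.1 heq.symm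
    rwa [this]
  have hκN : κ (cylinder y e r (hyperProj y e '' N)) = 0 := by
    refine measure_mono_null (t := Cᶜ ∪ Zᶜ) (fun z hz => ?_)
      (measure_union_null h.carrier_cone hκ)
    by_cases hzC : z ∈ C
    · exact Or.inr (hcyl.subset ⟨hzC, hz⟩).2
    · exact Or.inl hzC
  have hvol : volume (hyperProj y e '' N) = 0 := by
    have := hf.jump_mul_volume_le hε h hu hAm hA
    rw [hκN, nonpos_iff_eq_zero, mul_eq_zero, ENNReal.ofReal_eq_zero] at this
    exact this.resolve_left (not_le.2 (sub_pos.2 hf.lt))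
  have := hf.measure_le hε hu.locConst hd (hA.trans h16)
  rw [hcyl, hvol, mul_zero, nonpos_iff_eq_zero] at this
  exact this

end Flat

/-- If the mass of `κ = θ ℋᵈ` with `1 ≤ θ` is not larger than the measure of the cone, then `θ` is
equal to one almost everywhere and the jumps of `u` are equal to one. The jump is the density of the
vertical flux, which is close to the mass of `κ` and hence to the measure of the cone in a small
cylinder, and this in turn is close to the measure of its base. -/
theorem IsJumpFunction.unitJumps [IsFiniteMeasure κ] (h : IsCalibratingField v W κ C)
    (hu : IsJumpFunction v κ C u) (hC : IsTwoSidedCone C) {d : ℕ}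
    (hd : Module.finrank ℝ V = d + 1) (hd0 : 0 < d) {Z : Set V} (hZ : MeasurableSet Z)
    {θ : V → ℝ≥0∞} (hθ : AEMeasurable θ (μHE[d].restrict Z)) (hθ1 : ∀ x ∈ Z, 1 ≤ θ x)
    (hκ : κ = (μHE[d].restrict Z).withDensity θ) (hmass : κ univ ≤ μHE[d] (C ∩ ball 0 1))
    (hsing : μHE[d] (ball 0 1 \ W) = 0) : UnitJumps C u := by
  have hκZ : κ Zᶜ = 0 := by
    rw [hκ]
    refine withDensity_absolutelyContinuous _ _ ?_
    rw [Measure.restrict_apply hZ.compl, compl_inter_self, measure_empty]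
  -- almost all of the cone belongs to `Z`
  have hreg : μHE[d] (((C ∩ W) \ {0}) \ Z) = 0 := by
    refine measure_null_of_locally_null _ fun y hy => ?_
    obtain ⟨⟨⟨hyC, hyW⟩, hy0⟩, -⟩ := hy
    have hy1 : ‖y‖ < 1 := by simpa using h.subset hyW
    obtain ⟨c, c', hc⟩ := hu.exists_hasJump h hC hyC hy0 hy1
    obtain ⟨r, hf⟩ := hu.exists_isFlatAt h hC hyC hyW hy0 hc (ε := 1 / 4) (by norm_num)
    refine ⟨_, inter_mem_nhdsWithin _ (cylinder_mem_nhds (y := y) (e := v y) hf.pos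
      (closedBall_mem_nhds 0 (ε := r / 32) (by linarith [hf.pos]))), ?_⟩
    refine measure_mono_null ?_ (hf.measure_diff_eq_zero le_rfl h hu hC hd hZ hκZ)
    rintro z ⟨⟨⟨⟨hzC, -⟩, -⟩, hzZ⟩, hz⟩
    exact ⟨⟨hzC, hz⟩, hzZ⟩
  have h0 : μHE[d] ({0} : Set V) = 0 := by
    have := Measure.nullSingletonClass_hausdorff V (d := (d : ℝ)) (by exact_mod_cast hd0)
    rw [Measure.euclideanHausdorffMeasure_def, Measure.smul_apply, measure_singleton, smul_zero]
  have hCZ : μHE[d] ((C ∩ ball 0 1) \ Z) = 0 := by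
    refine measure_mono_null (t := (((C ∩ W) \ {0}) \ Z) ∪ ({0} ∪ (ball 0 1 \ W))) ?_
      (measure_union_null hreg (measure_union_null h0 hsing))
    rintro z ⟨⟨hzC, hzb⟩, hzZ⟩
    by_cases hz0 : z = 0
    · exact Or.inr (Or.inl hz0)
    · by_cases hzW : z ∈ W
      · exact Or.inl ⟨⟨⟨hzC, hzW⟩, hz0⟩, hzZ⟩
      · exact Or.inr (Or.inr ⟨hzb, hzW⟩)
  -- hence `θ` is equal to one almost everywhere
  have hone : (fun _ => 1) =ᵐ[μHE[d].restrict Z] θ := by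
    have hle : (fun _ => 1) ≤ᵐ[μHE[d].restrict Z] θ :=
      (ae_restrict_iff' hZ).2 (Eventually.of_forall hθ1)
    have hint : ∫⁻ x in Z, θ x ∂μHE[d] = κ univ := by
      rw [hκ, withDensity_apply _ MeasurableSet.univ, Measure.restrict_univ]
    refine ae_eq_of_ae_le_of_lintegral_le hle ?_ hθ ?_
    · refine ((lintegral_mono_ae hle).trans_lt ?_).ne
      rw [hint]
      exact measure_lt_top κ univ
    · rw [hint, lintegral_const, Measure.restrict_apply_univ, one_mul]
      refine hmass.trans ?_
      calc μHE[d] (C ∩ ball 0 1) ≤ μHE[d] (((C ∩ ball 0 1) \ Z) ∪ Z) :=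
            measure_mono fun z hz => by
              by_cases hzZ : z ∈ Z
              · exact Or.inr hzZ
              · exact Or.inl ⟨hz, hzZ⟩
        _ ≤ _ := (measure_union_le _ _).trans (by rw [hCZ, zero_add])
  have hκH : κ = μHE[d].restrict Z := by
    rw [hκ, ← withDensity_congr_ae hone]
    exact withDensity_one
  have hZC : μHE[d] (Z \ C) = 0 := by
    have := h.carrier_cone
    rw [hκH, Measure.restrict_apply hC.isClosed.isOpen_compl.measurableSet, inter_comm] at this
    exact this
  -- regular points first; the other jumps have the same height as those at nearby regular points
  have hjump : ∀ y ∈ C, y ∈ W → y ≠ 0 → ∀ c c', HasJump C u y c c' → c' = c + 1 := by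
    intro y hyC hyW hy0 c c' hc
    -- compare flux, mass, measure of the cone and volume of the base up to factors close to one
    have key : ∀ ε : ℝ, 0 < ε → ε ≤ 1 / 4 → 1 - ε ≤ c' - c ∧ c' - c ≤ ((1 - ε)⁻¹) ^ d := by
      intro ε hε hε4
      obtain ⟨r, hf⟩ := hu.exists_isFlatAt h hC hyC hyW hy0 hc hε
      have hr := hf.pos
      set A := closedBall (0 : (ℝ ∙ v y)ᗮ) (r / 32) with hA
      have hAm : MeasurableSet A := measurableSet_closedBall
      have hA16 : A ⊆ closedBall 0 (r / 16) := closedBall_subset_closedBall (by linarith)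
      have hcm := measurableSet_cylinder (y := y) (r := r) hAm
      have hκA : κ (cylinder y (v y) r A) = μHE[d] (C ∩ cylinder y (v y) r A) := by
        rw [hκH, Measure.restrict_apply hcm]
        have hb := hf.cylinder_subset hA16
        refine le_antisymm ?_ ?_
        · calc _ ≤ μHE[d] ((Z \ C) ∪ (C ∩ cylinder y (v y) r A)) := measure_mono fun z hz => by
                by_cases hzC : z ∈ C
                · exact Or.inr ⟨hzC, hz.1⟩
                · exact Or.inl ⟨hz.2, hzC⟩
            _ ≤ _ := (measure_union_le _ _).trans (by rw [hZC, zero_add])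
        · calc _ ≤ μHE[d] (((C ∩ ball 0 1) \ Z) ∪ (cylinder y (v y) r A ∩ Z)) :=
                measure_mono fun z hz => by
                  by_cases hzZ : z ∈ Z
                  · exact Or.inr ⟨hz.2, hzZ⟩
                  · exact Or.inl ⟨⟨hz.1, hf.ball_subset (hb hz.2)⟩, hzZ⟩
            _ ≤ _ := (measure_union_le _ _).trans (by rw [hCZ, zero_add])
      have hA0 : volume A ≠ 0 :=
        (measure_closedBall_pos volume (0 : (ℝ ∙ v y)ᗮ) (by linarith)).ne'
      have hAt : volume A ≠ ⊤ := measure_closedBall_lt_top.ne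
      have h1 := hf.jump_mul_volume_le hε4 h hu hAm Subset.rfl
      have h2 := hf.le_jump_mul_volume hε4 h hu hAm Subset.rfl
      have h3 := hf.volume_le hε4 hu.locConst hd hA16
      have h4 := hf.measure_le hε4 hu.locConst hd hA16
      rw [hκA] at h1 h2
      have hJ : 0 ≤ c' - c := (sub_pos.2 hf.lt).le
      constructor
      · have h5 := (mul_le_mul_right h3 (ENNReal.ofReal (1 - ε))).trans h2
        rw [ENNReal.mul_le_mul_iff_left hA0 hAt] at h5
        exact (ENNReal.ofReal_le_ofReal_iff hJ).1 h5
      · have h5 := h1.trans h4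
        rw [ENNReal.mul_le_mul_iff_left hA0 hAt, ← ENNReal.ofReal_pow (inv_nonneg.2 (by linarith))]
          at h5
        exact (ENNReal.ofReal_le_ofReal_iff (pow_nonneg (inv_nonneg.2 (by linarith)) _)).1 h5
    have hsmall : ∀ᶠ ε : ℝ in 𝓝[>] 0, 1 - ε ≤ c' - c ∧ c' - c ≤ ((1 - ε)⁻¹) ^ d := by
      filter_upwards [Ioc_mem_nhdsGT (show (0 : ℝ) < 1 / 4 by norm_num)] with ε hε
      exact key ε hε.1 hε.2
    have hl1 : Tendsto (fun ε : ℝ => 1 - ε) (𝓝[>] 0) (𝓝 1) := by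
      have : Tendsto (fun ε : ℝ => 1 - ε) (𝓝 0) (𝓝 (1 - 0)) :=
        (continuous_const.sub continuous_id).tendsto 0
      rw [sub_zero] at this
      exact this.mono_left nhdsWithin_le_nhds
    have hl2 : Tendsto (fun ε : ℝ => ((1 - ε)⁻¹) ^ d) (𝓝[>] 0) (𝓝 1) := by
      have := (hl1.inv₀ one_ne_zero).pow d
      simpa using this
    have h1 := ge_of_tendsto hl2 (hsmall.mono fun ε hε => hε.2)
    have h2 := le_of_tendsto hl1 (hsmall.mono fun ε hε => hε.1)
    linarith
  intro y hy hy0 hy1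
  obtain ⟨c, c', hc⟩ := hu.exists_hasJump h hC hy hy0 hy1
  obtain ⟨O, hO, hOo, hyO⟩ := _root_.mem_nhds_iff.1
    (inter_mem hc.eventually (isOpen_compl_singleton.mem_nhds hy0))
  obtain ⟨z, hz, hzC, hzW⟩ := h.exists_mem hy hy1 (hOo.mem_nhds hyO)
  have hz1 : ‖z‖ < 1 := by simpa using h.subset hzW
  have hzj : HasJump C u z c c' := HasJump.eq_of_nhds h hu hC hzC (hO hz).2 hz1 hc.lt (by
    filter_upwards [hOo.mem_nhds hz] with x hx using (hO hx).1)
  rw [hjump z hzC hzW (hO hz).2 c c' hzj] at hc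
  exact ⟨c, hc⟩

end UnitJump

/-! ### Cones over subsets of the sphere -/

section Cone

variable {n : ℕ} {M : Set (Eu n)}

theorem mem_coneOver_iff (hM : M ⊆ sphere 0 1) {z : Eu n} :
    z ∈ coneOver M ↔ ∃ p ∈ M, z = ‖z‖ • p := by
  constructor
  · rintro ⟨t, ht, p, hp, rfl⟩
    have : ‖p‖ = 1 := mem_sphere_zero_iff_norm.1 (hM hp)
    refine ⟨p, hp, ?_⟩
    rw [norm_smul, this, mul_one, Real.norm_of_nonneg ht]
  · rintro ⟨p, hp, hz⟩
    exact ⟨‖z‖, norm_nonneg z, p, hp, hz⟩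

theorem smul_mem_coneOver {z : Eu n} (hz : z ∈ coneOver M) {t : ℝ} (ht : 0 ≤ t) :
    t • z ∈ coneOver M := by
  obtain ⟨s, hs, p, hp, rfl⟩ := hz
  exact ⟨t * s, mul_nonneg ht hs, p, hp, by rw [smul_smul]⟩

theorem smul_mem_coneOver_iff {z : Eu n} {t : ℝ} (ht : 0 < t) :
    t • z ∈ coneOver M ↔ z ∈ coneOver M := by
  refine ⟨fun h => ?_, fun h => smul_mem_coneOver h ht.le⟩
  have := smul_mem_coneOver h (inv_nonneg.2 ht.le)
  rwa [smul_smul, inv_mul_cancel₀ ht.ne', one_smul] at this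

theorem isClosed_coneOver (hMc : IsCompact M) (hM : M ⊆ sphere 0 1) : IsClosed (coneOver M) := by
  have : CompactSpace M := isCompact_iff_compactSpace.1 hMc
  have h1 : IsClosed {q : M × Eu n | q.2 = ‖q.2‖ • (q.1 : Eu n)} :=
    isClosed_eq (by fun_prop) (by fun_prop)
  have h2 := isClosedMap_snd_of_compactSpace _ h1
  convert h2 using 1
  ext z
  rw [mem_coneOver_iff hM]
  constructor
  · rintro ⟨p, hp, hz⟩
    exact ⟨(⟨p, hp⟩, z), hz, rfl⟩
  · rintro ⟨⟨p, z'⟩, hz, rfl⟩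
    exact ⟨p, p.2, hz⟩

end Cone

/-! ### Cones over smooth hypersurfaces of the sphere are two-sided -/

section TwoSided

variable {m : ℕ}

/-- The index of the coordinate `m` of `ℝᵐ⁺²`, the radial one in the charts that flatten a cone. -/
abbrev idxRad (m : ℕ) : Fin (m + 2) := (Fin.last m).castSucc

/-- The index of the coordinate `m + 1` of `ℝᵐ⁺²`, the normal one in the charts that flatten a
cone. -/
abbrev idxNor (m : ℕ) : Fin (m + 2) := Fin.last (m + 1)

theorem eq_idx_of_le {i : Fin (m + 2)} (hi : m ≤ (i : ℕ)) : i = idxRad m ∨ i = idxNor m := by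
  have h2 : (i : ℕ) < m + 2 := i.2
  rcases hi.lt_or_eq with h | h
  · right; ext; simp; omega
  · left; ext; simp; omega

/-- The linear map that keeps the first `m` coordinates and sends the direction `m + 1` to the
vector of the plane of the last two coordinates which is normal to the projection of `ξ`. -/
def sliceMap (ξ : Eu (m + 2)) : Eu (m + 2) →L[ℝ] Eu (m + 2) :=
  LinearMap.toContinuousLinearMap
    { toFun := fun h => WithLp.toLp 2 fun i => if (i : ℕ) < m then h i else
        if i = idxRad m then -ξ (idxNor m) * h (idxNor m) else ξ (idxRad m) * h (idxNor m)
      map_add' := by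
        intro a b; ext i; simp only [PiLp.add_apply]; split_ifs <;> ring
      map_smul' := by
        intro a b; ext i
        simp only [PiLp.smul_apply, smul_eq_mul, RingHom.id_apply]; split_ifs <;> ring }

theorem sliceMap_apply (ξ h : Eu (m + 2)) (i : Fin (m + 2)) : sliceMap ξ h i =
    if (i : ℕ) < m then h i else
      if i = idxRad m then -ξ (idxNor m) * h (idxNor m) else ξ (idxRad m) * h (idxNor m) := rfl

theorem sliceMap_rad (ξ h : Eu (m + 2)) :
    sliceMap ξ h (idxRad m) = -ξ (idxNor m) * h (idxNor m) := by
  rw [sliceMap_apply, if_neg (by simp), if_pos rfl]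

theorem sliceMap_nor (ξ h : Eu (m + 2)) :
    sliceMap ξ h (idxNor m) = ξ (idxRad m) * h (idxNor m) := by
  rw [sliceMap_apply, if_neg (by simp), if_neg (by simp [Fin.ext_iff])]

/-- Around a point `t • x` of the cone over a submanifold, there is a chart of the ambient space
that flattens the cone. In a chart `Φ` which flattens `M` near `x`, it is the map
`y ↦ (t + y_rad) Φ⁻¹ (Φ x + sliceMap ξ y)`, where `ξ` is the image of the position vector. -/
theorem exists_flattening {M : Set (Eu (m + 2))} (hM : IsSubmanifold m M) (hMs : M ⊆ sphere 0 1)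
    {x : Eu (m + 2)} (hx : x ∈ M) {t : ℝ} (ht : 0 < t) :
    ∃ Ψ : OpenPartialHomeomorph (Eu (m + 2)) (Eu (m + 2)), 0 ∈ Ψ.source ∧ Ψ 0 = t • x ∧
      ∀ᶠ y in 𝓝 0, Ψ y ∈ coneOver M ↔ y (idxNor m) = 0 := by
  obtain ⟨Φ, hxs, hΦ, hΦs, hchart⟩ := hM x hx
  have hxn : ‖x‖ = 1 := mem_sphere_zero_iff_norm.1 (hMs hx)
  set a := Φ x with ha
  have hat : a ∈ Φ.target := Φ.map_source hxs
  have hsa : Φ.symm a = x := Φ.left_inv hxs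
  have hacoord : ∀ i : Fin (m + 2), m ≤ (i : ℕ) → a i = 0 := (hchart x hxs).1 hx
  have hdΦ : HasFDerivAt Φ (fderiv ℝ Φ x) x :=
    ((hΦ.contDiffAt (Φ.open_source.mem_nhds hxs)).differentiableAt (by simp)).hasFDerivAt
  have hsc : ContDiffAt ℝ ∞ Φ.symm a := hΦs.contDiffAt (Φ.open_target.mem_nhds hat)
  have hdS : HasFDerivAt Φ.symm (fderiv ℝ Φ.symm a) a :=
    (hsc.differentiableAt (by simp)).hasFDerivAt
  set D := fderiv ℝ Φ.symm a with hD
  have hDinv : ∀ h, D (fderiv ℝ Φ x h) = h := by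
    have h1 : HasFDerivAt (fun z => Φ.symm (Φ z)) (D.comp (fderiv ℝ Φ x)) x :=
      HasFDerivAt.comp x hdS hdΦ
    have h2 : HasFDerivAt (fun z => Φ.symm (Φ z)) (ContinuousLinearMap.id ℝ _) x := by
      refine (hasFDerivAt_id x).congr_of_eventuallyEq ?_
      filter_upwards [Φ.open_source.mem_nhds hxs] with z hz using Φ.left_inv hz
    intro h
    exact congrArg (fun T : Eu (m + 2) →L[ℝ] Eu (m + 2) => T h) (h1.unique h2)
  have hDinv' : ∀ h, fderiv ℝ Φ x (D h) = h := by
    have h1 : HasFDerivAt (fun z => Φ (Φ.symm z)) ((fderiv ℝ Φ x).comp D) a := by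
      have : HasFDerivAt Φ (fderiv ℝ Φ x) (Φ.symm a) := by rwa [hsa]
      exact HasFDerivAt.comp a this hdS
    have h2 : HasFDerivAt (fun z => Φ (Φ.symm z)) (ContinuousLinearMap.id ℝ _) a := by
      refine (hasFDerivAt_id a).congr_of_eventuallyEq ?_
      filter_upwards [Φ.open_target.mem_nhds hat] with z hz using Φ.right_inv hz
    intro h
    exact congrArg (fun T : Eu (m + 2) →L[ℝ] Eu (m + 2) => T h) (h1.unique h2)
  set ξ := fderiv ℝ Φ x x with hξ
  have hDξ : D ξ = x := hDinv x
  -- the position vector is not tangent to `M`, as `M` lies on a sphere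
  have hξne : ξ (idxRad m) ^ 2 + ξ (idxNor m) ^ 2 ≠ 0 := by
    intro h0
    have h1 : ξ (idxRad m) = 0 := by nlinarith [sq_nonneg (ξ (idxRad m)), sq_nonneg (ξ (idxNor m))]
    have h2 : ξ (idxNor m) = 0 := by nlinarith [sq_nonneg (ξ (idxRad m)), sq_nonneg (ξ (idxNor m))]
    have hline : HasDerivAt (fun s : ℝ => a + s • ξ) ξ 0 := by
      simpa using ((hasDerivAt_id (0 : ℝ)).smul_const ξ).const_add a
    have h00 : a + (0 : ℝ) • ξ = a := by simp
    have hcurve : HasDerivAt (fun s : ℝ => Φ.symm (a + s • ξ)) x 0 := by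
      have hd' : HasFDerivAt Φ.symm D (a + (0 : ℝ) • ξ) := by rwa [h00]
      have h4 := hd'.comp_hasDerivAt (0 : ℝ) hline
      rw [hDξ] at h4
      exact h4
    have hn := hcurve.norm_sq
    rw [h00, hsa, real_inner_self_eq_norm_sq, hxn] at hn
    have hconst : HasDerivAt (fun s : ℝ => ‖Φ.symm (a + s • ξ)‖ ^ 2) 0 0 := by
      refine (hasDerivAt_const (0 : ℝ) (1 : ℝ)).congr_of_eventuallyEq ?_
      have hev : ∀ᶠ s : ℝ in 𝓝 0, a + s • ξ ∈ Φ.target :=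
        hline.continuousAt.eventually (by beta_reduce; rw [h00]; exact Φ.open_target.mem_nhds hat)
      filter_upwards [hev] with s hs
      have : Φ.symm (a + s • ξ) ∈ M := by
        refine (hchart _ (Φ.map_target hs)).2 fun i hi => ?_
        rw [Φ.right_inv hs, PiLp.add_apply, hacoord i hi, PiLp.smul_apply]
        rcases eq_idx_of_le hi with rfl | rfl
        · rw [h1]; simp
        · rw [h2]; simp
      rw [mem_sphere_zero_iff_norm.1 (hMs this), one_pow]
    have := hn.unique hconst
    norm_num at this
  set A := sliceMap ξ with hA
  set F : Eu (m + 2) → Eu (m + 2) := fun y => (t + y (idxRad m)) • Φ.symm (a + A y) with hF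
  have hA0 : a + A 0 = a := by simp
  have hF0 : F 0 = t • x := by simp [hF, hsa]
  set D₀ : Eu (m + 2) →L[ℝ] Eu (m + 2) := t • D.comp A +
    (EuclideanSpace.proj (idxRad m) : Eu (m + 2) →L[ℝ] ℝ).smulRight x with hD₀
  have hcoord : HasFDerivAt (fun y : Eu (m + 2) => t + y (idxRad m))
      (EuclideanSpace.proj (idxRad m) : Eu (m + 2) →L[ℝ] ℝ) 0 :=
    (EuclideanSpace.proj (idxRad m) : Eu (m + 2) →L[ℝ] ℝ).hasFDerivAt.const_add t
  have hFd : HasFDerivAt F D₀ 0 := by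
    have h1 : HasFDerivAt (fun y => Φ.symm (a + A y)) (D.comp A) 0 := by
      refine HasFDerivAt.comp (g := Φ.symm) (f := fun y => a + A y) 0 ?_ (A.hasFDerivAt.const_add a)
      rwa [hA0]
    have h2 := hcoord.smul h1
    have h3 : (t + (0 : Eu (m + 2)) (idxRad m)) • D.comp A +
        (EuclideanSpace.proj (idxRad m) : Eu (m + 2) →L[ℝ] ℝ).smulRight (Φ.symm (a + A 0)) =
          D₀ := by
      rw [hD₀, hA0, hsa, PiLp.zero_apply, add_zero]
    rw [h3] at h2
    exact h2
  have hFc : ContDiffAt ℝ ∞ F 0 := by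
    have h1 : ContDiffAt ℝ ∞ (fun y => Φ.symm (a + A y)) 0 := by
      refine ContDiffAt.comp (g := Φ.symm) 0 (by rwa [hA0]) ?_
      exact contDiffAt_const.add A.contDiff.contDiffAt
    have h2 : ContDiffAt ℝ ∞ (fun y : Eu (m + 2) => t + y (idxRad m)) 0 :=
      contDiffAt_const.add
        (EuclideanSpace.proj (idxRad m) : Eu (m + 2) →L[ℝ] ℝ).contDiff.contDiffAt
    exact h2.smul h1
  -- in the plane of the last two coordinates, the projection of `ξ` and its normal are
  -- linearly independent
  have hinj : Function.Injective D₀ := by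
    rw [injective_iff_map_eq_zero]
    intro h hh
    have h1 : t • A h + h (idxRad m) • ξ = 0 := by
      have h2 := congrArg (fderiv ℝ Φ x) hh
      simp only [hD₀, add_apply, smul_apply, ContinuousLinearMap.comp_apply,
        ContinuousLinearMap.smulRight_apply, map_add, map_smul, hDinv', map_zero] at h2
      exact h2
    have hr := congrArg (fun z : Eu (m + 2) => z (idxRad m)) h1
    have hn := congrArg (fun z : Eu (m + 2) => z (idxNor m)) h1
    simp only [PiLp.add_apply, PiLp.smul_apply, smul_eq_mul, PiLp.zero_apply, hA, sliceMap_rad,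
      sliceMap_nor] at hr hn
    have hnor : h (idxNor m) = 0 := by
      have : (t * (ξ (idxRad m) ^ 2 + ξ (idxNor m) ^ 2)) * h (idxNor m) = 0 := by
        linear_combination ξ (idxRad m) * hn - ξ (idxNor m) * hr
      exact (mul_eq_zero.1 this).resolve_left (mul_ne_zero ht.ne' hξne)
    have hrad : h (idxRad m) = 0 := by
      have : (ξ (idxRad m) ^ 2 + ξ (idxNor m) ^ 2) * h (idxRad m) = 0 := by
        linear_combination ξ (idxRad m) * hr + ξ (idxNor m) * hn
      exact (mul_eq_zero.1 this).resolve_left hξne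
    ext i
    by_cases hi : (i : ℕ) < m
    · have h3 := congrArg (fun z : Eu (m + 2) => z i) h1
      simp only [PiLp.add_apply, PiLp.smul_apply, smul_eq_mul, PiLp.zero_apply, hA, sliceMap_apply,
        if_pos hi, hrad, zero_mul, add_zero] at h3
      exact (mul_eq_zero.1 h3).resolve_left ht.ne'
    · rcases eq_idx_of_le (not_lt.1 hi) with rfl | rfl
      · exact hrad
      · exact hnor
  set L : Eu (m + 2) ≃L[ℝ] Eu (m + 2) :=
    (LinearEquiv.ofInjectiveEndo (D₀ : Eu (m + 2) →ₗ[ℝ] Eu (m + 2)) hinj).toContinuousLinearEquiv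
    with hL
  have hLD : (L : Eu (m + 2) →L[ℝ] Eu (m + 2)) = D₀ := by ext1 h; rfl
  have hFd' : HasFDerivAt F (L : Eu (m + 2) →L[ℝ] Eu (m + 2)) 0 := by rwa [hLD]
  have hstrict : HasStrictFDerivAt F (L : Eu (m + 2) →L[ℝ] Eu (m + 2)) 0 :=
    hFc.hasStrictFDerivAt' hFd' (by simp)
  refine ⟨hstrict.toOpenPartialHomeomorph F, hstrict.mem_toOpenPartialHomeomorph_source, ?_, ?_⟩
  · rw [hstrict.toOpenPartialHomeomorph_coe]; exact hF0
  rw [hstrict.toOpenPartialHomeomorph_coe]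
  set G : Eu (m + 2) → Eu (m + 2) := fun y => Φ.symm (a + A y) with hG
  have hG0 : G 0 = x := by rw [hG]; simp [hsa]
  have hGc : ContinuousAt G 0 := by
    refine ContinuousAt.comp (g := Φ.symm) (f := fun y => a + A y) ?_ (by fun_prop)
    rw [hA0]; exact hsc.continuousAt
  -- the radial projection of `G y`, in the chart `Φ`
  set R : Eu (m + 2) → Eu (m + 2) := fun y => ‖G y‖⁻¹ • G y with hR
  have hR0 : R 0 = x := by rw [hR]; simp [hG0, hxn]
  have hRc : ContinuousAt R 0 :=
    (hGc.norm.inv₀ (by rw [hG0, hxn]; exact one_ne_zero)).smul hGc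
  set Y : Eu (m + 2) → Eu (m + 2) := fun y => WithLp.toLp 2 fun i =>
    if (i : ℕ) < m then (Φ (R y) - a) i else
      if i = idxRad m then (t + y (idxRad m)) * ‖G y‖ - t else 0 with hY
  have hY0 : Y 0 = 0 := by
    ext i
    simp only [hY, hR0, ← ha, sub_self, hG0, hxn]
    split_ifs <;> simp
  have hYc : ContinuousAt Y 0 := by
    have h1 : ContinuousAt (fun y => Φ (R y)) 0 := by
      refine ContinuousAt.comp (g := Φ) (f := R) ?_ hRc
      rw [hR0]; exact hdΦ.continuousAt
    refine (PiLp.continuous_toLp 2 _).continuousAt.comp (continuousAt_pi.2 fun i => ?_)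
    by_cases hi : (i : ℕ) < m
    · simp only [if_pos hi]
      exact ((EuclideanSpace.proj i : Eu (m + 2) →L[ℝ] ℝ).continuous.continuousAt.comp
        (h1.sub continuousAt_const))
    · by_cases hi' : i = idxRad m
      · simp only [if_neg hi, if_pos hi']
        have h2 : ContinuousAt (fun y : Eu (m + 2) => t + y (idxRad m)) 0 := hcoord.continuousAt
        exact (h2.mul hGc.norm).sub continuousAt_const
      · simp only [if_neg hi, if_neg hi']
        exact continuousAt_const
  set Ω := (hstrict.toOpenPartialHomeomorph F).source with hΩ
  have hΩn : Ω ∈ 𝓝 (0 : Eu (m + 2)) := (hstrict.toOpenPartialHomeomorph F).open_source.mem_nhds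
    hstrict.mem_toOpenPartialHomeomorph_source
  have hΩinj : InjOn F Ω := by
    have := (hstrict.toOpenPartialHomeomorph F).injOn
    rwa [hstrict.toOpenPartialHomeomorph_coe] at this
  have e1 : ∀ᶠ y in 𝓝 (0 : Eu (m + 2)), 0 < t + y (idxRad m) :=
    hcoord.continuousAt.eventually (lt_mem_nhds (by simpa using ht))
  have e2 : ∀ᶠ y in 𝓝 (0 : Eu (m + 2)), a + A y ∈ Φ.target := by
    have : ContinuousAt (fun y => a + A y) 0 := by fun_prop
    exact this.eventually (by beta_reduce; rw [hA0]; exact Φ.open_target.mem_nhds hat)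
  have e3 : ∀ᶠ y in 𝓝 (0 : Eu (m + 2)), Y y ∈ Ω := hYc.eventually (by rwa [hY0])
  have e4 : ∀ᶠ y in 𝓝 (0 : Eu (m + 2)), R y ∈ Φ.source :=
    hRc.eventually (by rw [hR0]; exact Φ.open_source.mem_nhds hxs)
  have e5 : ∀ᶠ y in 𝓝 (0 : Eu (m + 2)), G y ≠ 0 :=
    hGc.eventually_ne (by rw [hG0]; rintro rfl; simp at hxn)
  -- if `G y` is in the cone, then `F y` is also the image of `Y y`, whose normal coordinate is zero
  filter_upwards [hΩn, e1, e2, e3, e4, e5] with y hyΩ h1 h2 h3 h4 h5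
  change (t + y (idxRad m)) • G y ∈ coneOver M ↔ _
  rw [smul_mem_coneOver_iff h1]
  constructor
  · intro hGy
    have hRM : R y ∈ M := by
      obtain ⟨p, hp, hGp⟩ := (mem_coneOver_iff hMs).1 hGy
      have : R y = p := by
        rw [hR]; dsimp only
        rw [inv_smul_eq_iff₀ (norm_ne_zero_iff.2 h5)]
        exact hGp
      rwa [this]
    have hAY : a + A (Y y) = Φ (R y) := by
      ext i
      have hco := (hchart _ h4).1 hRM
      rw [PiLp.add_apply, hA, sliceMap_apply]
      have hYn : Y y (idxNor m) = 0 := by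
        change (if ((idxNor m : Fin (m + 2)) : ℕ) < m then _ else _) = _
        rw [if_neg (by simp), if_neg (by simp [Fin.ext_iff])]
      by_cases hi : (i : ℕ) < m
      · rw [if_pos hi]
        change a i + (if (i : ℕ) < m then _ else _) = _
        rw [if_pos hi, PiLp.sub_apply]; ring
      · rw [if_neg hi, hYn, hacoord i (not_lt.1 hi), hco i (not_lt.1 hi)]
        simp
    have hYr : Y y (idxRad m) = (t + y (idxRad m)) * ‖G y‖ - t := by
      change (if ((idxRad m : Fin (m + 2)) : ℕ) < m then _ else _) = _
      rw [if_neg (by simp), if_pos rfl]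
    have hFF : F (Y y) = F y := by
      change (t + Y y (idxRad m)) • Φ.symm (a + A (Y y)) = (t + y (idxRad m)) • G y
      rw [hAY, Φ.left_inv h4, hYr, add_sub_cancel, mul_smul]
      congr 1
      rw [hR]; dsimp only
      rw [smul_smul, mul_inv_cancel₀ (norm_ne_zero_iff.2 h5), one_smul]
    rw [← hΩinj h3 hyΩ hFF]
    change (if ((idxNor m : Fin (m + 2)) : ℕ) < m then _ else _) = _
    rw [if_neg (by simp), if_neg (by simp [Fin.ext_iff])]
  · intro hy0
    have : G y ∈ M := by
      refine (hchart _ (Φ.map_target h2)).2 fun i hi => ?_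
      rw [Φ.right_inv h2, PiLp.add_apply, hacoord i hi, hA]
      rcases eq_idx_of_le hi with rfl | rfl
      · rw [sliceMap_rad, hy0]; simp
      · rw [sliceMap_nor, hy0]; simp
    exact ⟨1, zero_le_one, _, this, (one_smul _ _).symm⟩

/-- The cone over a closed hypersurface of the sphere is two-sided away from the origin. -/
theorem isTwoSidedCone_coneOver {M : Set (Eu (m + 2))} (hM : IsSubmanifold m M) (hMc : IsCompact M)
    (hMs : M ⊆ sphere 0 1) (hnull : volume (coneOver M) = 0) : IsTwoSidedCone (coneOver M) where
  isClosed := isClosed_coneOver hMc hMs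
  null := hnull
  smul_mem x hx t ht := smul_mem_coneOver hx ht
  sides y hy hy0 O hO := by
    obtain ⟨x, hx, hyx⟩ := (mem_coneOver_iff hMs).1 hy
    obtain ⟨Ψ, h0, hΨ0, hev⟩ := exists_flattening hM hMs hx (norm_pos_iff.2 hy0)
    rw [← hyx] at hΨ0
    have hcont : ContinuousAt Ψ 0 := Ψ.continuousAt h0
    obtain ⟨δ, hδ, hball⟩ := Metric.eventually_nhds_iff_ball.1
      (hev.and ((Ψ.open_source.eventually_mem h0).and
        (hcont.eventually (by rw [hΨ0]; exact eventually_mem_set.2 hO))))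
    have hsub : ball 0 δ ⊆ Ψ.source := fun z hz => (hball z hz).2.1
    have hpre : ∀ A : Set (Eu (m + 2)), Convex ℝ A → A ⊆ ball 0 δ → IsPreconnected (Ψ '' A) :=
      fun A hA hAb => hA.isPreconnected.image _ (Ψ.continuousOn.mono (hAb.trans hsub))
    have hproj : IsLinearMap ℝ fun z : Eu (m + 2) => z (idxNor m) :=
      ⟨fun _ _ => rfl, fun _ _ => rfl⟩
    refine ⟨Ψ '' ball 0 δ, ?_, ?_, Ψ '' (ball 0 δ ∩ {z | z (idxNor m) < 0}),
      Ψ '' (ball 0 δ ∩ {z | 0 < z (idxNor m)}), ?_, ?_, ?_⟩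
    · rw [← hΨ0]
      exact Ψ.image_mem_nhds h0 (ball_mem_nhds 0 hδ)
    · rintro _ ⟨z, hz, rfl⟩
      exact (hball z hz).2.2
    · exact hpre _ ((convex_ball 0 δ).inter (convex_halfSpace_lt hproj 0)) inter_subset_left
    · exact hpre _ ((convex_ball 0 δ).inter (convex_halfSpace_gt hproj 0)) inter_subset_left
    · rw [← image_union, ← inter_union_distrib_left]
      refine Subset.antisymm ?_ ?_
      · rintro _ ⟨⟨z, hz, rfl⟩, hzC⟩
        refine ⟨z, ⟨hz, lt_or_gt_of_ne fun h => hzC ((hball z hz).1.2 h)⟩, rfl⟩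
      · rintro _ ⟨z, ⟨hz, hz'⟩, rfl⟩
        refine ⟨⟨z, hz, rfl⟩, fun hzC => ?_⟩
        have := (hball z hz).1.1 hzC
        rcases hz' with h | h
        · exact (ne_of_lt h) this
        · exact (ne_of_gt h) this

end TwoSided

/-! ### Covectors and multivectors of codimension one -/

section Covectors

open Module

variable {n N : ℕ}

theorem abs_det_basisFun_le (v : Fin n → Eu n) :
    |(EuclideanSpace.basisFun (Fin n) ℝ).toBasis.det v| ≤ ∏ i, ‖v i‖ := by
  have : Fact (finrank ℝ (Eu n) = n) := ⟨by simp⟩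
  rw [← (EuclideanSpace.basisFun (Fin n) ℝ).toBasis.orientation.volumeForm_robust' ]
  exact Orientation.abs_volumeForm_apply_le _ v

theorem abs_det_basisFun_eq_one {v : Fin n → Eu n} (hv : Orthonormal ℝ v) :
    |(EuclideanSpace.basisFun (Fin n) ℝ).toBasis.det v| = 1 := by
  have : Fact (finrank ℝ (Eu n) = n) := ⟨by simp⟩
  rw [← (EuclideanSpace.basisFun (Fin n) ℝ).toBasis.orientation.volumeForm_robust',
    Orientation.abs_volumeForm_apply_of_pairwise_orthogonal _ fun i j h => hv.2 h]
  simp [hv.1]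

/-- The determinant, as a continuous form of top degree. -/
def volForm (n : ℕ) : Eu n [⋀^Fin n]→L[ℝ] ℝ :=
  (EuclideanSpace.basisFun (Fin n) ℝ).toBasis.det.mkContinuous 1 fun v => by
    rw [one_mul]; exact abs_det_basisFun_le v

theorem volForm_apply (v : Fin n → Eu n) :
    volForm n v = (EuclideanSpace.basisFun (Fin n) ℝ).toBasis.det v := rfl

/-- The covector `det (b, ·, …, ·)` of codimension one. -/
def volCovec (N : ℕ) : Eu (N + 1) →L[ℝ] Covec (N + 1) N := (volForm (N + 1)).curryLeft

theorem volCovec_apply (b : Eu (N + 1)) (e : Fin N → Eu (N + 1)) :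
    volCovec N b e = volForm (N + 1) (Matrix.vecCons b e) := rfl

/-- The linear map underlying `perp`, that sends a covector of codimension one to its normal. -/
def perpL (N : ℕ) : Covec (N + 1) N →L[ℝ] Eu (N + 1) :=
  ((EuclideanSpace.equiv (Fin (N + 1)) ℝ).symm : (Fin (N + 1) → ℝ) →L[ℝ] Eu (N + 1)).comp
    (ContinuousLinearMap.pi fun i => ((-1 : ℝ) ^ (i : ℕ)) •
      (wedge fun j => EuclideanSpace.single (i.succAbove j) (1 : ℝ)))

theorem perpL_apply (φ : Covec (N + 1) N) (i : Fin (N + 1)) :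
    perpL N φ i = (-1) ^ (i : ℕ) * φ fun j => EuclideanSpace.single (i.succAbove j) (1 : ℝ) := rfl

theorem perp_eq (w : Eu (N + 1) → Covec (N + 1) N) : perp w = fun x => perpL N (w x) := rfl

theorem volForm_update_single (b : Eu n) (i : Fin n) :
    volForm n (Function.update (fun j => EuclideanSpace.single j (1 : ℝ)) i b) = b i := by
  have h1 : (fun j => EuclideanSpace.single j (1 : ℝ)) =
      (EuclideanSpace.basisFun (Fin n) ℝ).toBasis := by ext; simp
  rw [volForm_apply, h1, Basis.det_apply, Basis.toMatrix_update, Basis.toMatrix_self,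
    ← Matrix.cramer_apply, Matrix.cramer_one]
  simp

theorem perpL_volCovec (b : Eu (N + 1)) : perpL N (volCovec N b) = b := by
  ext i
  rw [perpL_apply, volCovec_apply]
  have h1 := (volForm (N + 1)).map_insertNth i b
    (i.removeNth fun j => EuclideanSpace.single j (1 : ℝ))
  rw [Fin.insertNth_removeNth, volForm_update_single] at h1
  rw [zsmul_eq_mul] at h1
  push_cast at h1
  exact h1.symm

/-- A covector of codimension one is determined by its values on the coordinate hyperplanes. -/
theorem perpL_injective : Function.Injective (perpL N) := by
  rw [injective_iff_map_eq_zero]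
  intro φ hφ
  have h0 : ∀ i : Fin (N + 1),
      φ (fun j => EuclideanSpace.single (i.succAbove j) (1 : ℝ)) = 0 := by
    intro i
    have := congrArg (fun z : Eu (N + 1) => z i) hφ
    simp only [perpL_apply, PiLp.zero_apply] at this
    exact (mul_eq_zero.1 this).resolve_left (pow_ne_zero _ (by norm_num))
  apply ContinuousAlternatingMap.toAlternatingMap_injective
  refine Basis.ext_alternating (EuclideanSpace.basisFun (Fin (N + 1)) ℝ).toBasis fun f hf => ?_
  obtain ⟨i, hi⟩ : ∃ i, i ∉ range f := by
    by_contra! h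
    have := Fintype.card_le_of_surjective f h
    simp at this
  have hex : ∀ j, ∃ k, i.succAbove k = f j := fun j =>
    Fin.exists_succAbove_eq fun h => hi ⟨j, h⟩
  choose g hg using hex
  have hginj : Function.Injective g := fun a b hab => hf (by rw [← hg, ← hg, hab])
  set σ : Equiv.Perm (Fin N) := Equiv.ofBijective g (Finite.injective_iff_bijective.1 hginj)
  have h1 := φ.toAlternatingMap.map_perm (fun j => EuclideanSpace.single (i.succAbove j) (1 : ℝ)) σ
  have h2 : (fun j => (EuclideanSpace.basisFun (Fin (N + 1)) ℝ).toBasis (f j)) =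
      (fun j => EuclideanSpace.single (i.succAbove j) (1 : ℝ)) ∘ σ := by
    ext1 j
    rw [Function.comp_apply]
    change _ = EuclideanSpace.single (i.succAbove (g j)) (1 : ℝ)
    rw [hg]; simp
  rw [h2, h1]
  have h3 : φ.toAlternatingMap (fun j => EuclideanSpace.single (i.succAbove j) (1 : ℝ)) = 0 := h0 i
  rw [h3]; simp

theorem volCovec_perpL (φ : Covec (N + 1) N) : volCovec N (perpL N φ) = φ :=
  perpL_injective (perpL_volCovec _)

theorem norm_volCovec_le (b : Eu (N + 1)) : ‖volCovec N b‖ ≤ ‖b‖ := by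
  refine ContinuousAlternatingMap.opNorm_le_bound _ (norm_nonneg b) fun e => ?_
  rw [volCovec_apply, volForm_apply, Real.norm_eq_abs]
  refine (abs_det_basisFun_le _).trans ?_
  rw [Fin.prod_univ_succ]
  simp

/-- A unit vector completes to an orthonormal family. -/
theorem exists_orthonormal_cons {b : Eu (N + 1)} (hb : ‖b‖ = 1) :
    ∃ e : Fin N → Eu (N + 1), Orthonormal ℝ (Matrix.vecCons b e) := by
  have h1 : Orthonormal ℝ ((↑) : ({b} : Set (Eu (N + 1))) → Eu (N + 1)) := by
    rw [orthonormal_subtype_iff_ite]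
    rintro v rfl w rfl
    simp [hb]
  obtain ⟨f, hf⟩ := Orthonormal.exists_orthonormalBasis_extension_of_card_eq
    (𝕜 := ℝ) (E := Eu (N + 1)) (ι := Fin (N + 1)) (by simp) (v := fun _ => b) (s := {0}) (by
      rw [orthonormal_iff_ite]
      rintro ⟨i, hi⟩ ⟨j, hj⟩
      rw [mem_singleton_iff] at hi hj
      subst hi hj
      simp [Set.domRestrict, hb])
  refine ⟨fun j => f j.succ, ?_⟩
  have h2 : Matrix.vecCons b (fun j => f j.succ) = f := by
    funext i
    refine Fin.cases ?_ (fun j => ?_) i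
    · simp [hf 0 rfl]
    · simp
  rw [h2]
  exact f.orthonormal

/-- The normal of a covector is bounded by its comass: evaluate the covector on an orthonormal basis
of the hyperplane. -/
theorem norm_perpL_le (φ : Covec (N + 1) N) : ‖perpL N φ‖ ≤ ‖φ‖ := by
  set v := perpL N φ with hv
  rcases eq_or_ne v 0 with h0 | h0
  · rw [h0, norm_zero]; exact norm_nonneg φ
  have hvn := norm_ne_zero_iff.2 h0
  obtain ⟨e, he⟩ := exists_orthonormal_cons (b := ‖v‖⁻¹ • v) (by
    rw [norm_smul, norm_inv, norm_norm, inv_mul_cancel₀ hvn])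
  have h1 : |φ e| = ‖v‖ := by
    rw [← volCovec_perpL φ, ← hv]
    have h2 : v = ‖v‖ • (‖v‖⁻¹ • v) := by rw [smul_smul, mul_inv_cancel₀ hvn, one_smul]
    conv_lhs => rw [h2, map_smul]
    rw [ContinuousAlternatingMap.smul_apply, smul_eq_mul, abs_mul, volCovec_apply, volForm_apply,
      abs_det_basisFun_eq_one he, mul_one, abs_norm]
  have h3 := φ.le_opNorm e
  have h4 : ∀ i, ‖e i‖ = 1 := fun i => by simpa using he.1 i.succ
  rw [Real.norm_eq_abs, h1] at h3
  simpa [h4] using h3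

/-- The vector that represents a multivector of codimension one: `ξ φ` is the inner product of
`hodge ξ` with the normal `perpL N φ` of the covector `φ`. -/
def hodge (ξ : MVec (N + 1) N) : Eu (N + 1) :=
  (InnerProductSpace.toDual ℝ (Eu (N + 1))).symm (ξ.comp (volCovec N))

theorem inner_hodge (ξ : MVec (N + 1) N) (b : Eu (N + 1)) : ⟪hodge ξ, b⟫ = ξ (volCovec N b) := by
  rw [hodge, InnerProductSpace.toDual_symm_apply]; rfl

theorem apply_eq_inner_hodge (ξ : MVec (N + 1) N) (φ : Covec (N + 1) N) :
    ξ φ = ⟪hodge ξ, perpL N φ⟫ := by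
  rw [inner_hodge, volCovec_perpL]

theorem continuous_hodge : Continuous (hodge (N := N)) :=
  (InnerProductSpace.toDual ℝ (Eu (N + 1))).symm.continuous.comp
    (((ContinuousLinearMap.compL ℝ (Eu (N + 1)) (Covec (N + 1) N) ℝ).flip (volCovec N)).continuous)

/-- The representing vector of an orientation is a unit normal. -/
theorem norm_hodge_of_orients {ξ : MVec (N + 1) N} {P : Submodule ℝ (Eu (N + 1))}
    (h : Orients ξ P) : ‖hodge ξ‖ = 1 := by
  obtain ⟨e, he, -, hξ⟩ := h
  have habs : ∀ b, |⟪hodge ξ, b⟫| = |volForm (N + 1) (Matrix.vecCons b e)| := by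
    intro b
    rw [inner_hodge]
    rcases hξ with rfl | rfl
    · rfl
    · rw [neg_apply, abs_neg]; rfl
  apply le_antisymm
  · have h1 := habs (hodge ξ)
    rw [real_inner_self_eq_norm_sq, abs_of_nonneg (sq_nonneg _)] at h1
    have h2 : |volForm (N + 1) (Matrix.vecCons (hodge ξ) e)| ≤ ‖hodge ξ‖ := by
      rw [volForm_apply]
      refine (abs_det_basisFun_le _).trans ?_
      rw [Fin.prod_univ_succ]
      simp [he.1]
    nlinarith [norm_nonneg (hodge ξ)]
  · obtain ⟨b, hb, hbe⟩ : ∃ b : Eu (N + 1), ‖b‖ = 1 ∧ ∀ i, ⟪b, e i⟫ = 0 := by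
      have hrank : finrank ℝ (Submodule.span ℝ (range e)) = N := by
        rw [finrank_span_eq_card he.linearIndependent]; simp
      have h1 := (Submodule.span ℝ (range e)).finrank_add_finrank_orthogonal
      rw [hrank, finrank_euclideanSpace_fin] at h1
      have h2 : finrank ℝ (Submodule.span ℝ (range e))ᗮ = 1 := by omega
      obtain ⟨z, hz⟩ := finrank_pos_iff_exists_ne_zero.1 (by rw [h2]; exact one_pos)
      have hz' : (z : Eu (N + 1)) ≠ 0 := by simpa using hz
      refine ⟨‖(z : Eu (N + 1))‖⁻¹ • z, ?_, fun i => ?_⟩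
      · rw [norm_smul, norm_inv, norm_norm, inv_mul_cancel₀ (norm_ne_zero_iff.2 hz')]
      · rw [real_inner_smul_left, real_inner_comm,
          (Submodule.mem_orthogonal _ _).1 z.2 (e i) (Submodule.subset_span ⟨i, rfl⟩), mul_zero]
    have hon : Orthonormal ℝ (Matrix.vecCons b e) := by
      constructor
      · intro i; refine Fin.cases ?_ (fun j => ?_) i
        · simpa using hb
        · simpa using he.1 j
      · intro i j
        refine Fin.cases ?_ (fun i => ?_) i <;> refine Fin.cases ?_ (fun j => ?_) j
        · simp
        · intro _; simpa using hbe j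
        · intro _; simpa [real_inner_comm] using hbe i
        · intro hij; simpa using he.2 fun h => hij (by rw [h])
    have h1 := habs b
    rw [volForm_apply, abs_det_basisFun_eq_one hon] at h1
    have h2 := abs_real_inner_le_norm (hodge ξ) b
    rw [h1, hb, mul_one] at h2
    exact h2

/-- The exterior derivative of `h det (b, c, ·)`. As there are no nonzero forms above the top
degree, expanding `dh ∧ det = 0` along `b` and `c` expresses it by covectors `det (b, ·)`. -/
theorem alternatizeUncurryFin_smulRight_volForm {m : ℕ} (L : Eu (m + 2) →L[ℝ] ℝ)
    (b c : Eu (m + 2)) :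
    ContinuousAlternatingMap.alternatizeUncurryFin
        (L.smulRight ((volCovec (m + 1) b).curryLeft c)) =
      L c • volCovec (m + 1) b - L b • volCovec (m + 1) c := by
  ext e
  have h0 : ContinuousAlternatingMap.alternatizeUncurryFin (L.smulRight (volForm (m + 2)))
      (Matrix.vecCons b (Matrix.vecCons c e)) = 0 := by
    refine AlternatingMap.map_linearDependent (ContinuousAlternatingMap.alternatizeUncurryFin
      (L.smulRight (volForm (m + 2)))).toAlternatingMap _ fun h => ?_
    have := h.fintype_card_le_finrank
    simp at this
  rw [ContinuousAlternatingMap.alternatizeUncurryFin_apply, Fin.sum_univ_succ,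
    Fin.sum_univ_succ] at h0
  rw [ContinuousAlternatingMap.alternatizeUncurryFin_apply]
  have hrem : ∀ i : Fin (m + 1), i.succ.succ.removeNth (Matrix.vecCons b (Matrix.vecCons c e)) =
      Matrix.vecCons b (Matrix.vecCons c (i.removeNth e)) := by
    intro i
    ext1 j
    refine Fin.cases ?_ (fun j => ?_) j
    · simp [Fin.removeNth]
    · refine Fin.cases ?_ (fun j => ?_) j
      · simp [Fin.removeNth]
      · simp [Fin.removeNth]
  have hrem0 : (0 : Fin (m + 3)).removeNth (Matrix.vecCons b (Matrix.vecCons c e)) =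
      Matrix.vecCons c e := by ext1 j; simp [Fin.removeNth]
  have hrem1 : (Fin.succ (0 : Fin (m + 2))).removeNth (Matrix.vecCons b (Matrix.vecCons c e)) =
      Matrix.vecCons b e := by
    ext1 j
    refine Fin.cases ?_ (fun j => ?_) j <;> simp [Fin.removeNth]
  simp only [hrem, hrem0, hrem1, ContinuousLinearMap.smulRight_apply,
    ContinuousAlternatingMap.smul_apply, Matrix.cons_val_zero, Matrix.cons_val_succ, Fin.val_zero,
    Fin.val_succ, smul_eq_mul] at h0
  simp only [ContinuousLinearMap.smulRight_apply, ContinuousAlternatingMap.smul_apply,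
    ContinuousAlternatingMap.sub_apply, volCovec_apply, smul_eq_mul,
    ContinuousAlternatingMap.curryLeft_apply_apply]
  have h5 : ∀ i : Fin (m + 1), (-1 : ℝ) ^ ((i : ℕ) + 1 + 1) = (-1) ^ (i : ℕ) := fun i => by
    rw [pow_succ, pow_succ]; ring
  simp only [zsmul_eq_mul, Int.cast_pow, Int.cast_neg, Int.cast_one, h5] at h0 ⊢
  linear_combination h0

end Covectors

/-! ### Removable singularities of divergence free fields -/

section Removability

open Module

variable {V : Type*} [NormedAddCommGroup V] [InnerProductSpace ℝ V] [FiniteDimensional ℝ V]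
  [MeasurableSpace V] [BorelSpace V]

theorem hausdorffMeasure_eq_zero_of_euclidean {s : Set V} {d : ℕ} (h : μHE[d] s = 0) :
    μH[d] s = 0 := by
  rw [Measure.euclideanHausdorffMeasure_def, Measure.smul_apply, ENNReal.smul_def, smul_eq_mul,
    mul_eq_zero] at h
  refine h.resolve_left ?_
  simpa using Measure.addHaarScalarFactor_volume_hausdorffMeasure_ne_zero d

/-- A compact set of vanishing `d`-dimensional Hausdorff measure is covered by finitely many balls
for which the sum of the `d`-th powers of the radii is small. -/
theorem exists_finite_ball_cover {K : Set V} (hK : IsCompact K) {d : ℕ} (hd : 0 < d)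
    (h : μHE[d] K = 0) {ε : ℝ} (hε : 0 < ε) :
    ∃ (F : Finset ℕ) (c : ℕ → V) (ρ : ℕ → ℝ), (∀ n, 0 < ρ n) ∧ K ⊆ ⋃ n ∈ F, ball (c n) (ρ n) ∧
      ∑ n ∈ F, ρ n ^ d < ε := by
  have h0 := hausdorffMeasure_eq_zero_of_euclidean h
  rw [Measure.hausdorffMeasure_apply] at h0
  have h1 := ENNReal.iSup_eq_zero.1 h0 1
  have h2 := ENNReal.iSup_eq_zero.1 h1 one_pos
  have h3 : (⨅ (t : ℕ → Set V) (_ : K ⊆ ⋃ n, t n) (_ : ∀ n, ediam (t n) ≤ 1),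
      ∑' n, ⨆ _ : (t n).Nonempty, ediam (t n) ^ (d : ℝ)) < ENNReal.ofReal (ε / 2) := by
    rw [h2]; exact ENNReal.ofReal_pos.2 (by positivity)
  simp only [iInf_lt_iff] at h3
  obtain ⟨t, hcov, hdiam, hsum⟩ := h3
  obtain ⟨e, he, s, hes, hs⟩ := posSumOfEncodable (half_pos hε) ℕ
  have hex : ∀ n, ∃ r : ℝ, (ediam (t n)).toReal < r ∧ r ^ d < (ediam (t n)).toReal ^ d + e n := by
    intro n
    have hc : ContinuousAt (fun r : ℝ => r ^ d) (ediam (t n)).toReal := by fun_prop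
    have h4 : ∀ᶠ r in 𝓝[>] (ediam (t n)).toReal, r ^ d < (ediam (t n)).toReal ^ d + e n :=
      (hc.eventually (gt_mem_nhds (by linarith [he n]))).filter_mono nhdsWithin_le_nhds
    obtain ⟨r, hr1, hr2⟩ := (h4.and self_mem_nhdsWithin).exists
    exact ⟨r, hr2, hr1⟩
  choose ρ hρ1 hρ2 using hex
  have hne : ∀ n, ∃ c : V, t n ⊆ ball c (ρ n) := by
    intro n
    rcases (t n).eq_empty_or_nonempty with h4 | ⟨c, hc⟩
    · exact ⟨0, by simp [h4]⟩
    · refine ⟨c, fun x hx => ?_⟩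
      have h5 : edist x c ≤ ediam (t n) := edist_le_ediam_of_mem hx hc
      rw [mem_ball, dist_edist]
      exact (ENNReal.toReal_mono ((hdiam n).trans_lt ENNReal.one_lt_top).ne h5).trans_lt (hρ1 n)
  choose c hc using hne
  obtain ⟨F, hF⟩ := hK.elim_finite_subcover (fun n => ball (c n) (ρ n)) (fun n => isOpen_ball)
    (hcov.trans (iUnion_mono hc))
  refine ⟨F, c, ρ, fun n => ENNReal.toReal_nonneg.trans_lt (hρ1 n), hF, ?_⟩
  have h6 : ∑ n ∈ F, (ediam (t n)).toReal ^ d < ε / 2 := by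
    rw [← ENNReal.ofReal_lt_ofReal_iff (half_pos hε),
      ENNReal.ofReal_sum_of_nonneg fun n _ => pow_nonneg ENNReal.toReal_nonneg d]
    refine lt_of_le_of_lt ?_ hsum
    refine le_trans (Finset.sum_le_sum fun n _ => ?_) (ENNReal.sum_le_tsum F)
    rw [ENNReal.ofReal_pow ENNReal.toReal_nonneg,
      ENNReal.ofReal_toReal ((hdiam n).trans_lt ENNReal.one_lt_top).ne]
    rcases (t n).eq_empty_or_nonempty with h4 | h4
    · simp [h4, hd.ne']
    · rw [ciSup_pos h4, ENNReal.rpow_natCast]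
  calc ∑ n ∈ F, ρ n ^ d ≤ ∑ n ∈ F, ((ediam (t n)).toReal ^ d + e n) :=
        Finset.sum_le_sum fun n _ => (hρ2 n).le
    _ = ∑ n ∈ F, (ediam (t n)).toReal ^ d + ∑ n ∈ F, e n := Finset.sum_add_distrib
    _ < ε / 2 + ε / 2 := by
        have := sum_le_hasSum F (fun n _ => (he n).le) hes
        linarith
    _ = ε := by ring

/-- Sets of vanishing measure of codimension one have cutoff functions with gradient small in
`L¹`. -/
theorem exists_cutoff {K : Set V} (hK : IsCompact K) {d : ℕ} (hV : finrank ℝ V = d + 1) (hd : 0 < d)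
    (h : μHE[d] K = 0) {ε : ℝ} (hε : 0 < ε) :
    ∃ χ : V → ℝ, ContDiff ℝ 1 χ ∧ HasCompactSupport χ ∧ (∃ O, IsOpen O ∧ K ⊆ O ∧ EqOn χ 1 O) ∧
      (∫ x, |χ x|) ≤ ε ∧ (∫ x, ‖fderiv ℝ χ x‖) ≤ ε := by
  let f : ContDiffBump (0 : V) := ⟨1, 2, one_pos, one_lt_two⟩
  have hfd : Differentiable ℝ f := (f.contDiff (n := 1)).differentiable (by simp)
  have hfi : Integrable f := f.continuous.integrable_of_hasCompactSupport f.hasCompactSupport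
  have hfdi : Integrable (fderiv ℝ f) :=
    ((f.contDiff (n := 1)).continuous_fderiv (by simp)).integrable_of_hasCompactSupport
      (f.hasCompactSupport.fderiv (𝕜 := ℝ))
  set A := 2 * (∫ x, f x) with hA
  set B := 2 * (∫ x, ‖fderiv ℝ f x‖) with hB
  have hA0 : 0 ≤ A := mul_nonneg zero_le_two (integral_nonneg fun x => f.nonneg)
  have hB0 : 0 ≤ B := mul_nonneg zero_le_two (integral_nonneg fun x => norm_nonneg _)
  obtain ⟨F, c, ρ, hρ, hcov, hsum⟩ := exists_finite_ball_cover hK hd h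
    (ε := min 1 (ε / (A + B + 1))) (lt_min one_pos (by positivity))
  have hρ1 : ∀ n ∈ F, ρ n ≤ 1 := by
    intro n hn
    have h1 : ρ n ^ d < 1 := lt_of_le_of_lt
      (Finset.single_le_sum (f := fun n => ρ n ^ d) (fun i _ => pow_nonneg (hρ i).le d) hn)
      (hsum.trans_le (min_le_left _ _))
    by_contra! h2
    exact absurd h1 (not_lt.2 (one_le_pow₀ h2.le))
  let η : ℕ → V → ℝ := fun n x => f ((ρ n)⁻¹ • (x - c n))
  have hηc : ∀ n, ContDiff ℝ 1 (η n) := fun n =>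
    f.contDiff.comp (contDiff_const.smul (contDiff_id.sub contDiff_const))
  have hηs : ∀ n, HasCompactSupport (η n) := fun n => by
    have h1 : HasCompactSupport fun x : V => f ((ρ n)⁻¹ • x) :=
      f.hasCompactSupport.comp_smul (inv_ne_zero (hρ n).ne')
    exact h1.comp_homeomorph (Homeomorph.subRight (c n))
  have hη0 : ∀ n x, 0 ≤ η n x := fun n x => f.nonneg
  have hηi : ∀ n, Integrable (η n) := fun n =>
    (hηc n).continuous.integrable_of_hasCompactSupport (hηs n)
  have hηd : ∀ n x, fderiv ℝ (η n) x = (ρ n)⁻¹ • fderiv ℝ f ((ρ n)⁻¹ • (x - c n)) := by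
    intro n x
    have h1 : HasFDerivAt (fun x : V => (ρ n)⁻¹ • (x - c n))
        ((ρ n)⁻¹ • ContinuousLinearMap.id ℝ V) x :=
      ((hasFDerivAt_id x).sub_const (c n)).const_smul ((ρ n)⁻¹)
    have h2 := (hfd ((ρ n)⁻¹ • (x - c n))).hasFDerivAt.comp x h1
    have h3 : fderiv ℝ (η n) x = _ := h2.fderiv
    rw [h3]; ext z; simp
  have hint : ∀ n ∈ F, (∫ x, η n x) ≤ ρ n ^ d * ∫ x, f x := by
    intro n hn
    have h1 : (∫ x, η n x) = ρ n ^ (d + 1) * ∫ x, f x := by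
      rw [integral_sub_right_eq_self (fun x => f ((ρ n)⁻¹ • x)) (c n),
        Measure.integral_comp_inv_smul_of_nonneg volume (fun x => f x) (hρ n).le, hV, smul_eq_mul]
    rw [h1]
    exact mul_le_mul_of_nonneg_right (pow_le_pow_of_le_one (hρ n).le (hρ1 n hn) (Nat.le_succ d))
      (integral_nonneg fun x => f.nonneg)
  have hintd : ∀ n, (∫ x, ‖fderiv ℝ (η n) x‖) = ρ n ^ d * ∫ x, ‖fderiv ℝ f x‖ := by
    intro n
    simp only [hηd, norm_smul, norm_inv, Real.norm_of_nonneg (hρ n).le]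
    rw [integral_const_mul,
      integral_sub_right_eq_self (fun x => ‖fderiv ℝ f ((ρ n)⁻¹ • x)‖) (c n),
      Measure.integral_comp_inv_smul_of_nonneg volume (fun x => ‖fderiv ℝ f x‖) (hρ n).le, hV,
      smul_eq_mul, ← mul_assoc, pow_succ, mul_comm (ρ n ^ d), ← mul_assoc,
      inv_mul_cancel₀ (hρ n).ne', one_mul]
  let s : V → ℝ := fun x => ∑ n ∈ F, η n x
  have hsc : ContDiff ℝ 1 s := ContDiff.sum fun n _ => hηc n
  have hss : HasCompactSupport s := by
    refine HasCompactSupport.of_support_subset_isCompact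
      (F.isCompact_biUnion fun n _ => (hηs n).isCompact) fun x hx => ?_
    obtain ⟨n, hn, hne⟩ := Finset.exists_ne_zero_of_sum_ne_zero hx
    exact mem_iUnion₂.2 ⟨n, hn, subset_tsupport _ hne⟩
  have hs0 : ∀ x, 0 ≤ s x := fun x => Finset.sum_nonneg fun n _ => hη0 n x
  have hsd : ∀ x, ‖fderiv ℝ s x‖ ≤ ∑ n ∈ F, ‖fderiv ℝ (η n) x‖ := by
    intro x
    have h1 : fderiv ℝ s x = ∑ n ∈ F, fderiv ℝ (η n) x :=
      fderiv_fun_sum fun n _ => (hηc n).differentiable (by simp) x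
    rw [h1]; exact norm_sum_le _ _
  -- the function `(1 - s)₊²`, which vanishes where `1 ≤ s`
  let ψ : V → ℝ := fun x => (max ((2 - s x) - 1) 0) ^ 2
  have hψc : ContDiff ℝ 1 ψ := contDiff_truncation.comp (contDiff_const.sub hsc)
  have hψd : ∀ x, ‖fderiv ℝ ψ x‖ ≤ 2 * ∑ n ∈ F, ‖fderiv ℝ (η n) x‖ := by
    intro x
    have h1 : HasFDerivAt (fun x => 2 - s x) (-fderiv ℝ s x) x :=
      (hsc.differentiable (by simp) x).hasFDerivAt.const_sub 2
    have h2 := (hasDerivAt_truncation (2 - s x)).comp_hasFDerivAt x h1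
    have h3 : fderiv ℝ ψ x = _ := h2.fderiv
    rw [h3, norm_smul, norm_neg]
    refine mul_le_mul ?_ (hsd x) (norm_nonneg _) zero_le_two
    rw [Real.norm_of_nonneg (mul_nonneg zero_le_two (le_max_right _ _))]
    linarith [max_le (show 2 - s x - 1 ≤ 1 by linarith [hs0 x]) zero_le_one]
  have hχabs : ∀ x, |1 - ψ x| ≤ 2 * s x := by
    intro x
    have h1 := hs0 x
    have h2 : 0 ≤ max (2 - s x - 1) 0 := le_max_right _ _
    have h3 : 2 - s x - 1 ≤ max (2 - s x - 1) 0 := le_max_left _ _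
    have h4 : max (2 - s x - 1) 0 ≤ 1 := max_le (by linarith) zero_le_one
    rw [abs_of_nonneg (by simp only [ψ]; nlinarith)]
    simp only [ψ]
    nlinarith [sq_nonneg (max (2 - s x - 1) 0 - 1)]
  refine ⟨fun x => 1 - ψ x, contDiff_const.sub hψc, ?_, ⟨⋃ n ∈ F, ball (c n) (ρ n),
    isOpen_biUnion fun n _ => isOpen_ball, hcov, fun x hx => ?_⟩, ?_, ?_⟩
  · refine hss.mono fun x hx hx0 => hx ?_
    have := hχabs x
    rw [hx0, mul_zero] at this
    exact abs_nonpos_iff.1 this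
  · obtain ⟨n, hn, hxn⟩ := mem_iUnion₂.1 hx
    have h1 : η n x = 1 := by
      refine f.one_of_mem_closedBall ?_
      rw [mem_closedBall_zero_iff, norm_smul, norm_inv, Real.norm_of_nonneg (hρ n).le]
      rw [mem_ball, dist_eq_norm] at hxn
      change (ρ n)⁻¹ * ‖x - c n‖ ≤ 1
      rw [inv_mul_le_one₀ (hρ n)]; exact hxn.le
    have h2 : 1 ≤ s x := h1 ▸ Finset.single_le_sum (f := fun n => η n x) (fun i _ => hη0 i x) hn
    have h3 : ψ x = 0 := by
      change (max ((2 - s x) - 1) 0) ^ 2 = 0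
      rw [max_eq_right (by linarith)]; norm_num
    simp [h3]
  · have h1 : (∫ x, |1 - ψ x|) ≤ ∫ x, 2 * s x := by
      refine integral_mono_of_nonneg (ae_of_all _ fun x => abs_nonneg _)
        ((integrable_finsetSum F fun n _ => hηi n).const_mul 2) (ae_of_all _ hχabs)
    refine h1.trans ?_
    rw [integral_const_mul, integral_finsetSum F fun n _ => hηi n]
    have h2 : ∑ n ∈ F, (∫ x, η n x) ≤ (∑ n ∈ F, ρ n ^ d) * ∫ x, f x := by
      rw [Finset.sum_mul]; exact Finset.sum_le_sum hint
    have h3 : ∑ n ∈ F, ρ n ^ d ≤ ε / (A + B + 1) := hsum.le.trans (min_le_right _ _)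
    calc 2 * ∑ n ∈ F, (∫ x, η n x) ≤ (∑ n ∈ F, ρ n ^ d) * A := by rw [hA]; linarith
      _ ≤ ε / (A + B + 1) * A := mul_le_mul_of_nonneg_right h3 hA0
      _ ≤ ε := by rw [div_mul_eq_mul_div, div_le_iff₀ (by positivity)]; nlinarith
  · have h1 : (∫ x, ‖fderiv ℝ (fun x => 1 - ψ x) x‖) ≤ ∫ x, 2 * ∑ n ∈ F, ‖fderiv ℝ (η n) x‖ := by
      refine integral_mono_of_nonneg (ae_of_all _ fun x => norm_nonneg _)
        ((integrable_finsetSum F fun n _ => ?_).const_mul 2) (ae_of_all _ fun x => ?_)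
      · exact (((hηc n).continuous_fderiv (by simp)).integrable_of_hasCompactSupport
          ((hηs n).fderiv (𝕜 := ℝ))).norm
      · simp only [fderiv_const_sub, norm_neg]
        exact hψd x
    refine h1.trans ?_
    rw [integral_const_mul, integral_finsetSum F fun n _ => (((hηc n).continuous_fderiv
      (by simp)).integrable_of_hasCompactSupport ((hηs n).fderiv (𝕜 := ℝ))).norm]
    have h2 : ∑ n ∈ F, (∫ x, ‖fderiv ℝ (η n) x‖) = (∑ n ∈ F, ρ n ^ d) * ∫ x, ‖fderiv ℝ f x‖ := by
      rw [Finset.sum_mul]; exact Finset.sum_congr rfl fun n _ => hintd n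
    have h3 : ∑ n ∈ F, ρ n ^ d ≤ ε / (A + B + 1) := hsum.le.trans (min_le_right _ _)
    calc 2 * ∑ n ∈ F, (∫ x, ‖fderiv ℝ (η n) x‖) = (∑ n ∈ F, ρ n ^ d) * B := by
          rw [hB, h2]; ring
      _ ≤ ε / (A + B + 1) * B := mul_le_mul_of_nonneg_right h3 hB0
      _ ≤ ε := by rw [div_mul_eq_mul_div, div_le_iff₀ (by positivity)]; nlinarith

/-- Closed sets of vanishing measure of codimension one are removable for bounded weakly divergence
free fields. -/
theorem integral_fderiv_eq_zero_of_removable {d : ℕ} (hV : finrank ℝ V = d + 1) (hd : 0 < d)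
    {v : V → V} (hvm : Measurable v) (hv : ∀ x, ‖v x‖ ≤ 1) {U W : Set V} (hW : IsOpen W)
    (hnull : μHE[d] (U \ W) = 0)
    (hdiv : ∀ φ : V → ℝ, ContDiff ℝ 1 φ → HasCompactSupport φ → tsupport φ ⊆ W →
      ∫ x, fderiv ℝ φ x (v x) = 0)
    {φ : V → ℝ} (hφ : ContDiff ℝ 1 φ) (hφs : HasCompactSupport φ) (hφU : tsupport φ ⊆ U) :
    ∫ x, fderiv ℝ φ x (v x) = 0 := by
  set K := tsupport φ \ W with hK
  have hKc : IsCompact K := hφs.isCompact.diff hW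
  have hK0 : μHE[d] K = 0 := measure_mono_null (sdiff_subset_sdiff_left hφU) hnull
  obtain ⟨A, hA⟩ := hφs.exists_bound_of_continuous hφ.continuous
  obtain ⟨B, hB⟩ := (hφs.fderiv (𝕜 := ℝ)).exists_bound_of_continuous
    (hφ.continuous_fderiv (by simp))
  have hA0 : 0 ≤ A := (norm_nonneg _).trans (hA 0)
  have hB0 : 0 ≤ B := (norm_nonneg _).trans (hB 0)
  have key : ∀ ε : ℝ, 0 < ε → |∫ x, fderiv ℝ φ x (v x)| ≤ (A + B) * ε := by
    intro ε hε
    obtain ⟨χ, hχ, hχs, ⟨O, hO, hKO, hχO⟩, hχ1, hχ2⟩ := exists_cutoff hKc hV hd hK0 hε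
    have hmul : ContDiff ℝ 1 fun x => (1 - χ x) * φ x := (contDiff_const.sub hχ).mul hφ
    have hmuls : HasCompactSupport fun x => (1 - χ x) * φ x := hφs.mul_left
    have hsupp : tsupport (fun x => (1 - χ x) * φ x) ⊆ W := by
      intro x hx
      have hx1 : x ∈ tsupport φ := tsupport_mul_subset_right hx
      by_contra hxW
      have hxO : x ∈ O := hKO ⟨hx1, hxW⟩
      refine (notMem_tsupport_iff_eventuallyEq.2 ?_) hx
      filter_upwards [hO.mem_nhds hxO] with y hy
      rw [hχO hy]; simp
    have h0 := hdiv _ hmul hmuls hsupp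
    have hder : ∀ x, fderiv ℝ (fun x => (1 - χ x) * φ x) x (v x) =
        fderiv ℝ φ x (v x) - (χ x * fderiv ℝ φ x (v x) + φ x * fderiv ℝ χ x (v x)) := by
      intro x
      rw [fderiv_fun_mul ((contDiff_const.sub hχ).differentiable (by simp) x)
        (hφ.differentiable (by simp) x), fderiv_const_sub]
      simp only [add_apply, smul_apply, neg_apply, smul_eq_mul]
      ring
    have hae : ∀ {g : V → ℝ}, ContDiff ℝ 1 g → HasCompactSupport g →
        Integrable fun x => fderiv ℝ g x (v x) := by
      intro g hg hgs
      have h1 : Integrable (fderiv ℝ g) := (hg.continuous_fderiv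
        (by simp)).integrable_of_hasCompactSupport (hgs.fderiv (𝕜 := ℝ))
      refine h1.norm.mono' ?_ (ae_of_all _ fun x => ?_)
      · exact (isBoundedBilinearMap_apply.continuous.measurable.comp
          ((hg.continuous_fderiv (by simp)).measurable.prodMk hvm)).aestronglyMeasurable
      · exact ((fderiv ℝ g x).le_opNorm (v x)).trans
          (mul_le_of_le_one_right (norm_nonneg _) (hv x))
    have hi1 := hae hφ hφs
    have hi2 : Integrable fun x => χ x * fderiv ℝ φ x (v x) :=
      hi1.bdd_mul (c := _) hχ.continuous.aestronglyMeasurable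
        (ae_of_all _ (hχs.exists_bound_of_continuous hχ.continuous).choose_spec)
    have hi3 : Integrable fun x => φ x * fderiv ℝ χ x (v x) :=
      (hae hχ hχs).bdd_mul (c := A) hφ.continuous.aestronglyMeasurable (ae_of_all _ hA)
    simp only [hder] at h0
    rw [integral_sub hi1 (by exact hi2.add hi3), sub_eq_zero] at h0
    rw [h0, ← Real.norm_eq_abs]
    have hχi : Integrable fun x => |χ x| :=
      (hχ.continuous.integrable_of_hasCompactSupport hχs).abs
    have hχdi : Integrable fun x => ‖fderiv ℝ χ x‖ := ((hχ.continuous_fderiv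
      (by simp)).integrable_of_hasCompactSupport (hχs.fderiv (𝕜 := ℝ))).norm
    calc ‖∫ x, (χ x * fderiv ℝ φ x (v x) + φ x * fderiv ℝ χ x (v x))‖
        ≤ ∫ x, (B * |χ x| + A * ‖fderiv ℝ χ x‖) := by
          refine norm_integral_le_of_norm_le ((hχi.const_mul B).add (hχdi.const_mul A))
            (ae_of_all _ fun x => ?_)
          refine (norm_add_le _ _).trans (add_le_add ?_ ?_)
          · rw [norm_mul, mul_comm, Real.norm_eq_abs (χ x)]
            exact mul_le_mul_of_nonneg_right (((fderiv ℝ φ x).le_opNorm (v x)).trans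
              ((mul_le_of_le_one_right (norm_nonneg _) (hv x)).trans (hB x))) (abs_nonneg _)
          · rw [norm_mul]
            exact mul_le_mul (hA x) (((fderiv ℝ χ x).le_opNorm (v x)).trans
              (mul_le_of_le_one_right (norm_nonneg _) (hv x))) (norm_nonneg _) hA0
      _ = B * (∫ x, |χ x|) + A * ∫ x, ‖fderiv ℝ χ x‖ := by
          rw [integral_add (hχi.const_mul B) (hχdi.const_mul A), integral_const_mul,
            integral_const_mul]
      _ ≤ (A + B) * ε := by nlinarith
  by_contra hne
  have hpos := abs_pos.2 hne
  have h1 := key (|∫ x, fderiv ℝ φ x (v x)| / (2 * (A + B + 1))) (by positivity)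
  rw [mul_div_assoc', le_div_iff₀ (by positivity)] at h1
  nlinarith

end Removability

/-! ### The normal field of a calibration -/

section CalibrationField

open Module

variable {N : ℕ} {w : Eu (N + 1) → Covec (N + 1) N} {S : Set (Eu (N + 1))}

/-- The normal field of a calibration of the unit ball, extended by zero. -/
def calField (w : Eu (N + 1) → Covec (N + 1) N) (S : Set (Eu (N + 1))) : Eu (N + 1) → Eu (N + 1) :=
  (ball 0 1 \ S).indicator (perp w)

theorem IsCoflatCalibration.isOpen_regular (hw : IsCoflatCalibration (ball 0 1) w S) :
    IsOpen (ball 0 1 \ S) := by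
  obtain ⟨C, hC, rfl⟩ := hw.relClosed
  rw [sdiff_self_inter]
  exact isOpen_ball.sdiff hC

theorem IsCoflatCalibration.contDiffOn_perp (hw : IsCoflatCalibration (ball 0 1) w S) :
    ContDiffOn ℝ 1 (perp w) (ball 0 1 \ S) := by
  rw [perp_eq]
  exact (perpL N).contDiff.comp_contDiffOn hw.contDiffOn

/-- By continuity, the bound on the comass holds at each regular point. -/
theorem IsCoflatCalibration.norm_le (hw : IsCoflatCalibration (ball 0 1) w S) {x : Eu (N + 1)}
    (hx : x ∈ ball (0 : Eu (N + 1)) 1 \ S) : ‖w x‖ ≤ 1 := by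
  have hae : ∀ᵐ y ∂(volume.restrict (ball (0 : Eu (N + 1)) 1)), ‖w y‖ ≤ 1 := by
    have h1 : ∀ᵐ y ∂(volume.restrict (ball (0 : Eu (N + 1)) 1)), ‖w y‖ₑ ≤ _ :=
      ae_le_eLpNormEssSup
    filter_upwards [h1] with y hy
    have h2 : ‖w y‖ₑ ≤ 1 := hy.trans (by simpa using hw.norm_le_one)
    rwa [← ofReal_norm, ENNReal.ofReal_le_one] at h2
  by_contra! hlt
  have hopen : IsOpen ((ball (0 : Eu (N + 1)) 1 \ S) ∩ {y | 1 < ‖w y‖}) :=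
    hw.contDiffOn.continuousOn.norm.isOpen_inter_preimage hw.isOpen_regular isOpen_Ioi
  have h0 : volume ((ball (0 : Eu (N + 1)) 1 \ S) ∩ {y | 1 < ‖w y‖}) = 0 := by
    rw [ae_restrict_iff' measurableSet_ball] at hae
    refine measure_mono_null ?_ hae
    rintro y ⟨hy, hy1⟩ h
    exact absurd (h hy.1) (not_le.2 hy1)
  have := hopen.measure_eq_zero_iff (μ := volume) |>.1 h0
  exact (this ▸ (⟨hx, hlt⟩ : x ∈ (ball (0 : Eu (N + 1)) 1 \ S) ∩ {y | 1 < ‖w y‖}) :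
    x ∈ (∅ : Set (Eu (N + 1))))

theorem IsCoflatCalibration.norm_calField_le (hw : IsCoflatCalibration (ball 0 1) w S)
    (x : Eu (N + 1)) : ‖calField w S x‖ ≤ 1 := by
  by_cases hx : x ∈ ball (0 : Eu (N + 1)) 1 \ S
  · rw [calField, indicator_of_mem hx]
    exact (norm_perpL_le (w x)).trans (hw.norm_le hx)
  · rw [calField, indicator_of_notMem hx, norm_zero]; exact zero_le_one

theorem IsCoflatCalibration.continuousOn_calField (hw : IsCoflatCalibration (ball 0 1) w S) :
    ContinuousOn (calField w S) (ball 0 1 \ S) :=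
  hw.contDiffOn_perp.continuousOn.congr fun _ hx => indicator_of_mem hx _

theorem IsCoflatCalibration.measurable_calField (hw : IsCoflatCalibration (ball 0 1) w S) :
    Measurable (calField w S) := by
  classical
  rw [calField, ← piecewise_eq_indicator]
  exact hw.contDiffOn_perp.continuousOn.measurable_piecewise continuousOn_const
    hw.isOpen_regular.measurableSet

/-- A closed form of codimension one has a divergence free normal field. -/
theorem sum_fderiv_perp_eq_zero {x : Eu (N + 1)} (hd : DifferentiableAt ℝ w x)
    (h : extDeriv w x = 0) :
    ∑ i, fderiv ℝ (fun y => perp w y i) x (EuclideanSpace.single i 1) = 0 := by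
  have h1 := congrArg (fun α => α fun i => EuclideanSpace.single i (1 : ℝ)) h
  rw [extDeriv_apply hd] at h1
  refine Eq.trans (Finset.sum_congr rfl fun i _ => ?_) h1
  have h2 : DifferentiableAt ℝ
      (fun y => w y fun j => EuclideanSpace.single (i.succAbove j) (1 : ℝ)) x :=
    (wedge (n := N + 1) fun j =>
      EuclideanSpace.single (i.succAbove j) (1 : ℝ)).differentiableAt.comp x hd
  change fderiv ℝ (fun y => (-1) ^ (i : ℕ) *
    w y fun j => EuclideanSpace.single (i.succAbove j) (1 : ℝ)) x _ = _
  rw [fderiv_const_mul h2, smul_apply, zsmul_eq_mul]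
  push_cast
  rfl

/-- Integration by parts off the singular set. -/
theorem IsCoflatCalibration.integral_fderiv_of_tsupport_subset
    (hw : IsCoflatCalibration (ball 0 1) w S) {φ : Eu (N + 1) → ℝ} (hφ : ContDiff ℝ 1 φ)
    (hφs : HasCompactSupport φ) (hφU : tsupport φ ⊆ ball 0 1 \ S) :
    ∫ x, fderiv ℝ φ x (calField w S x) = 0 := by
  set W := ball (0 : Eu (N + 1)) 1 \ S with hW
  have hcoord : ∀ i, ContDiffOn ℝ 1 (fun y => perp w y i) W := fun i =>
    (EuclideanSpace.proj i : Eu (N + 1) →L[ℝ] ℝ).contDiff.comp_contDiffOn hw.contDiffOn_perp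
  -- each `φ vᵢ` is a compactly supported `C¹` function on the whole space
  have hF : ∀ i, ContDiff ℝ 1 fun y => φ y * perp w y i := by
    intro i
    rw [contDiff_iff_contDiffAt]
    intro x
    by_cases hx : x ∈ tsupport φ
    · exact hφ.contDiffAt.mul ((hcoord i).contDiffAt (hw.isOpen_regular.mem_nhds (hφU hx)))
    · refine (contDiffAt_const (c := (0 : ℝ))).congr_of_eventuallyEq ?_
      filter_upwards [notMem_tsupport_iff_eventuallyEq.1 hx] with y hy
      rw [hy]; simp
  have hFs : ∀ i, HasCompactSupport fun y => φ y * perp w y i := fun i => hφs.mul_right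
  have hFi : ∀ i, Integrable fun x =>
      fderiv ℝ (fun y => φ y * perp w y i) x (EuclideanSpace.single i 1) := fun i => by
    refine Continuous.integrable_of_hasCompactSupport ?_ ?_
    · exact ((hF i).continuous_fderiv (by simp)).clm_apply continuous_const
    · exact (hFs i).fderiv_apply (𝕜 := ℝ) _
  have hzero : ∀ i,
      ∫ x, fderiv ℝ (fun y => φ y * perp w y i) x (EuclideanSpace.single i 1) = 0 := by
    intro i
    have h1 := integral_mul_fderiv_eq_neg_fderiv_mul_of_integrable (μ := volume)
      (f := fun _ : Eu (N + 1) => (1 : ℝ)) (g := fun y => φ y * perp w y i)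
      (v := EuclideanSpace.single i (1 : ℝ)) (by simp) (by simpa using hFi i)
      (by simpa using (hF i).continuous.integrable_of_hasCompactSupport (hFs i))
      (fun x _ => differentiableAt_const _) (fun x _ => (hF i).differentiable (by simp) x)
    simpa using h1
  have hsum : ∀ x, fderiv ℝ φ x (calField w S x) =
      ∑ i, fderiv ℝ (fun y => φ y * perp w y i) x (EuclideanSpace.single i 1) := by
    intro x
    by_cases hx : x ∈ tsupport φ
    · have hxW := hφU hx
      have hwd : DifferentiableAt ℝ w x :=
        (hw.contDiffOn.contDiffAt (hw.isOpen_regular.mem_nhds hxW)).differentiableAt (by simp)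
      have h1 : ∀ i, fderiv ℝ (fun y => φ y * perp w y i) x (EuclideanSpace.single i 1) =
          φ x * fderiv ℝ (fun y => perp w y i) x (EuclideanSpace.single i 1) +
            perp w x i * fderiv ℝ φ x (EuclideanSpace.single i 1) := by
        intro i
        rw [fderiv_fun_mul (hφ.differentiable (by simp) x) (((hcoord i).contDiffAt
          (hw.isOpen_regular.mem_nhds hxW)).differentiableAt (by simp))]
        simp only [add_apply, smul_apply, smul_eq_mul]
      simp only [h1]
      rw [Finset.sum_add_distrib, ← Finset.mul_sum, sum_fderiv_perp_eq_zero hwd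
        (hw.closed x hxW), mul_zero, zero_add, calField, indicator_of_mem hxW]
      have h2 : perp w x = ∑ i, perp w x i • EuclideanSpace.single i (1 : ℝ) := by
        ext j
        simp [Finset.sum_apply, Pi.single_apply]
      conv_lhs => rw [h2]
      rw [map_sum]
      simp only [map_smul, smul_eq_mul]
    · have h1 : φ =ᶠ[𝓝 x] fun _ => (0 : ℝ) := notMem_tsupport_iff_eventuallyEq.1 hx
      rw [h1.fderiv_eq]
      have h2 : ∀ i, (fun y => φ y * perp w y i) =ᶠ[𝓝 x] fun _ => (0 : ℝ) := fun i => by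
        filter_upwards [h1] with y hy
        rw [hy, zero_mul]
      simp only [(h2 _).fderiv_eq]
      simp
  simp only [hsum]
  rw [integral_finsetSum _ fun i _ => hFi i]
  exact Finset.sum_eq_zero fun i _ => hzero i

theorem IsCoflatCalibration.measure_sdiff (hw : IsCoflatCalibration (ball 0 1) w S) :
    μHE[N] (ball (0 : Eu (N + 1)) 1 \ (ball 0 1 \ S)) = 0 := by
  rw [sdiff_sdiff_right_self]
  exact measure_mono_null inter_subset_right hw.null

theorem IsCoflatCalibration.volume_sdiff (hw : IsCoflatCalibration (ball 0 1) w S) :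
    volume (ball (0 : Eu (N + 1)) 1 \ (ball 0 1 \ S)) = 0 := by
  have h1 := (Measure.euclideanHausdorffMeasure_zero_or_top (Nat.lt_succ_self N)
    (ball (0 : Eu (N + 1)) 1 \ (ball 0 1 \ S))).resolve_right (by rw [hw.measure_sdiff]; simp)
  have h2 : (μHE[N + 1] : Measure (Eu (N + 1))) = volume := by
    have := InnerProductSpace.euclideanHausdorffMeasure_eq_volume (V := Eu (N + 1))
    rwa [finrank_euclideanSpace_fin] at this
  rwa [← h2]

end CalibrationField

/-! ### Polar representation of currents of codimension one -/

section Polar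

open Module

variable {N : ℕ}

/-- The smooth retraction `y ↦ 2 y / (1 + |y|²)` of space into the unit ball, which fixes the unit
sphere. -/
def squash {V : Type*} [NormedAddCommGroup V] [InnerProductSpace ℝ V] (y : V) : V :=
  (2 / (1 + ‖y‖ ^ 2)) • y

section Squash

variable {V : Type*} [NormedAddCommGroup V] [InnerProductSpace ℝ V]

theorem contDiff_squash : ContDiff ℝ ∞ (squash : V → V) := by
  refine ContDiff.smul (contDiff_const.div (contDiff_const.add (contDiff_norm_sq ℝ)) fun y => ?_)
    contDiff_id
  positivity

theorem squash_zero : squash (0 : V) = 0 := by simp [squash]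

theorem norm_squash_le (y : V) : ‖squash y‖ ≤ 1 := by
  rw [squash, norm_smul, Real.norm_of_nonneg (by positivity), div_mul_eq_mul_div,
    div_le_one (by positivity)]
  nlinarith [sq_nonneg (‖y‖ - 1)]

theorem norm_sub_squash_le {e : V} (he : ‖e‖ = 1) (y : V) : ‖e - squash y‖ ≤ 4 * ‖e - y‖ := by
  have hpos : 0 < 1 + ‖y‖ ^ 2 := by positivity
  have h1 : e - squash y =
      (1 + ‖y‖ ^ 2)⁻¹ • ((2 : ℝ) • (e - y) + (‖y‖ ^ 2 - 1) • e) := by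
    rw [squash, eq_inv_smul_iff₀ hpos.ne', smul_sub, smul_smul, mul_div_cancel₀ _ hpos.ne']
    module
  have h2 : |‖y‖ ^ 2 - 1| ≤ (1 + ‖y‖) * ‖e - y‖ := by
    have h3 : |‖e‖ - ‖y‖| ≤ ‖e - y‖ := abs_norm_sub_norm_le e y
    rw [he] at h3
    have h4 : ‖y‖ ^ 2 - 1 = (1 + ‖y‖) * -(1 - ‖y‖) := by ring
    rw [h4, abs_mul, abs_neg, abs_of_nonneg (by positivity)]
    exact mul_le_mul_of_nonneg_left h3 (by positivity)
  rw [h1, norm_smul, norm_inv, Real.norm_of_nonneg hpos.le, inv_mul_le_iff₀ hpos]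
  calc ‖(2 : ℝ) • (e - y) + (‖y‖ ^ 2 - 1) • e‖
      ≤ 2 * ‖e - y‖ + (1 + ‖y‖) * ‖e - y‖ := by
        refine (norm_add_le _ _).trans (add_le_add ?_ ?_)
        · rw [norm_smul]; norm_num
        · rw [norm_smul, he, mul_one]; exact h2
    _ ≤ (1 + ‖y‖ ^ 2) * (4 * ‖e - y‖) := by
        have : 2 + (1 + ‖y‖) ≤ (1 + ‖y‖ ^ 2) * 4 := by nlinarith [sq_nonneg (‖y‖ - 1)]
        nlinarith [mul_le_mul_of_nonneg_right this (norm_nonneg (e - y))]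

end Squash

/-- Test form with a given underlying function. -/
def testForm {n k : ℕ} (f : Eu n → Covec n k) (hf : ContDiff ℝ ∞ f) (hs : HasCompactSupport f) :
    TestForm n k where
  toFun := f
  contDiff' := hf
  hasCompactSupport' := hs
  tsupport_subset' := subset_univ _

theorem testForm_apply {n k : ℕ} {f : Eu n → Covec n k} (hf : ContDiff ℝ ∞ f)
    (hs : HasCompactSupport f) (x : Eu n) : testForm f hf hs x = f x := rfl

/-- The polar representation of a current of codimension one by a measure `κ` and a field `ν` of
unit normals. -/
structure IsPolar (T : Current (N + 1) N) (κ : Measure (Eu (N + 1))) (ν : Eu (N + 1) → Eu (N + 1)) :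
    Prop where
  measurable : AEStronglyMeasurable ν κ
  unit : ∀ᵐ x ∂κ, ‖ν x‖ = 1
  apply_eq : ∀ φ : TestForm (N + 1) N, T φ = ∫ x, ⟪ν x, perpL N (φ x)⟫ ∂κ

/-- The measure `θ ℋᴺ⌊_Z`. -/
def multMeasure (Z : Set (Eu (N + 1))) (θ : Eu (N + 1) → ℕ) : Measure (Eu (N + 1)) :=
  (μHE[N].restrict Z).withDensity fun x => (θ x : ℝ≥0∞)

theorem multMeasure_absolutelyContinuous (Z : Set (Eu (N + 1))) (θ : Eu (N + 1) → ℕ) :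
    multMeasure Z θ ≪ μHE[N] :=
  (withDensity_absolutelyContinuous _ _).trans Measure.absolutelyContinuous_restrict

section GivenBy

variable {T : Current (N + 1) N} {Z : Set (Eu (N + 1))} {θ : Eu (N + 1) → ℕ}
  {ξ : Eu (N + 1) → MVec (N + 1) N}

theorem IsRectifiableTriple.aemeasurable_mult (h : IsRectifiableTriple Z θ ξ) :
    AEMeasurable (fun x => (θ x : NNReal)) (μHE[N].restrict Z) := by
  have h1 := h.integrable.aestronglyMeasurable.aemeasurable.real_toNNReal
  refine h1.congr (ae_of_all _ fun x => ?_)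
  simp

theorem multMeasure_eq (Z : Set (Eu (N + 1))) (θ : Eu (N + 1) → ℕ) :
    multMeasure Z θ =
      (μHE[N].restrict Z).withDensity fun x => ((θ x : NNReal) : ℝ≥0∞) := by
  simp [multMeasure]

theorem IsRectifiableTriple.integral_multMeasure (h : IsRectifiableTriple Z θ ξ)
    (f : Eu (N + 1) → ℝ) :
    ∫ x, f x ∂(multMeasure Z θ) = ∫ x in Z, (θ x : ℝ) * f x ∂μHE[N] := by
  rw [multMeasure_eq, integral_withDensity_eq_integral_smul₀ h.aemeasurable_mult]
  rfl

theorem IsRectifiableTriple.isFiniteMeasure (h : IsRectifiableTriple Z θ ξ) :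
    IsFiniteMeasure (multMeasure Z θ) := by
  refine isFiniteMeasure_withDensity ?_
  have h1 := h.integrable.lintegral_lt_top
  refine (lt_of_eq_of_lt ?_ h1).ne
  refine lintegral_congr fun x => ?_
  simp

/-- The orientations of the tangent planes have unit normals, so a current given by a rectifiable
set has a polar representation. -/
theorem Current.IsGivenBy.isPolar (h : T.IsGivenBy Z θ ξ) :
    IsPolar T (multMeasure Z θ) (fun x => hodge (ξ x)) := by
  obtain ⟨ht, hT⟩ := h
  have hunit : ∀ᵐ x ∂(μHE[N].restrict Z), ‖hodge (ξ x)‖ = 1 := by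
    filter_upwards [ht.orient] with x ⟨P, _, hP⟩ using norm_hodge_of_orients hP
  have hξ : ∀ᵐ x ∂(μHE[N].restrict Z), ‖ξ x‖ ≤ 1 := by
    filter_upwards [hunit] with x hx
    refine ContinuousLinearMap.opNorm_le_bound _ zero_le_one fun φ => ?_
    rw [apply_eq_inner_hodge, one_mul]
    refine (norm_inner_le_norm _ _).trans ?_
    rw [hx, one_mul]
    exact norm_perpL_le φ
  have hint : Integrable (fun x => (θ x : ℝ) • ξ x) (μHE[N].restrict Z) := by
    refine ht.integrable.norm.mono' (ht.integrable.aestronglyMeasurable.smul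
      ht.measurable_orient) ?_
    filter_upwards [hξ] with x hx
    rw [norm_smul]
    exact mul_le_of_le_one_right (norm_nonneg _) hx
  refine ⟨?_, ?_, fun φ => ?_⟩
  · exact (continuous_hodge.comp_aestronglyMeasurable ht.measurable_orient).mono_ac
      (withDensity_absolutelyContinuous _ _)
  · exact (withDensity_absolutelyContinuous _ _).ae_le hunit
  · rw [hT, currentOf_apply hint.locallyIntegrable, ht.integral_multMeasure]
    refine integral_congr_ae (ae_of_all _ fun x => ?_)
    simp only [smul_apply, smul_eq_mul]
    rw [apply_eq_inner_hodge]

end GivenBy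

variable {T : Current (N + 1) N} {κ : Measure (Eu (N + 1))} {ν : Eu (N + 1) → Eu (N + 1)}

theorem IsPolar.integrable [IsFiniteMeasure κ] (h : IsPolar T κ ν) : Integrable ν κ :=
  Integrable.of_bound h.measurable 1 (h.unit.mono fun _ hx => hx.le)

theorem IsPolar.integrable_inner [IsFiniteMeasure κ] (h : IsPolar T κ ν)
    {f : Eu (N + 1) → Eu (N + 1)} (hf : AEStronglyMeasurable f κ) {c : ℝ} (hc : ∀ x, ‖f x‖ ≤ c) :
    Integrable (fun x => ⟪ν x, f x⟫) κ := by
  refine Integrable.of_bound (h.measurable.inner hf) c ?_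
  filter_upwards [h.unit] with x hx
  refine (norm_inner_le_norm _ _).trans ?_
  rw [hx, one_mul]
  exact hc x

/-- Unit fields are approximated in `L¹` by smooth fields of norm at most one. -/
theorem IsPolar.exists_smooth_approx [IsFiniteMeasure κ] (h : IsPolar T κ ν) {ε : ℝ} (hε : 0 < ε) :
    ∃ G : Eu (N + 1) → Eu (N + 1), ContDiff ℝ ∞ G ∧ HasCompactSupport G ∧ (∀ x, ‖G x‖ ≤ 1) ∧
      κ.real univ - ∫ x, ⟪ν x, G x⟫ ∂κ ≤ ε := by
  obtain ⟨g, hgs, hg, hclose⟩ := (memLp_one_iff_integrable.2 h.integrable).exist_eLpNorm_sub_le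
    ENNReal.one_ne_top le_rfl (ε := ε / 4) (by positivity)
  have hgi : Integrable g κ := hg.continuous.integrable_of_hasCompactSupport hgs
  have hclose' : (∫ x, ‖ν x - g x‖ ∂κ) ≤ ε / 4 := by
    rw [eLpNorm_one_eq_lintegral_enorm] at hclose
    have h1 := integral_norm_eq_lintegral_enorm (h.integrable.sub hgi).aestronglyMeasurable
    have h2 : (∫ x, ‖ν x - g x‖ ∂κ) = _ := h1
    rw [h2]
    exact ENNReal.toReal_le_of_le_ofReal (by positivity) hclose
  have hGc : ContDiff ℝ ∞ fun x => squash (g x) := contDiff_squash.comp hg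
  have hi := h.integrable_inner hGc.continuous.aestronglyMeasurable fun x => norm_squash_le (g x)
  have hGs : HasCompactSupport fun x => squash (g x) := by
    refine hgs.mono fun x hx hx0 => hx ?_
    beta_reduce
    rw [hx0, squash_zero]
  have hG1 : ∀ x, ‖squash (g x)‖ ≤ 1 := fun x => norm_squash_le (g x)
  refine ⟨fun x => squash (g x), hGc, hGs, hG1, ?_⟩
  have h1 : κ.real univ - ∫ x, ⟪ν x, squash (g x)⟫ ∂κ = ∫ x, (1 - ⟪ν x, squash (g x)⟫) ∂κ := by
    rw [integral_sub (integrable_const _) hi]; simp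
  rw [h1]
  calc ∫ x, (1 - ⟪ν x, squash (g x)⟫) ∂κ ≤ ∫ x, 4 * ‖ν x - g x‖ ∂κ := by
        refine integral_mono_ae ((integrable_const _).sub hi)
          ((h.integrable.sub hgi).norm.const_mul 4) ?_
        filter_upwards [h.unit] with x hx
        have h2 : 1 - ⟪ν x, squash (g x)⟫ = ⟪ν x, ν x - squash (g x)⟫ := by
          rw [inner_sub_right, real_inner_self_eq_norm_sq, hx, one_pow]
        simp only [h2]
        refine (real_inner_le_norm _ _).trans ?_
        rw [hx, one_mul]
        exact norm_sub_squash_le hx _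
    _ ≤ ε := by rw [integral_const_mul]; linarith

/-- The total mass of the measure of a polar representation is at most the mass of the current. -/
theorem IsPolar.measure_univ_le_mass [IsFiniteMeasure κ] (h : IsPolar T κ ν) :
    κ univ ≤ T.mass := by
  refine ENNReal.le_of_forall_pos_le_add fun ε hε _ => ?_
  obtain ⟨G, hG, hGs, hG1, hle⟩ := h.exists_smooth_approx (NNReal.coe_pos.2 hε)
  have hφ : ∀ x, ‖testForm (fun x => volCovec N (G x)) ((volCovec N).contDiff.comp hG)
      (hGs.comp_left (map_zero _)) x‖ ≤ 1 := fun x => (norm_volCovec_le _).trans (hG1 x)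
  have hTφ : T (testForm (fun x => volCovec N (G x)) ((volCovec N).contDiff.comp hG)
      (hGs.comp_left (map_zero _))) = ∫ x, ⟪ν x, G x⟫ ∂κ := by
    rw [h.apply_eq]
    refine integral_congr_ae (ae_of_all _ fun x => ?_)
    simp only [testForm_apply, perpL_volCovec]
  have hmass : ENNReal.ofReal (∫ x, ⟪ν x, G x⟫ ∂κ) ≤ T.mass := by
    rw [← hTφ]
    exact le_iSup₂_of_le (f := fun (φ : TestForm (N + 1) N) (_ : ∀ x, ‖φ x‖ ≤ 1) =>
      ENNReal.ofReal (T φ)) _ hφ le_rfl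
  calc κ univ = ENNReal.ofReal (κ.real univ) := (ofReal_measureReal (measure_ne_top κ univ)).symm
    _ ≤ ENNReal.ofReal ((∫ x, ⟪ν x, G x⟫ ∂κ) + ε) := ENNReal.ofReal_le_ofReal (by linarith)
    _ ≤ ENNReal.ofReal (∫ x, ⟪ν x, G x⟫ ∂κ) + ENNReal.ofReal ε := ENNReal.ofReal_add_le
    _ ≤ T.mass + ε := by
        rw [ENNReal.ofReal_coe_nnreal]; gcongr

theorem IsPolar.mass_le [IsFiniteMeasure κ] (h : IsPolar T κ ν) : T.mass ≤ κ univ := by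
  refine iSup₂_le fun φ hφ => ?_
  rw [← ofReal_measureReal (μ := κ) (s := univ) (by finiteness), h.apply_eq]
  refine ENNReal.ofReal_le_ofReal ((le_abs_self _).trans ?_)
  rw [← Real.norm_eq_abs]
  refine (norm_integral_le_of_norm_le_const (C := 1) ?_).trans (by simp)
  filter_upwards [h.unit] with x hx
  refine (norm_inner_le_norm _ _).trans ?_
  rw [hx, one_mul]
  exact (norm_perpL_le _).trans (hφ x)

/-- Where the current vanishes, so does `ν`, tested with the forms `g det (b, ·)`; but `ν` has norm
one. -/
theorem IsPolar.measure_eq_zero_of_isVanishingOn [IsFiniteMeasure κ] (h : IsPolar T κ ν)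
    {O : Set (Eu (N + 1))} (hO : IsOpen O)
    (hvan : Distribution.IsVanishingOn (T : TestForm (N + 1) N → ℝ) O) : κ O = 0 := by
  have h0 : ∀ᵐ x ∂κ, x ∈ O → ν x = 0 := by
    refine hO.ae_eq_zero_of_integral_contDiff_smul_eq_zero
      (h.integrable.locallyIntegrable.locallyIntegrableOn _) fun g hg hgs hgO => ?_
    have hi : Integrable (fun x => g x • ν x) κ := by
      obtain ⟨c, hc⟩ := hgs.exists_bound_of_continuous hg.continuous
      exact h.integrable.bdd_smul (C := c) hg.continuous.aestronglyMeasurable (ae_of_all _ hc)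
    refine ext_inner_right ℝ fun b => ?_
    rw [inner_zero_left, real_inner_comm, ← integral_inner hi]
    have h1 := hvan (testForm (fun x => g x • volCovec N b) (hg.smul contDiff_const)
      hgs.smul_right) ((tsupport_smul_subset_left g _).trans hgO)
    rw [h.apply_eq] at h1
    rw [← h1]
    refine integral_congr_ae (ae_of_all _ fun x => ?_)
    simp only [testForm_apply, map_smul, perpL_volCovec, real_inner_smul_right]
    rw [real_inner_comm]
  rw [measure_eq_zero_iff_ae_notMem]
  filter_upwards [h0, h.unit] with x hx1 hx2 hx3
  rw [hx1 hx3, norm_zero] at hx2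
  exact zero_ne_one hx2

/-- The measure of a polar representation is carried by the support of the current. -/
theorem IsPolar.measure_compl_spt [IsFiniteMeasure κ] (h : IsPolar T κ ν) : κ T.sptᶜ = 0 := by
  refine measure_null_of_locally_null _ fun x hx => ?_
  obtain ⟨O, h1, h2, h3⟩ := (Distribution.notMem_dsupport_iff x).1 hx
  exact ⟨O, mem_nhdsWithin_of_mem_nhds (h2.mem_nhds h3), h.measure_eq_zero_of_isVanishingOn h2 h1⟩

theorem IsPolar.measure_ne_zero (h : IsPolar T κ ν) {O : Set (Eu (N + 1))} (hO : IsOpen O)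
    (hne : (O ∩ T.spt).Nonempty) : κ O ≠ 0 := by
  obtain ⟨x, hxO, hx⟩ := hne
  intro h0
  refine (Distribution.notMem_dsupport_iff x).2 ⟨O, fun φ hφ => ?_, hO, hxO⟩ hx
  rw [h.apply_eq]
  refine integral_eq_zero_of_ae ?_
  filter_upwards [measure_eq_zero_iff_ae_notMem.1 h0] with y hy
  rw [image_eq_zero_of_notMem_tsupport fun hy' => hy (hφ hy'), map_zero, inner_zero_right]
  rfl

end Polar

/-! ### Calibrated cones -/

section Calibrated

open Module

variable {m : ℕ}

/-- Forms that vanish on a set are annihilated by the currents carried by it. -/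
theorem fundCurrent_eq_zero {n k : ℕ} {M : Set (Eu n)}
    {ξ : Eu n → MVec n k} {φ : TestForm n k} (hφ : ∀ x ∈ M, φ x = 0) : fundCurrent M ξ φ = 0 := by
  unfold fundCurrent currentOf
  rw [TestFunction.integralAgainstBilinCLM_apply]
  split_ifs with h
  · refine setIntegral_eq_zero_of_forall_eq_zero fun x hx => ?_
    rw [hφ x hx, map_zero, zero_apply]
  · rfl

/-- A current of codimension one without boundary in `U` has a curl free vector measure: it is
tested with the forms `h det (b, a, ·)`. -/
theorem IsPolar.isCurlFreeOn {T : Current (m + 2) (m + 1)} {κ : Measure (Eu (m + 2))}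
    {ν : Eu (m + 2) → Eu (m + 2)} (h : IsPolar T κ ν) [IsFiniteMeasure κ] {U : Set (Eu (m + 2))}
    (hU : ∀ φ : TestForm (m + 2) m, tsupport φ ⊆ U → T.bdry φ = 0) : IsCurlFreeOn ν κ U := by
  intro f hf hfs hfU a b
  let φ : TestForm (m + 2) m := testForm (fun x => f x • (volCovec (m + 1) b).curryLeft a)
    (hf.smul contDiff_const) hfs.smul_right
  have hT := hU φ ((tsupport_smul_subset_left f _).trans hfU)
  have hd : ∀ x, perpL (m + 1) (dTest (m + 2) m φ x) = fderiv ℝ f x a • b - fderiv ℝ f x b • a := by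
    intro x
    rw [dTest_apply]
    have h1 : fderiv ℝ (φ : Eu (m + 2) → Covec (m + 2) m) x =
        (fderiv ℝ f x).smulRight ((volCovec (m + 1) b).curryLeft a) :=
      ((hf.differentiable (by simp) x).hasFDerivAt.smul_const _).fderiv
    rw [extDeriv, h1, alternatizeUncurryFin_smulRight_volForm, map_sub, map_smul, map_smul,
      perpL_volCovec, perpL_volCovec]
  have h2 : T.bdry φ = T (dTest (m + 2) m φ) := rfl
  rw [h2, h.apply_eq] at hT
  simp only [hd, inner_sub_right, real_inner_smul_right] at hT
  have hc : ∀ c : Eu (m + 2), Continuous fun x => fderiv ℝ f x c := fun c =>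
    (hf.continuous_fderiv (by simp)).clm_apply continuous_const
  have hi : ∀ c e : Eu (m + 2), Integrable (fun x => fderiv ℝ f x c * ⟪ν x, e⟫) κ := by
    intro c e
    obtain ⟨K, hK⟩ := (hfs.fderiv_apply (𝕜 := ℝ) c).exists_bound_of_continuous (hc c)
    exact (h.integrable.inner_const e).bdd_mul (c := K) (hc c).aestronglyMeasurable
      (ae_of_all _ hK)
  rw [integral_sub (hi a b) (hi b a), sub_eq_zero] at hT
  exact hT

variable {w : Eu (m + 2) → Covec (m + 2) (m + 1)} {S C : Set (Eu (m + 2))}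
  {T : Current (m + 2) (m + 1)} {κ : Measure (Eu (m + 2))} {ν : Eu (m + 2) → Eu (m + 2)}

/-- Equality in the calibration inequality: if the pairing with the calibration exhausts the mass,
then the calibration is the unit normal, and there is no mass outside the ball. -/
theorem IsPolar.ae_eq_calField (h : IsPolar T κ ν) [IsFiniteMeasure κ]
    (hw : IsCoflatCalibration (ball 0 1) w S) (hS : κ S = 0)
    (hcal : κ.real univ ≤ ∫ x in ball 0 1, ⟪ν x, perp w x⟫ ∂κ) :
    ν =ᵐ[κ] calField w S ∧ κ (ball 0 1)ᶜ = 0 := by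
  have hvm : AEStronglyMeasurable (calField w S) κ := hw.measurable_calField.aestronglyMeasurable
  have hi := h.integrable_inner hvm hw.norm_calField_le
  have heq : ∫ x in ball 0 1, ⟪ν x, perp w x⟫ ∂κ = ∫ x, ⟪ν x, calField w S x⟫ ∂κ := by
    have hnot : ∀ᵐ x ∂κ, x ∉ S := measure_eq_zero_iff_ae_notMem.1 hS
    rw [← integral_indicator measurableSet_ball]
    refine integral_congr_ae ?_
    filter_upwards [hnot] with x hx
    by_cases hxb : x ∈ ball (0 : Eu (m + 2)) 1
    · rw [indicator_of_mem hxb, calField,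
        indicator_of_mem (show x ∈ ball (0 : Eu (m + 2)) 1 \ S from ⟨hxb, hx⟩)]
    · rw [indicator_of_notMem hxb, calField, indicator_of_notMem fun h' => hxb h'.1,
        inner_zero_right]
  rw [heq] at hcal
  have hle : ∀ᵐ x ∂κ, 0 ≤ 1 - ⟪ν x, calField w S x⟫ := by
    filter_upwards [h.unit] with x hx
    have := real_inner_le_norm (ν x) (calField w S x)
    rw [hx, one_mul] at this
    linarith [hw.norm_calField_le x]
  have hint : ∫ x, (1 - ⟪ν x, calField w S x⟫) ∂κ = 0 := by
    refine le_antisymm ?_ (integral_nonneg_of_ae hle)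
    rw [integral_sub (integrable_const _) hi]
    simp only [integral_const, smul_eq_mul, mul_one]
    linarith
  have hone : ∀ᵐ x ∂κ, 1 - ⟪ν x, calField w S x⟫ = 0 :=
    (integral_eq_zero_iff_of_nonneg_ae hle ((integrable_const _).sub hi)).1 hint
  have hae : ν =ᵐ[κ] calField w S := by
    filter_upwards [hone, h.unit] with x h1 h2
    have h3 : ‖ν x - calField w S x‖ ^ 2 ≤ 0 := by
      rw [norm_sub_sq_real, h2]
      nlinarith [hw.norm_calField_le x, norm_nonneg (calField w S x)]
    have h4 : ‖ν x - calField w S x‖ = 0 := by nlinarith [norm_nonneg (ν x - calField w S x)]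
    exact sub_eq_zero.1 (norm_eq_zero.1 h4)
  refine ⟨hae, ?_⟩
  rw [measure_eq_zero_iff_ae_notMem]
  filter_upwards [hae, h.unit] with x h1 h2 h3
  rw [h1, calField, indicator_of_notMem fun h' => h3 h'.1, norm_zero] at h2
  exact zero_ne_one h2

/-- A calibrated current without boundary in the ball gives a weakly divergence free field, the
normal field of the calibration, for which `v κ = ν κ` is curl free. -/
theorem IsPolar.isCalibratingField (h : IsPolar T κ ν) [IsFiniteMeasure κ]
    (hw : IsCoflatCalibration (ball 0 1) w S) (hS : κ S = 0)
    (hcal : κ.real univ ≤ ∫ x in ball 0 1, ⟪ν x, perp w x⟫ ∂κ)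
    (hspt : T.spt = C ∩ closedBall 0 1)
    (hbdry : ∀ φ : TestForm (m + 2) m, tsupport φ ⊆ ball 0 1 → T.bdry φ = 0) :
    IsCalibratingField (calField w S) (ball 0 1 \ S) κ C := by
  obtain ⟨hae, hball⟩ := h.ae_eq_calField hw hS hcal
  refine ⟨hw.measurable_calField, hw.norm_calField_le, hw.isOpen_regular, sdiff_subset,
    hw.continuousOn_calField, hw.volume_sdiff, fun φ hφ hφs hφU => ?_, ?_, ?_, ?_, ?_, ?_⟩
  · exact integral_fderiv_eq_zero_of_removable (d := m + 1) (by simp) (Nat.succ_pos m)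
      hw.measurable_calField hw.norm_calField_le hw.isOpen_regular hw.measure_sdiff
      (fun φ hφ hφs hφW => hw.integral_fderiv_of_tsupport_subset hφ hφs hφW) hφ hφs hφU
  · refine measure_mono_null (t := (ball 0 1)ᶜ ∪ S) (fun x hx => ?_) (measure_union_null hball hS)
    by_cases hxb : x ∈ ball (0 : Eu (m + 2)) 1
    · right
      by_contra hxS
      exact hx ⟨hxb, hxS⟩
    · exact Or.inl hxb
  · refine measure_mono_null (t := T.sptᶜ) (fun x hx hx' => ?_) h.measure_compl_spt
    rw [hspt] at hx'
    exact hx hx'.1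
  · filter_upwards [hae, h.unit] with x h1 h2
    rw [← h1, h2]
  · intro f hf hfs hfU a b
    have hc := h.isCurlFreeOn hbdry f hf hfs hfU a b
    have e : ∀ c e : Eu (m + 2), ∫ y, fderiv ℝ f y c * ⟪calField w S y, e⟫ ∂κ =
        ∫ y, fderiv ℝ f y c * ⟪ν y, e⟫ ∂κ := fun c e => by
      refine integral_congr_ae ?_
      filter_upwards [hae] with y hy
      rw [hy]
    rw [e, e, hc]
  · rintro O hO ⟨x, hxO, hxC, hxb⟩
    refine h.measure_ne_zero hO ⟨x, hxO, ?_⟩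
    rw [hspt]
    exact ⟨hxC, ball_subset_closedBall hxb⟩

/-- A cone whose part in the unit ball has finite measure meets the unit sphere in a null set: the
ball contains infinitely many disjoint scaled copies of this intersection. -/
theorem measure_eq_zero_of_measure_coneOver_ne_top {n d : ℕ} {M : Set (Eu n)}
    (hMm : MeasurableSet M) (hMs : M ⊆ sphere 0 1)
    (hfin : μHE[d] (coneOver M ∩ closedBall 0 1) ≠ ⊤) : μHE[d] M = 0 := by
  set r : ℕ → ℝ := fun k => 1 - 1 / ((k : ℝ) + 2) with hr
  have hrange : ∀ k, 1 / 2 ≤ r k ∧ r k < 1 := by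
    intro k
    have h2 : (0 : ℝ) < (k : ℝ) + 2 := by positivity
    constructor
    · have : 1 / ((k : ℝ) + 2) ≤ 1 / 2 := one_div_le_one_div_of_le (by norm_num) (by simp)
      simp only [hr]; linarith
    · have : 0 < 1 / ((k : ℝ) + 2) := by positivity
      simp only [hr]; linarith
  have hrinj : Function.Injective r := by
    intro a b hab
    simp only [hr, sub_right_inj, one_div, inv_inj, add_left_inj, Nat.cast_inj] at hab
    exact hab
  have hr0 : ∀ k, 0 < r k := fun k => by linarith [(hrange k).1]
  set A : ℕ → Set (Eu n) := fun k => (fun x => r k • x) '' M with hA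
  have hAm : ∀ k, MeasurableSet (A k) := fun k =>
    (Homeomorph.smulOfNeZero (r k) (hr0 k).ne').measurableEmbedding.measurableSet_image' hMm
  have hdisj : Pairwise (Function.onFun Disjoint A) := by
    intro i j hij
    rw [Function.onFun, Set.disjoint_left]
    rintro _ ⟨x, hx, rfl⟩ ⟨y, hy, hxy⟩
    have h1 := congrArg norm hxy
    simp only [norm_smul, mem_sphere_zero_iff_norm.1 (hMs hx), mem_sphere_zero_iff_norm.1 (hMs hy),
      mul_one, Real.norm_of_nonneg (hr0 _).le] at h1
    exact hij (hrinj h1.symm)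
  have hsub : (⋃ k, A k) ⊆ coneOver M ∩ closedBall 0 1 := by
    refine iUnion_subset fun k => ?_
    rintro _ ⟨x, hx, rfl⟩
    refine ⟨⟨r k, (hr0 k).le, x, hx, rfl⟩, ?_⟩
    rw [mem_closedBall_zero_iff, norm_smul, mem_sphere_zero_iff_norm.1 (hMs hx), mul_one,
      Real.norm_of_nonneg (hr0 k).le]
    exact (hrange k).2.le
  have hlow : ∀ k, μHE[d] M ≤ (2 : NNReal) ^ d * μHE[d] (A k) := by
    intro k
    have h1 : LipschitzOnWith 2 (fun x : Eu n => (r k)⁻¹ • x) (A k) := by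
      refine LipschitzWith.lipschitzOnWith (LipschitzWith.of_dist_le_mul fun x y => ?_)
      rw [dist_smul₀, norm_inv, Real.norm_of_nonneg (hr0 k).le]
      refine mul_le_mul_of_nonneg_right ?_ dist_nonneg
      rw [inv_le_comm₀ (hr0 k) (by norm_num)]
      simpa using (hrange k).1
    have h2 := euclideanHausdorffMeasure_image_le h1 d
    refine le_trans (measure_mono fun x hx => ?_) h2
    refine ⟨r k • x, ⟨x, hx, rfl⟩, ?_⟩
    simp only [smul_smul, inv_mul_cancel₀ (hr0 k).ne', one_smul]
  by_contra hne
  have h2 : (((2 : NNReal) ^ d : NNReal) : ℝ≥0∞) ≠ ⊤ := ENNReal.coe_ne_top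
  have h20 : (((2 : NNReal) ^ d : NNReal) : ℝ≥0∞) ≠ 0 := by simp
  have hlow' : ∀ k, μHE[d] M / (((2 : NNReal) ^ d : NNReal) : ℝ≥0∞) ≤ μHE[d] (A k) := fun k =>
    ENNReal.div_le_of_le_mul' (by simpa using hlow k)
  have hsum : ∑' k : ℕ, μHE[d] (A k) = ⊤ := by
    refine top_unique ?_
    rw [← ENNReal.tsum_const_eq_top_of_ne_zero (α := ℕ) (ENNReal.div_ne_zero.2 ⟨hne, h2⟩)]
    exact ENNReal.tsum_le_tsum hlow'
  rw [← measure_iUnion hdisj hAm] at hsum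
  exact hfin (top_unique (hsum ▸ measure_mono hsub))

open scoped Pointwise in
/-- A cone whose part in the unit ball has finite measure of codimension one is a null set. -/
theorem volume_coneOver_eq_zero {M : Set (Eu (m + 2))}
    (hfin : μHE[m + 1] (coneOver M ∩ closedBall 0 1) ≠ ⊤) : volume (coneOver M) = 0 := by
  have h1 := (Measure.euclideanHausdorffMeasure_zero_or_top (Nat.lt_succ_self (m + 1))
    (coneOver M ∩ closedBall 0 1)).resolve_right hfin
  have h2 : (μHE[m + 1 + 1] : Measure (Eu (m + 2))) = volume :=
    EuclideanSpace.euclideanHausdorffMeasure_eq_volume (m + 2)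
  rw [h2] at h1
  have hcov : coneOver M ⊆ ⋃ k : ℕ, ((k : ℝ) + 1) • (coneOver M ∩ closedBall 0 1) := by
    intro x hx
    obtain ⟨k, hk⟩ := exists_nat_ge ‖x‖
    have hk0 : (0 : ℝ) < (k : ℝ) + 1 := by positivity
    refine mem_iUnion.2 ⟨k, ?_⟩
    rw [mem_smul_set_iff_inv_smul_mem₀ hk0.ne']
    refine ⟨smul_mem_coneOver hx (inv_nonneg.2 hk0.le), ?_⟩
    rw [mem_closedBall_zero_iff, norm_smul, norm_inv, Real.norm_of_nonneg hk0.le,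
      inv_mul_le_one₀ hk0]
    linarith
  refine measure_mono_null hcov (measure_iUnion_null fun k => ?_)
  rw [Measure.addHaar_smul, h1, mul_zero]

/-- The calibrated cone, its integration current, and the calibration fulfil the hypotheses under
which the cone is a jump set with unit jumps. -/
theorem IsCalibratedBy.exists_jumpFunction {M : Set (Eu (m + 2))}
    {ξ : Eu (m + 2) → MVec (m + 2) m} (hM : IsSubmanifold m M) (hMc : IsCompact M)
    (hMs : M ⊆ sphere 0 1) (hw : IsCoflatCalibration (ball 0 1) w S)
    (hcal : IsCalibratedBy (fundCurrent M ξ) w (ball 0 1) (coneOver M ∩ closedBall 0 1)) :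
    ∃ κ : Measure (Eu (m + 2)), IsFiniteMeasure κ ∧
      IsCalibratingField (calField w S) (ball 0 1 \ S) κ (coneOver M) ∧
      IsTwoSidedCone (coneOver M) ∧ ∃ u, IsJumpFunction (calField w S) κ (coneOver M) u ∧
        UnitJumps (coneOver M) u := by
  obtain ⟨T, -, ⟨hspt, hmass⟩, hbd, Z, θ, η, hT, hpair⟩ := hcal.calibrated
  set E := coneOver M ∩ closedBall (0 : Eu (m + 2)) 1 with hE
  have hpolar := hT.isPolar
  have hfm := hT.1.isFiniteMeasure
  set κ := multMeasure Z θ with hκ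
  -- the mass of `T` is both the mass of `κ` and, by assumption, the measure of `E`
  have hκE : κ univ = μHE[m + 1] E :=
    le_antisymm (hpolar.measure_univ_le_mass.trans hmass.le) (hmass.ge.trans hpolar.mass_le)
  have hfin : μHE[m + 1] E ≠ ⊤ := by rw [← hκE]; exact measure_ne_top κ univ
  have hS : κ S = 0 := multMeasure_absolutelyContinuous Z θ hw.null
  have hcal' : κ.real univ ≤ ∫ x in ball 0 1, ⟪hodge (η x), perp w x⟫ ∂κ := by
    rw [measureReal_def, hκE, hpair, pairing]
    refine le_of_eq ?_
    rw [← integral_indicator measurableSet_ball, hT.1.integral_multMeasure, inter_comm,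
      ← Measure.restrict_restrict measurableSet_ball, ← integral_indicator measurableSet_ball]
    refine integral_congr_ae (ae_of_all _ fun x => ?_)
    by_cases hx : x ∈ ball (0 : Eu (m + 2)) 1
    · simp only [indicator_of_mem hx]
      rw [apply_eq_inner_hodge]
      rfl
    · simp only [indicator_of_notMem hx, mul_zero]
  have hbdry : ∀ φ : TestForm (m + 2) m, tsupport φ ⊆ ball 0 1 → T.bdry φ = 0 := by
    intro φ hφ
    rw [hbd]
    refine fundCurrent_eq_zero fun x hx => ?_
    refine image_eq_zero_of_notMem_tsupport fun hx' => ?_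
    have h1 := mem_ball_zero_iff.1 (hφ hx')
    rw [mem_sphere_zero_iff_norm.1 (hMs hx)] at h1
    exact lt_irrefl _ h1
  have hfield := hpolar.isCalibratingField hw hS hcal' hspt hbdry
  have hcone := isTwoSidedCone_coneOver hM hMc hMs (volume_coneOver_eq_zero hfin)
  obtain ⟨u, hu⟩ := hfield.exists_isJumpFunction hcone
  -- the part of `E` on the sphere is negligible
  have hM0 := measure_eq_zero_of_measure_coneOver_ne_top hMc.measurableSet hMs hfin
  have hEball : μHE[m + 1] E ≤ μHE[m + 1] (coneOver M ∩ ball 0 1) := by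
    have hsub : E ⊆ (coneOver M ∩ ball 0 1) ∪ M := by
      rintro x ⟨hxC, hxb⟩
      rcases (mem_closedBall_zero_iff.1 hxb).lt_or_eq with h1 | h1
      · exact Or.inl ⟨hxC, mem_ball_zero_iff.2 h1⟩
      · obtain ⟨p, hp, hxp⟩ := (mem_coneOver_iff hMs).1 hxC
        rw [h1, one_smul] at hxp
        exact Or.inr (hxp ▸ hp)
    refine (measure_mono hsub).trans ((measure_union_le _ _).trans ?_)
    rw [hM0, add_zero]
  refine ⟨κ, hfm, hfield, hcone, u, hu, ?_⟩
  refine hu.unitJumps hfield hcone (d := m + 1) (by simp) (Nat.succ_pos m) hT.1.measurableSet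
    (θ := fun x => (θ x : ℝ≥0∞)) ?_ ?_ rfl (hκE.le.trans hEball) hw.measure_sdiff
  · refine hT.1.aemeasurable_mult.coe_nnreal_ennreal.congr (ae_of_all _ fun x => ?_)
    simp
  · intro x hx
    exact_mod_cast hT.1.one_le x hx

end Calibrated

/-! ### Existence of maximal integral curves -/

section IntegralCurves

variable {n : ℕ}

/-- An integral curve of `v` in `W`, defined on an open interval containing `0`, through `x` at time
`0`. -/
structure IsLocalCurve (v : Eu n → Eu n) (W : Set (Eu n)) (x : Eu n) (p : Set ℝ × (ℝ → Eu n)) :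
    Prop where
  isOpen : IsOpen p.1
  zero_mem : 0 ∈ p.1
  ordConnected : p.1.OrdConnected
  mapsTo : MapsTo p.2 p.1 W
  hasDerivAt : ∀ t ∈ p.1, HasDerivAt p.2 (v (p.2 t)) t
  start : p.2 0 = x

/-- The Picard–Lindelöf theorem. -/
theorem exists_isLocalCurve {v : Eu n → Eu n} {W : Set (Eu n)} (hW : IsOpen W)
    (hv : ContDiffOn ℝ 1 v W) {x : Eu n} (hx : x ∈ W) : ∃ p, IsLocalCurve v W x p := by
  obtain ⟨γ, hγ0, ε, hε, hγ⟩ := (hv.contDiffAt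
    (hW.mem_nhds hx)).exists_forall_mem_closedBall_exists_eq_forall_mem_Ioo_hasDerivAt₀ 0
  have hc : ContinuousAt γ 0 := (hγ 0 (by simp [hε])).continuousAt
  obtain ⟨δ, hδ, hball⟩ := Metric.eventually_nhds_iff_ball.1
    (hc.eventually (by rw [hγ0]; exact hW.eventually_mem hx))
  have hmin : 0 < min ε δ := lt_min hε hδ
  refine ⟨(Ioo (-min ε δ) (min ε δ), γ), isOpen_Ioo, ⟨by simpa using hmin, hmin⟩, ordConnected_Ioo,
    fun t ht => hball t ?_, fun t ht => hγ t ?_, hγ0⟩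
  · rw [mem_ball_zero_iff, Real.norm_eq_abs, abs_lt]
    exact ⟨by linarith [ht.1, min_le_right ε δ], by linarith [ht.2, min_le_right ε δ]⟩
  · exact ⟨by linarith [ht.1, min_le_left ε δ], by linarith [ht.2, min_le_left ε δ]⟩

/-- Through each point passes a maximal integral curve, by the local existence theorem and Zorn's
lemma. Uniqueness is not needed, since maximality refers to extensions of a given curve. -/
theorem exists_isMaximalIntegralCurve {v : Eu n → Eu n} {W : Set (Eu n)} (hW : IsOpen W)
    (hv : ContDiffOn ℝ 1 v W) {x : Eu n} (hx : x ∈ W) :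
    ∃ γ I, IsMaximalIntegralCurve v W γ I ∧ x ∈ γ '' I := by
  classical
  obtain ⟨p₀, hp₀⟩ := exists_isLocalCurve hW hv hx
  let r : {p // IsLocalCurve v W x p} → {p // IsLocalCurve v W x p} → Prop := fun p q =>
    p.1.1 ⊆ q.1.1 ∧ EqOn q.1.2 p.1.2 p.1.1
  obtain ⟨⟨⟨I, γ⟩, hp⟩, hmax⟩ := exists_maximal_of_chains_bounded (r := r) (fun c hc => by
    rcases c.eq_empty_or_nonempty with rfl | ⟨a₀, ha₀⟩
    · exact ⟨⟨p₀, hp₀⟩, by simp⟩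
    let J : Set ℝ := ⋃₀ ((fun a => a.1.1) '' c)
    let η : ℝ → Eu n := fun t => if h : ∃ a ∈ c, t ∈ a.1.1 then h.choose.1.2 t else 0
    have hη : ∀ a ∈ c, EqOn η a.1.2 a.1.1 := by
      intro a ha t ht
      have hex : ∃ a ∈ c, t ∈ a.1.1 := ⟨a, ha, ht⟩
      have h1 : η t = hex.choose.1.2 t := dif_pos hex
      rw [h1]
      obtain ⟨hb, hbt⟩ := hex.choose_spec
      rcases eq_or_ne hex.choose a with h2 | h2
      · rw [h2]
      · rcases hc hb ha h2 with h3 | h3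
        · exact (h3.2 hbt).symm
        · exact h3.2 ht
    have hJ : ∀ t ∈ J, ∃ a ∈ c, t ∈ a.1.1 := by
      rintro t ⟨_, ⟨a, ha, rfl⟩, ht⟩
      exact ⟨a, ha, ht⟩
    have hsub : ∀ a ∈ c, a.1.1 ⊆ J := fun a ha t ht => ⟨_, ⟨a, ha, rfl⟩, ht⟩
    have hloc : IsLocalCurve v W x (J, η) := by
      refine ⟨isOpen_sUnion ?_, hsub a₀ ha₀ a₀.2.zero_mem, ?_, fun t ht => ?_, fun t ht => ?_, ?_⟩
      · rintro _ ⟨a, -, rfl⟩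
        exact a.2.isOpen
      · refine IsPreconnected.ordConnected (isPreconnected_sUnion 0 _ ?_ ?_)
        · rintro _ ⟨a, -, rfl⟩
          exact a.2.zero_mem
        · rintro _ ⟨a, -, rfl⟩
          exact a.2.ordConnected.isPreconnected
      · obtain ⟨a, ha, hat⟩ := hJ t ht
        change η t ∈ W
        rw [hη a ha hat]
        exact a.2.mapsTo hat
      · obtain ⟨a, ha, hat⟩ := hJ t ht
        change HasDerivAt η (v (η t)) t
        rw [hη a ha hat]
        refine (a.2.hasDerivAt t hat).congr_of_eventuallyEq ?_
        filter_upwards [a.2.isOpen.mem_nhds hat] with s hs using hη a ha hs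
      · change η 0 = x
        rw [hη a₀ ha₀ a₀.2.zero_mem]
        exact a₀.2.start
    exact ⟨⟨(J, η), hloc⟩, fun a ha => ⟨hsub a ha, hη a ha⟩⟩)
    (fun h1 h2 => ⟨h1.1.trans h2.1, fun t ht => (h2.2 (h1.1 ht)).trans (h1.2 ht)⟩)
  refine ⟨γ, I, ⟨hp.isOpen, ⟨0, hp.zero_mem⟩, hp.ordConnected, hp.mapsTo,
    fun t ht => (hp.hasDerivAt t ht).hasDerivWithinAt, ?_⟩, 0, hp.zero_mem, hp.start⟩
  intro J η hJ hJc hIJ hmaps hη hEq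
  have hloc : IsLocalCurve v W x (J, η) := ⟨hJ, hIJ hp.zero_mem, hJc, hmaps,
    fun t ht => (hη t ht).hasDerivAt (hJ.mem_nhds ht), (hEq hp.zero_mem).trans hp.start⟩
  exact (hmax ⟨(J, η), hloc⟩ ⟨hIJ, hEq⟩).1

theorem multGeOne_of_contDiffOn {v : Eu n → Eu n} {W E : Set (Eu n)} (hW : IsOpen W)
    (hv : ContDiffOn ℝ 1 v W) : MultGeOne v W E := by
  rintro x ⟨-, hx⟩
  obtain ⟨γ, I, hγ, hxγ⟩ := exists_isMaximalIntegralCurve hW hv hx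
  exact ⟨γ '' I, ⟨γ, I, hγ, rfl⟩, hxγ⟩

end IntegralCurves

/-! ### Multiplicity of calibrated cones -/

section Multiplicity

variable {m : ℕ} {w : Eu (m + 2) → Covec (m + 2) (m + 1)} {S : Set (Eu (m + 2))}

/-- The jump function of a calibrated cone takes two values and increases across the cone along the
integral curves, so that none of them returns to the cone. -/
theorem IsCalibratedBy.multLeOne {M : Set (Eu (m + 2))} {ξ : Eu (m + 2) → MVec (m + 2) m}
    (hM : IsSubmanifold m M) (hMc : IsCompact M) (hMs : M ⊆ sphere 0 1)
    (hw : IsCoflatCalibration (ball 0 1) w S)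
    (hcal : IsCalibratedBy (fundCurrent M ξ) w (ball 0 1) (coneOver M ∩ closedBall 0 1)) :
    MultLeOne (perp w) (ball 0 1 \ S) (coneOver M ∩ closedBall 0 1) := by
  obtain ⟨κ, hfin, hfield, hcone, u, hu, hunit⟩ := hcal.exists_jumpFunction hM hMc hMs hw
  obtain ⟨c, hc⟩ := hu.exists_two_values hfield hcone hunit
    (by rw [← Module.finrank_eq_rank, finrank_euclideanSpace_fin]; norm_cast; omega)
    (hu.locConst.finite_image hcone)
  rintro Γ ⟨γ, I, hγ, rfl⟩
  have hderiv : ∀ t ∈ I, HasDerivAt γ (calField w S (γ t)) t := by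
    intro t ht
    rw [calField, indicator_of_mem (hγ.mapsTo ht)]
    exact (hγ.integralCurve t ht).hasDerivAt (hγ.isOpen.mem_nhds ht)
  have hsub := hu.subsingleton_hits hfield hcone hc hγ.ordConnected hγ.mapsTo hderiv
  rintro _ ⟨⟨s, hs, rfl⟩, hsE⟩ _ ⟨⟨t, ht, rfl⟩, htE⟩
  rw [hsub ⟨hs, hsE.1⟩ ⟨ht, htE.1⟩]

end Multiplicity

end CoflatCone

end

open CoflatCone in
theorem proposition5p1 (m : ℕ) (M : Set (Eu (m + 2))) (ξ : Eu (m + 2) → MVec (m + 2) m)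
    (hM : IsSubmanifold m M) (hMc : IsCompact M) (hMs : M ⊆ Metric.sphere 0 1)
    (hξ : IsOrientation M ξ)
    (w : Eu (m + 2) → Covec (m + 2) (m + 1)) (S : Set (Eu (m + 2)))
    (hw : IsCoflatCalibration (Metric.ball 0 1) w S)
    (hcal : IsCalibratedBy (fundCurrent M ξ) w (Metric.ball 0 1)
      (coneOver M ∩ Metric.closedBall 0 1)) :
    MultOne (perp w) (Metric.ball 0 1 \ S) (coneOver M ∩ Metric.closedBall 0 1) ∧
      IsCalibratedMultOne (fundCurrent M ξ) w S (Metric.ball 0 1)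
        (coneOver M ∩ Metric.closedBall 0 1) := by
  have h : MultOne (perp w) (Metric.ball 0 1 \ S) (coneOver M ∩ Metric.closedBall 0 1) :=
    ⟨hcal.multLeOne hM hMc hMs hw, multGeOne_of_contDiffOn hw.isOpen_regular hw.contDiffOn_perp⟩
  exact ⟨h, hcal, h⟩
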